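/- All graphs are finite and simple. For a graph $F$ let \[ m_2(F) = \max\left( \left\{ \frac{e_{F'}-1}{v_{F'}-2} : \emptyset \neq F' \subseteq F,\ v_{F'} \ge 3 \right\} \cup \left\{\tfrac12\right\} \right), \] where $v_{F'}$ and $e_{F'}$ are the numbers of vertices and edges of the subgraph $F'$, and for a nonempty finite family $\mathcal{F}$ of graphs let $m_2(\mathcal{F}) = \min\{ m_2(F) : F \in \mathcal{F}\}$. A graph $G$ is $2$-list-Ramsey with respect to $\mathcal{F}$ if one can assign to each edge of $G$ a list of two colours (different edges may have different lists) so that every colouring of the edges of $G$ from these lists contains a monochromatic copy of some $F \in \mathcal{F}$. Let $G_{n,p}$ be the binomial random graph on $n$ vertices in which each edge is present independently with probability $p$. Theorem ($0$-statement). For every nonempty finite family $\mathcal{F}$ of graphs with $m_2(\mathcal{F}) > 1$ there is a constant $c_0 > 0$ such that, for every sequence $p = p(n) \in [0,1]$ with $p(n) \le c_0 \cdot n^{-1/m_2(\mathcal{F})}$ for all sufficiently large $n$, \[ \lim_{n\to\infty} \Pr\left( G_{n,p(n)} \text{ is } 2\text{-list-Ramsey with respect to } \mathcal{F} \right) = 0.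 \] -/

import Mathlib

open Filter Topology unitInterval
open scoped SimpleGraph

namespace ListRamsey

/-- The set of numbers `(e_{F'} - 1) / (v_{F'} - 2)`, over the nonempty (not necessarily induced)
subgraphs `F'` of `F` with at least three vertices, together with `1 / 2`. -/
def twoDensities {V : Type*} (F : SimpleGraph V) : Set ℝ :=
  {x | ∃ F' : F.Subgraph, F'.verts.Nonempty ∧ 3 ≤ F'.verts.ncard ∧
    x = ((F'.edgeSet.ncard : ℝ) - 1) / ((F'.verts.ncard : ℝ) - 2)} ∪ {1 / 2}

/-- The maximum 2-density `m₂(F)` of a finite graph `F`. -/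
noncomputable def maxTwoDensity {V : Type*} (F : SimpleGraph V) : ℝ :=
  sSup (twoDensities F)

/-- For a finite graph, the supremum defining `m₂(F)` is a maximum. -/
theorem isGreatest_maxTwoDensity {V : Type*} [Finite V] (F : SimpleGraph V) :
    IsGreatest (twoDensities F) (maxTwoDensity F) := by
  have hfin : (twoDensities F).Finite := by
    refine Set.Finite.union ?_ (Set.finite_singleton _)
    refine (Set.finite_range (fun F' : F.Subgraph =>
      ((F'.edgeSet.ncard : ℝ) - 1) / ((F'.verts.ncard : ℝ) - 2))).subset ?_
    rintro x ⟨F', -, -, rfl⟩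
    exact ⟨F', rfl⟩
  have hne : (twoDensities F).Nonempty := ⟨1 / 2, Or.inr rfl⟩
  exact ⟨hne.csSup_mem hfin, fun x hx => le_csSup hfin.bddAbove hx⟩

/-- `m₂(𝓕)`, the minimum of `m₂(F)` over the members `F` of a finite nonempty family. -/
noncomputable def familyMaxTwoDensity {ι : Type*} {W : ι → Type*}
    (F : ∀ i, SimpleGraph (W i)) : ℝ :=
  ⨅ i, maxTwoDensity (F i)

/-- For a finite nonempty family, the infimum defining `m₂(𝓕)` is a minimum. -/
theorem isLeast_familyMaxTwoDensity {ι : Type*} [Finite ι] [Nonempty ι] {W : ι → Type*}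
    (F : ∀ i, SimpleGraph (W i)) :
    IsLeast (Set.range fun i => maxTwoDensity (F i)) (familyMaxTwoDensity F) :=
  ⟨(Set.range_nonempty _).csInf_mem (Set.finite_range _),
    fun _ hx => csInf_le (Set.finite_range _).bddBelow hx⟩

/-- `G` is `r`-list-Ramsey with respect to the family `F`: the edges of `G` can be given lists of
`r` colours each such that every colouring from these lists contains a monochromatic copy of some
member of `F`. Colours are natural numbers; as the graphs `G` considered are countable, this is no
restriction on the lists. `c.labelGraph k` is the graph formed by the edges of colour `k`, and
`⊑` is containment as a (not necessarily induced) subgraph. -/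
def IsListRamsey {ι : Type*} {W : ι → Type*} (F : ∀ i, SimpleGraph (W i)) (r : ℕ)
    {V : Type*} (G : SimpleGraph V) : Prop :=
  ∃ L : G.edgeSet → Finset ℕ, (∀ e, (L e).card = r) ∧
    ∀ c : G.EdgeLabeling ℕ, (∀ e, c e ∈ L e) → ∃ i, ∃ k, F i ⊑ c.labelGraph k

end ListRamsey

/-!
The proof has a deterministic and a probabilistic half. Write `m > 1` for the 2-density `m₂` of the
family.

**Sparse graphs can be coloured.** If every vertex set `Z` of a graph spans at most `m |Z|` edges,
then for any lists of two colours there is a colouring from the lists in which each colour class has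
fewer than `m (|Z| - 2) + 1` edges inside every `Z` with at least three vertices
(`exists_sparse_colouring`). Such a class contains no member of the family, since each member has a
subgraph with `e - 1 ≥ m (v - 2)`. The basic tool is a list version of the theorem of Nash-Williams:
Rado's theorem on independent transversals (`exists_transversal_of_submodular`), applied to a sum of
graphic matroids, one for each colour, gives a colouring in which each colour is a union of few
forests (`exists_forest_colouring`). This is enough for `m ≤ 3/2` and for `m > 5/2`. For
`2 < m ≤ 5/2` vertices of degree at most four (or five, in the extremal case) are coloured one after
the other. For `3/2 < m ≤ 2` it suffices that the classes have at most `4/3 (|Z| - 1)` edges inside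
`Z`; one contracts the parts of a vertex partition that maximizes the sum of the excesses
`e(P) - 2 (|P| - 1)`. If no partition reaches the excess of the whole graph, then this excess is one
or two and the proper subgraphs have smaller excess, so that a vertex of degree three or four can be
coloured last.

**The random graph.** In each member of the family choose a strictly balanced edge set of maximum
2-density (`exists_isPattern`). If the random graph is list-Ramsey, then a minimal uncolourable set
`H` of its edges is connected by copies of these patterns (`exists_copyConnected`), and by the first
half it contains a part on which the potential `m v - e` is negative. Attaching copies never
increases the potential, so it is negative on `H` itself. Hence, if `H` is explored from one of its
edges by attaching copies one by one, then the exploration either runs for `4 log n` steps or reaches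
a set of negative potential (`exists_explored`). The expected number of such explorations is small:
for `p ≤ c n ^ (-1 / m)` a copy that shares a single edge with the explored part contributes a factor
`O(c)`, and any other copy decreases the potential by a constant and therefore contributes a factor
`n ^ (-ε)` (`copy_weight_le`, `sum_copy_weight_le`), so the union bound `measure_explored_le` applies.
-/

namespace ListRamsey

/-! ### Rado's theorem and colourings by forests -/

/-- Rado's theorem for a monotone submodular function: a family satisfying the Hall-type condition
has a transversal satisfying it. As long as some `A i` has two elements, one of them can be
deleted, because two violated conditions would contradict submodularity. -/
theorem exists_transversal_of_submodular {ι τ : Type*} [DecidableEq ι] [DecidableEq τ]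
    [Nonempty τ] (f : Finset τ → ℕ) (hmono : Monotone f)
    (hsub : ∀ X Y, f (X ∪ Y) + f (X ∩ Y) ≤ f X + f Y) (U : Finset ι) (A : ι → Finset τ)
    (hne : ∀ i ∈ U, (A i).Nonempty) (hA : ∀ J ⊆ U, J.card ≤ f (J.biUnion A)) :
    ∃ x : ι → τ, (∀ i ∈ U, x i ∈ A i) ∧ ∀ J ⊆ U, J.card ≤ f (J.image x) := by
  induction h : ∑ i ∈ U, (A i).card using Nat.strong_induction_on generalizing A with
  | _ N ih =>
  by_cases hall : ∀ i ∈ U, (A i).card = 1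
  · have hex : ∀ i : ι, ∃ x : τ, i ∈ U → A i = {x} := by
      intro i
      by_cases hi : i ∈ U
      · obtain ⟨x, hx⟩ := Finset.card_eq_one.1 (hall i hi)
        exact ⟨x, fun _ => hx⟩
      · exact ⟨Classical.arbitrary τ, fun h => absurd h hi⟩
    choose x hx using hex
    refine ⟨x, fun i hi => by simp [hx i hi], fun J hJ => ?_⟩
    have : J.image x = J.biUnion A := by
      ext y
      simp only [Finset.mem_image, Finset.mem_biUnion]
      constructor
      · rintro ⟨i, hi, rfl⟩
        exact ⟨i, hi, by simp [hx i (hJ hi)]⟩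
      · rintro ⟨i, hi, hy⟩
        rw [hx i (hJ hi), Finset.mem_singleton] at hy
        exact ⟨i, hi, hy.symm⟩
    rw [this]
    exact hA J hJ
  push Not at hall
  obtain ⟨i, hi, hcard⟩ := hall
  have h2 : 1 < (A i).card := by
    have := (hne i hi).card_pos
    omega
  obtain ⟨x₁, hx₁, x₂, hx₂, hx⟩ := Finset.one_lt_card.1 h2
  have key : ∀ y ∈ A i,
      ¬ (∀ J ⊆ U, J.card ≤ f (J.biUnion (Function.update A i ((A i).erase y)))) →
      ∃ J ⊆ U, i ∉ J ∧ f ((A i).erase y ∪ J.biUnion A) ≤ J.card := by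
    intro y hy hn
    push Not at hn
    obtain ⟨J, hJ, hlt⟩ := hn
    have hiJ : i ∈ J := by
      by_contra hiJ
      have : J.biUnion (Function.update A i ((A i).erase y)) = J.biUnion A := by
        apply Finset.biUnion_congr rfl
        intro j hj
        rw [Function.update_of_ne]
        rintro rfl
        exact hiJ hj
      rw [this] at hlt
      exact absurd (hA J hJ) (by omega)
    refine ⟨J.erase i, (Finset.erase_subset _ _).trans hJ, Finset.notMem_erase _ _, ?_⟩
    have : J.biUnion (Function.update A i ((A i).erase y)) =
        (A i).erase y ∪ (J.erase i).biUnion A := by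
      conv_lhs => rw [← Finset.insert_erase hiJ]
      rw [Finset.biUnion_insert, Function.update_self]
      congr 1
      apply Finset.biUnion_congr rfl
      intro j hj
      rw [Function.update_of_ne (Finset.ne_of_mem_erase hj)]
    rw [this] at hlt
    rw [Finset.card_erase_of_mem hiJ]
    omega
  have step : ∀ y ∈ A i, ((A i).erase y).Nonempty →
      (∀ J ⊆ U, J.card ≤ f (J.biUnion (Function.update A i ((A i).erase y)))) →
      ∃ x : ι → τ, (∀ i ∈ U, x i ∈ A i) ∧ ∀ J ⊆ U, J.card ≤ f (J.image x) := by
    intro y hy hney hcond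
    have hlt : ∑ j ∈ U, (Function.update A i ((A i).erase y) j).card < N := by
      rw [← h]
      apply Finset.sum_lt_sum
      · intro j hj
        by_cases hji : j = i
        · subst hji
          rw [Function.update_self]
          exact Finset.card_le_card (Finset.erase_subset _ _)
        · rw [Function.update_of_ne hji]
      · exact ⟨i, hi, by rw [Function.update_self]; exact Finset.card_erase_lt_of_mem hy⟩
    obtain ⟨x, hx, hx'⟩ := ih _ hlt (Function.update A i ((A i).erase y)) (by
      intro j hj
      by_cases hji : j = i
      · subst hji
        rwa [Function.update_self]
      · rw [Function.update_of_ne hji]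
        exact hne j hj) hcond rfl
    refine ⟨x, fun j hj => ?_, hx'⟩
    have := hx j hj
    by_cases hji : j = i
    · subst hji
      rw [Function.update_self] at this
      exact Finset.mem_of_mem_erase this
    · rwa [Function.update_of_ne hji] at this
  by_contra hcon
  obtain ⟨J₁, hJ₁, hi₁, hf₁⟩ := key x₁ hx₁ fun h => hcon
    (step x₁ hx₁ ⟨x₂, Finset.mem_erase.2 ⟨hx.symm, hx₂⟩⟩ h)
  obtain ⟨J₂, hJ₂, hi₂, hf₂⟩ := key x₂ hx₂ fun h => hcon
    (step x₂ hx₂ ⟨x₁, Finset.mem_erase.2 ⟨hx, hx₁⟩⟩ h)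
  have h1 : (insert i (J₁ ∪ J₂)).card ≤
      f (((A i).erase x₁ ∪ J₁.biUnion A) ∪ ((A i).erase x₂ ∪ J₂.biUnion A)) := by
    refine (hA _ (Finset.insert_subset hi (Finset.union_subset hJ₁ hJ₂))).trans (hmono ?_)
    intro z hz
    simp only [Finset.mem_biUnion, Finset.mem_insert, Finset.mem_union, Finset.mem_erase] at hz ⊢
    obtain ⟨j, rfl | hj | hj, hz⟩ := hz
    · by_cases hzx : z = x₁
      · right; left; exact ⟨hzx ▸ hx, hz⟩
      · left; left; exact ⟨hzx, hz⟩
    · left; right; exact ⟨j, hj, hz⟩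
    · right; right; exact ⟨j, hj, hz⟩
  have h3 : (J₁ ∩ J₂).card ≤
      f (((A i).erase x₁ ∪ J₁.biUnion A) ∩ ((A i).erase x₂ ∪ J₂.biUnion A)) := by
    refine (hA _ (Finset.inter_subset_left.trans hJ₁)).trans (hmono ?_)
    intro z hz
    simp only [Finset.mem_biUnion, Finset.mem_inter, Finset.mem_union] at hz ⊢
    obtain ⟨j, ⟨hj1, hj2⟩, hz⟩ := hz
    exact ⟨Or.inr ⟨j, hj1, hz⟩, Or.inr ⟨j, hj2, hz⟩⟩
  have h4 := hsub ((A i).erase x₁ ∪ J₁.biUnion A) ((A i).erase x₂ ∪ J₂.biUnion A)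
  have h5 := Finset.card_union_add_card_inter J₁ J₂
  rw [Finset.card_insert_of_notMem (by simp [hi₁, hi₂])] at h1
  omega

section ForestColouring

variable {V : Type*} [Fintype V] [DecidableEq V]

/-- The vector of the edge `e = uv` after contracting along `π`: the difference of the unit vectors
at `π u` and `π v` (the sign, which depends on a choice of orientation, is irrelevant). -/
noncomputable def edgeVec (π : V → V) (e : Sym2 V) : V → ℚ :=
  Pi.single (π e.out.1) 1 - Pi.single (π e.out.2) 1

/-- The graphic rank of a set of edges in the multigraph obtained by contracting along `π`. -/
noncomputable def graphicRank (π : V → V) (X : Finset (Sym2 V)) : ℕ :=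
  Module.finrank ℚ (Submodule.span ℚ (edgeVec π '' (X : Set (Sym2 V))))

omit [Fintype V] [DecidableEq V] in
theorem map_eq_out (π : V → V) (e : Sym2 V) : e.map π = s(π e.out.1, π e.out.2) := by
  conv_lhs => rw [← Quot.out_eq e]
  rfl

theorem graphicRank_mono (π : V → V) : Monotone (graphicRank π) := fun _ _ h =>
  Submodule.finrank_mono (Submodule.span_mono (Set.image_mono (Finset.coe_subset.2 h)))

theorem graphicRank_submodular (π : V → V) (X Y : Finset (Sym2 V)) :
    graphicRank π (X ∪ Y) + graphicRank π (X ∩ Y) ≤ graphicRank π X + graphicRank π Y := by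
  unfold graphicRank
  rw [Finset.coe_union, Set.image_union, Submodule.span_union]
  have h : Submodule.span ℚ (edgeVec π '' ((X ∩ Y : Finset (Sym2 V)) : Set (Sym2 V))) ≤
      Submodule.span ℚ (edgeVec π '' (X : Set (Sym2 V))) ⊓
        Submodule.span ℚ (edgeVec π '' (Y : Set (Sym2 V))) :=
    le_inf (Submodule.span_mono (Set.image_mono (by simp)))
      (Submodule.span_mono (Set.image_mono (by simp)))
  rw [← Submodule.finrank_sup_add_finrank_inf_eq (Submodule.span ℚ (edgeVec π '' X))
    (Submodule.span ℚ (edgeVec π '' Y))]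
  exact Nat.add_le_add_left (Submodule.finrank_mono h) _

/-- A connected component on the vertex set `C` has rank at most `|C| - 1`: its edge vectors are
combinations of the differences of unit vectors to a fixed vertex of `C`. -/
theorem graphicRank_le (π : V → V) {X : Finset (Sym2 V)} {C : Finset V} (hC : C.Nonempty)
    (h : ∀ e ∈ X, e.map π ∈ C.sym2) : graphicRank π X ≤ C.card - 1 := by
  obtain ⟨z, hz⟩ := hC
  set w : V → (V → ℚ) := fun u => Pi.single u 1 - Pi.single z 1 with hw
  have hmem : ∀ u ∈ C, w u ∈ Submodule.span ℚ (((C.erase z).image w : Finset (V → ℚ)) :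
      Set (V → ℚ)) := by
    intro u hu
    by_cases huz : u = z
    · simp [hw, huz]
    · refine Submodule.subset_span ?_
      rw [Finset.coe_image]
      exact ⟨u, by simp [hu, huz], rfl⟩
  have hle : Submodule.span ℚ (edgeVec π '' (X : Set (Sym2 V))) ≤
      Submodule.span ℚ (((C.erase z).image w : Finset (V → ℚ)) : Set (V → ℚ)) := by
    rw [Submodule.span_le]
    rintro _ ⟨e, he, rfl⟩
    have := h e he
    rw [map_eq_out, Finset.mk_mem_sym2_iff] at this
    have h2 := Submodule.sub_mem _ (hmem _ this.1) (hmem _ this.2)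
    simpa [hw, edgeVec] using h2
  calc graphicRank π X ≤ _ := Submodule.finrank_mono hle
    _ ≤ ((C.erase z).image w).card := finrank_span_finset_le_card _
    _ ≤ (C.erase z).card := Finset.card_image_le
    _ = C.card - 1 := Finset.card_erase_of_mem hz

/-- If a multigraph has at most `s (|C| - 1)` edges inside every vertex set `C`, then it has at most
`s` times as many edges as its rank: sum over the flats spanned by its components. -/
theorem card_le_mul_graphicRank (π : V → V) (s : ℕ) (Y : Finset (Sym2 V))
    (h : ∀ C : Finset V, C.Nonempty →
      (Y.filter fun e => e.map π ∈ C.sym2).card ≤ s * (C.card - 1)) :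
    Y.card ≤ s * graphicRank π Y := by
  classical
  set M := Submodule.span ℚ (edgeVec π '' (Y : Set (Sym2 V))) with hM
  let r : Setoid V :=
    { r := fun u v => (Pi.single u 1 - Pi.single v 1 : V → ℚ) ∈ M
      iseqv :=
        { refl := fun u => by simp
          symm := fun {u v} huv => by simpa using M.neg_mem huv
          trans := fun {u v x} h1 h2 => by simpa using M.add_mem h1 h2 } }
  let cl : Quotient r → Finset V := fun q => Finset.univ.filter fun v => Quotient.mk r v = q
  have hne : ∀ q, (cl q).Nonempty := fun q => by
    obtain ⟨v, hv⟩ := Quotient.exists_rep q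
    exact ⟨v, by simp [cl, hv]⟩
  have hsum : ∑ q, (cl q).card = Fintype.card V := by
    rw [← Finset.card_univ]
    exact (Finset.card_eq_sum_card_fiberwise (f := fun v => Quotient.mk r v)
      (fun _ _ => Finset.mem_coe.2 (Finset.mem_univ _))).symm
  have hcard : Y.card ≤ ∑ q, (Y.filter fun e => e.map π ∈ (cl q).sym2).card := by
    rw [Finset.card_eq_sum_card_fiberwise (f := fun e : Sym2 V => Quotient.mk r (π e.out.1))
      (t := Finset.univ) (fun _ _ => Finset.mem_coe.2 (Finset.mem_univ _))]
    refine Finset.sum_le_sum fun q _ => Finset.card_le_card fun e he => ?_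
    simp only [Finset.mem_filter] at he ⊢
    refine ⟨he.1, ?_⟩
    rw [map_eq_out, Finset.mk_mem_sym2_iff]
    refine ⟨by simp [cl, he.2], ?_⟩
    simp only [cl, Finset.mem_filter, Finset.mem_univ, true_and]
    rw [← he.2]
    refine Quotient.sound (r.symm ?_)
    exact Submodule.subset_span ⟨e, he.1, rfl⟩
  have hrank : Fintype.card V ≤ graphicRank π Y + Fintype.card (Quotient r) := by
    let R : Submodule ℚ (V → ℚ) := Submodule.span ℚ
      ((Finset.univ.image fun q : Quotient r => (Pi.single q.out 1 : V → ℚ) :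
        Finset (V → ℚ)) : Set (V → ℚ))
    have htop : (⊤ : Submodule ℚ (V → ℚ)) ≤ M ⊔ R := by
      rw [← (Pi.basisFun ℚ V).span_eq, Submodule.span_le]
      rintro _ ⟨v, rfl⟩
      rw [Pi.basisFun_apply]
      have h1 : (Pi.single v 1 - Pi.single (Quotient.mk r v).out 1 : V → ℚ) ∈ M :=
        r.symm (Quotient.mk_out v)
      have h2 : (Pi.single (Quotient.mk r v).out 1 : V → ℚ) ∈ R :=
        Submodule.subset_span (by simp)
      simpa using Submodule.add_mem_sup h1 h2
    calc Fintype.card V = Module.finrank ℚ (⊤ : Submodule ℚ (V → ℚ)) := by simp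
      _ ≤ Module.finrank ℚ (M ⊔ R : Submodule ℚ (V → ℚ)) := Submodule.finrank_mono htop
      _ ≤ Module.finrank ℚ M + Module.finrank ℚ R :=
        Submodule.finrank_add_le_finrank_add_finrank _ _
      _ ≤ _ := by
        refine Nat.add_le_add le_rfl ?_
        exact (finrank_span_finset_le_card _).trans Finset.card_image_le
  calc Y.card ≤ ∑ q, s * ((cl q).card - 1) :=
        hcard.trans (Finset.sum_le_sum fun q _ => h _ (hne q))
    _ = s * (Fintype.card V - Fintype.card (Quotient r)) := by
      rw [← Finset.mul_sum, Finset.sum_tsub_distrib _ fun q _ => (hne q).card_pos, hsum]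
      simp
    _ ≤ _ := Nat.mul_le_mul le_rfl (by omega)

/-- List colouring by `t` forests per colour. If the multigraph of edges not collapsed by `π` has at
most `2 t (|C| - 1)` edges inside every vertex set `C`, then these edges can be coloured from lists
of two colours such that each colour has at most `t (|C| - 1)` edges inside every `C`. -/
theorem exists_forest_colouring (E : Finset (Sym2 V)) (L : Sym2 V → Finset ℕ)
    (hL : ∀ e, (L e).card = 2) (π : V → V) (t : ℕ)
    (h : ∀ C : Finset V, C.Nonempty →
      (E.filter fun e => ¬ (e.map π).IsDiag ∧ e.map π ∈ C.sym2).card ≤ 2 * t * (C.card - 1)) :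
    ∃ c : Sym2 V → ℕ, (∀ e, c e ∈ L e) ∧ ∀ k, ∀ C : Finset V, C.Nonempty →
      (E.filter fun e => c e = k ∧ ¬ (e.map π).IsDiag ∧ e.map π ∈ C.sym2).card
        ≤ t * (C.card - 1) := by
  classical
  have hLne : ∀ e, (L e).Nonempty := fun e => Finset.card_pos.1 (by rw [hL]; norm_num)
  rcases isEmpty_or_nonempty (Sym2 V) with hV | hV
  · exact ⟨fun _ => 0, fun e => (hV.false e).elim,
      fun k C hC => (hV.false s(hC.choose, hC.choose)).elim⟩
  -- Rado's theorem is applied to the sets of pairs `(e, k)` with `k ∈ L e`, and to the sum over the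
  -- colours of `t` times the rank of the edges of this colour.
  set U := E.filter fun e => ¬ (e.map π).IsDiag with hU
  set K := E.biUnion L with hK
  let sl : Finset (Sym2 V × ℕ) → ℕ → Finset (Sym2 V) := fun X k =>
    (X.filter fun y => y.2 = k).image Prod.fst
  let f : Finset (Sym2 V × ℕ) → ℕ := fun X => ∑ k ∈ K, t * graphicRank π (sl X k)
  have hmem : ∀ X k e, e ∈ sl X k ↔ (e, k) ∈ X := by
    intro X k e
    simp only [sl, Finset.mem_image, Finset.mem_filter]
    constructor
    · rintro ⟨⟨a, b⟩, ⟨h1, rfl⟩, rfl⟩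
      exact h1
    · intro h
      exact ⟨(e, k), ⟨h, rfl⟩, rfl⟩
  have hmono : Monotone f := by
    intro X Y hXY
    refine Finset.sum_le_sum fun k _ => Nat.mul_le_mul le_rfl (graphicRank_mono π ?_)
    intro e he
    rw [hmem] at he ⊢
    exact hXY he
  have hsub : ∀ X Y, f (X ∪ Y) + f (X ∩ Y) ≤ f X + f Y := by
    intro X Y
    simp only [f]
    rw [← Finset.sum_add_distrib, ← Finset.sum_add_distrib]
    refine Finset.sum_le_sum fun k _ => ?_
    have h1 : sl (X ∪ Y) k = sl X k ∪ sl Y k := by ext e; simp [hmem]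
    have h2 : sl (X ∩ Y) k = sl X k ∩ sl Y k := by ext e; simp [hmem]
    rw [h1, h2, ← mul_add, ← mul_add]
    exact Nat.mul_le_mul le_rfl (graphicRank_submodular π _ _)
  obtain ⟨x, hx, hx'⟩ := exists_transversal_of_submodular f hmono hsub U
    (fun e => (L e).image fun k => (e, k)) (fun e _ => (hLne e).image _) (by
      intro J hJ
      have hJE : J ⊆ E := hJ.trans (Finset.filter_subset _ _)
      -- every edge of `J` has two colours, so the colours' parts of `J` have total size `2 |J|`
      have hdc : ∑ k ∈ K, (J.filter fun e => k ∈ L e).card = 2 * J.card := by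
        refine (Finset.sum_card_bipartiteAbove_eq_sum_card_bipartiteBelow
          (fun e k => k ∈ L e)).symm.trans ?_
        rw [Finset.sum_const_nat (m := 2), mul_comm]
        intro e he
        rw [← hL e]
        congr 1
        ext k
        simp only [Finset.bipartiteAbove, Finset.mem_filter, and_iff_right_iff_imp]
        exact fun hk => Finset.mem_biUnion.2 ⟨e, hJE he, hk⟩
      have hsl : ∀ k, sl (J.biUnion fun e => (L e).image fun k => (e, k)) k =
          J.filter fun e => k ∈ L e := by
        intro k
        ext e
        rw [hmem]
        simp
      have h2 : 2 * J.card ≤ 2 * f (J.biUnion fun e => (L e).image fun k => (e, k)) := by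
        rw [← hdc, Finset.mul_sum]
        refine Finset.sum_le_sum fun k _ => ?_
        rw [hsl, ← mul_assoc]
        refine card_le_mul_graphicRank π (2 * t) _ fun C hC => ?_
        refine (Finset.card_le_card ?_).trans (h C hC)
        intro e he
        simp only [Finset.mem_filter] at he ⊢
        have := hJ he.1.1
        rw [hU, Finset.mem_filter] at this
        exact ⟨this.1, this.2, he.2⟩
      omega)
  choose y hy using fun e => hLne e
  have hx1 : ∀ e ∈ U, (x e).1 = e ∧ (x e).2 ∈ L e := by
    intro e he
    have := hx e he
    rw [Finset.mem_image] at this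
    obtain ⟨k, hk, hk'⟩ := this
    rw [← hk']
    exact ⟨rfl, hk⟩
  refine ⟨fun e => if e ∈ U then (x e).2 else y e, fun e => ?_, fun k C hC => ?_⟩
  · dsimp only
    split_ifs with he
    · exact (hx1 e he).2
    · exact hy e
  set J := E.filter fun e => (if e ∈ U then (x e).2 else y e) = k ∧ ¬ (e.map π).IsDiag ∧
    e.map π ∈ C.sym2 with hJ
  have hJU : J ⊆ U := by
    intro e he
    rw [hJ, Finset.mem_filter] at he
    rw [hU, Finset.mem_filter]
    exact ⟨he.1, he.2.2.1⟩
  have hxJ : ∀ e ∈ J, x e = (e, k) := by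
    intro e he
    have h1 := hx1 e (hJU he)
    have h2 := he
    rw [hJ, Finset.mem_filter, if_pos (hJU he)] at h2
    exact Prod.ext h1.1 h2.2.1
  have hslk : ∀ j, sl (J.image x) j = if j = k then J else ∅ := by
    intro j
    ext e
    rw [hmem, Finset.mem_image]
    constructor
    · rintro ⟨e', he', h'⟩
      rw [hxJ e' he'] at h'
      obtain ⟨rfl, rfl⟩ := Prod.mk.inj h'
      simpa using he'
    · intro h'
      split_ifs at h' with hj
      · subst hj
        exact ⟨e, h', hxJ e h'⟩
      · simp at h'
  have hr0 : graphicRank π ∅ = 0 := by simp [graphicRank]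
  calc J.card ≤ f (J.image x) := hx' J hJU
    _ ≤ t * graphicRank π J := by
      simp only [f, hslk]
      by_cases hk : k ∈ K
      · rw [Finset.sum_eq_single_of_mem k hk]
        · simp
        · intro j _ hj
          simp [hj, hr0]
      · rw [Finset.sum_eq_zero]
        · exact Nat.zero_le _
        · intro j hj
          rw [if_neg (by rintro rfl; exact hk hj), hr0, mul_zero]
    _ ≤ t * (C.card - 1) := by
      refine Nat.mul_le_mul le_rfl (graphicRank_le π hC fun e he => ?_)
      rw [hJ, Finset.mem_filter] at he
      exact he.2.2.2

end ForestColouring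

/-! ### Counting edges inside vertex sets -/

section Counting

variable {V : Type*} [DecidableEq V]

/-- The number of edges of `E` with both ends in `Z`. -/
def edgesIn (E : Finset (Sym2 V)) (Z : Finset V) : ℕ := (E.filter fun e => e ∈ Z.sym2).card

/-- The number of neighbours of `v` in `Z`, with respect to the edge set `E`. -/
def degIn (E : Finset (Sym2 V)) (v : V) (Z : Finset V) : ℕ := (Z.filter fun u => s(v, u) ∈ E).card

/-- The edges of colour `k`. -/
def colourClass (E : Finset (Sym2 V)) (c : Sym2 V → ℕ) (k : ℕ) : Finset (Sym2 V) :=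
  E.filter fun e => c e = k

omit [DecidableEq V] in
theorem colourClass_subset (E : Finset (Sym2 V)) (c : Sym2 V → ℕ) (k : ℕ) :
    colourClass E c k ⊆ E := Finset.filter_subset _ _

theorem edgesIn_mono {E E' : Finset (Sym2 V)} {Z Z' : Finset V} (hE : E ⊆ E') (hZ : Z ⊆ Z') :
    edgesIn E Z ≤ edgesIn E' Z' := by
  refine Finset.card_le_card fun e he => ?_
  rw [Finset.mem_filter] at he ⊢
  exact ⟨hE he.1, Finset.sym2_mono hZ he.2⟩

theorem edgesIn_insert {E : Finset (Sym2 V)} (hE : ∀ e ∈ E, ¬ e.IsDiag) {v : V} {Z : Finset V}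
    (hv : v ∉ Z) : edgesIn E (insert v Z) = edgesIn E Z + degIn E v Z := by
  unfold edgesIn degIn
  have hinj : Set.InjOn (fun u => s(v, u)) (Z.filter fun u => s(v, u) ∈ E : Finset V) := by
    intro a _ b _ hab
    exact Sym2.congr_right.1 hab
  rw [← Finset.card_image_of_injOn hinj, ← Finset.card_union_of_disjoint]
  · congr 1
    ext e
    induction e with
    | _ a b =>
    simp only [Finset.mem_filter, Finset.mk_mem_sym2_iff, Finset.mem_insert, Finset.mem_union,
      Finset.mem_image, Sym2.eq_iff]
    constructor
    · rintro ⟨h, rfl | ha, rfl | hb⟩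
      · exact absurd h (fun h => hE _ h (by simp))
      · exact Or.inr ⟨b, ⟨hb, h⟩, Or.inl ⟨rfl, rfl⟩⟩
      · exact Or.inr ⟨a, ⟨ha, by rwa [Sym2.eq_swap]⟩, Or.inr ⟨rfl, rfl⟩⟩
      · exact Or.inl ⟨h, ha, hb⟩
    · rintro (⟨h, ha, hb⟩ | ⟨u, ⟨hu, h⟩, ⟨rfl, rfl⟩ | ⟨rfl, rfl⟩⟩)
      · exact ⟨h, Or.inr ha, Or.inr hb⟩
      · exact ⟨h, Or.inl rfl, Or.inr hu⟩
      · exact ⟨by rwa [Sym2.eq_swap], Or.inr hu, Or.inl rfl⟩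
  · rw [Finset.disjoint_left]
    intro e he he'
    simp only [Finset.mem_filter, Finset.mem_image] at he he'
    obtain ⟨u, _, rfl⟩ := he'
    exact hv (Finset.mk_mem_sym2_iff.1 he.2).1

theorem edgesIn_erase {E : Finset (Sym2 V)} (hE : ∀ e ∈ E, ¬ e.IsDiag) {v : V} {Z : Finset V}
    (hv : v ∈ Z) : edgesIn E Z = edgesIn E (Z.erase v) + degIn E v (Z.erase v) := by
  rw [← edgesIn_insert hE (Finset.notMem_erase v Z), Finset.insert_erase hv]

theorem degIn_insert_self {E : Finset (Sym2 V)} (hE : ∀ e ∈ E, ¬ e.IsDiag) (v : V) (Z : Finset V) :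
    degIn E v (insert v Z) = degIn E v Z := by
  unfold degIn
  rw [Finset.filter_insert, if_neg fun h => hE _ h (by simp)]

theorem degIn_erase_self {E : Finset (Sym2 V)} (hE : ∀ e ∈ E, ¬ e.IsDiag) {v : V} {Z : Finset V}
    (hv : v ∈ Z) : degIn E v (Z.erase v) = degIn E v Z := by
  rw [← degIn_insert_self hE, Finset.insert_erase hv]

theorem edgesIn_empty (E : Finset (Sym2 V)) : edgesIn E ∅ = 0 := by simp [edgesIn]

theorem sum_degIn {E : Finset (Sym2 V)} (hE : ∀ e ∈ E, ¬ e.IsDiag) (Z : Finset V) :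
    ∑ v ∈ Z, degIn E v Z = 2 * edgesIn E Z := by
  induction Z using Finset.induction_on with
  | empty => simp [edgesIn_empty]
  | insert v Z hv ih =>
    have hstep : ∀ u ∈ Z, degIn E u (insert v Z) = degIn E u Z + if s(v, u) ∈ E then 1 else 0 := by
      intro u _
      unfold degIn
      rw [Finset.filter_insert, Sym2.eq_swap]
      split_ifs with h
      · rw [Finset.card_insert_of_notMem (by simp [hv])]
      · rfl
    rw [Finset.sum_insert hv, Finset.sum_congr rfl hstep, Finset.sum_add_distrib, ih,
      degIn_insert_self hE, edgesIn_insert hE hv, ← Finset.card_filter]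
    change degIn E v Z + (_ + degIn E v Z) = _
    ring

theorem degIn_le_card_sub_one {E : Finset (Sym2 V)} (hE : ∀ e ∈ E, ¬ e.IsDiag) {v : V}
    {Z : Finset V} (hv : v ∈ Z) : degIn E v Z ≤ Z.card - 1 := by
  rw [← degIn_erase_self hE hv, ← Finset.card_erase_of_mem hv]
  exact Finset.card_filter_le _ _

theorem two_mul_edgesIn_le {E : Finset (Sym2 V)} (hE : ∀ e ∈ E, ¬ e.IsDiag) (Z : Finset V) :
    2 * edgesIn E Z ≤ Z.card * (Z.card - 1) := by
  rw [← sum_degIn hE, ← smul_eq_mul, ← Finset.sum_const]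
  exact Finset.sum_le_sum fun v hv => degIn_le_card_sub_one hE hv

/-- Some vertex has at most average degree. -/
theorem exists_degIn_mul_card_le {E : Finset (Sym2 V)} (hE : ∀ e ∈ E, ¬ e.IsDiag) {Z : Finset V}
    (hZ : Z.Nonempty) : ∃ v ∈ Z, degIn E v Z * Z.card ≤ 2 * edgesIn E Z := by
  obtain ⟨v, hv, hmin⟩ := Finset.exists_min_image Z (fun v => degIn E v Z) hZ
  refine ⟨v, hv, ?_⟩
  rw [← sum_degIn hE, mul_comm, ← smul_eq_mul]
  exact Finset.card_nsmul_le_sum _ _ _ hmin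

/-- Recolouring the edges at `v`: the edge `vu` gets the colour `g u`. -/
theorem exists_recolour {E : Finset (Sym2 V)} (hE : ∀ e ∈ E, ¬ e.IsDiag) {L : Sym2 V → Finset ℕ}
    {c : Sym2 V → ℕ} (hc : ∀ e, c e ∈ L e) (v : V) {g : V → ℕ} (hg : ∀ u, g u ∈ L s(v, u)) :
    ∃ c' : Sym2 V → ℕ, (∀ e, c' e ∈ L e) ∧
      (∀ k Z, v ∉ Z → edgesIn (colourClass E c' k) Z = edgesIn (colourClass E c k) Z) ∧
      ∀ k Z, v ∈ Z → edgesIn (colourClass E c' k) Z = edgesIn (colourClass E c k) (Z.erase v) +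
        ((Z.erase v).filter fun u => s(v, u) ∈ E ∧ g u = k).card := by
  classical
  set c' : Sym2 V → ℕ := fun e => if h : v ∈ e then g (Sym2.Mem.other h) else c e with hc'
  have hstar : ∀ u, c' s(v, u) = g u := by
    intro u
    have h : v ∈ s(v, u) := Sym2.mem_mk_left v u
    have h2 := Sym2.other_spec h
    rw [hc']
    dsimp only
    rw [dif_pos h, Sym2.congr_right.1 h2]
  have hout : ∀ k Z, v ∉ Z → edgesIn (colourClass E c' k) Z = edgesIn (colourClass E c k) Z := by
    intro k Z hv
    unfold edgesIn colourClass
    rw [Finset.filter_filter, Finset.filter_filter]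
    congr 1
    refine Finset.filter_congr fun e _ => and_congr_left fun he => ?_
    rw [hc']
    dsimp only
    rw [dif_neg fun h => hv (Finset.mem_sym2_iff.1 he v h)]
  refine ⟨c', fun e => ?_, hout, fun k Z hv => ?_⟩
  · rw [hc']
    dsimp only
    split_ifs with h
    · have h1 := hg (Sym2.Mem.other h)
      rwa [Sym2.other_spec h] at h1
    · exact hc e
  · rw [edgesIn_erase (fun e he => hE e (colourClass_subset _ _ _ he)) hv,
      hout k _ (Finset.notMem_erase v Z)]
    congr 1
    unfold degIn colourClass
    congr 1
    refine Finset.filter_congr fun u _ => ?_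
    rw [Finset.mem_filter, hstar]

/-- Sets of vertices without edges between them. -/
theorem edgesIn_eq_add_of_split {E : Finset (Sym2 V)} {Z A : Finset V}
    (h : ∀ a ∈ Z, ∀ b ∈ Z, s(a, b) ∈ E → (a ∈ A ↔ b ∈ A)) :
    edgesIn E Z = edgesIn E (Z ∩ A) + edgesIn E (Z \ A) := by
  unfold edgesIn
  rw [← Finset.card_union_of_disjoint]
  · congr 1
    ext e
    induction e with
    | _ a b =>
    simp only [Finset.mem_filter, Finset.mk_mem_sym2_iff, Finset.mem_union, Finset.mem_inter,
      Finset.mem_sdiff]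
    constructor
    · rintro ⟨he, ha, hb⟩
      have := h a ha b hb he
      tauto
    · tauto
  · rw [Finset.disjoint_left]
    intro e
    induction e with
    | _ a b =>
    simp only [Finset.mem_filter, Finset.mk_mem_sym2_iff, Finset.mem_inter, Finset.mem_sdiff]
    tauto

end Counting

/-! ### Contractions -/

section Contraction

variable {V : Type*} [Fintype V] [DecidableEq V]

omit [Fintype V] in
/-- Edges inside `Z`, sorted into those inside a fibre of `π` and those joining two fibres. -/
theorem edgesIn_eq_sum_fibres (E : Finset (Sym2 V)) (π : V → V) (Z : Finset V) :
    edgesIn E Z = ∑ y ∈ Z.image π, edgesIn E (Z.filter fun v => π v = y) +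
      (E.filter fun e => e ∈ Z.sym2 ∧ ¬ (e.map π).IsDiag).card := by
  have h1 : ∑ y ∈ Z.image π, edgesIn E (Z.filter fun v => π v = y) =
      (E.filter fun e => e ∈ Z.sym2 ∧ (e.map π).IsDiag).card := by
    rw [Finset.card_eq_sum_card_fiberwise (f := fun e : Sym2 V => π e.out.1) (t := Z.image π)]
    · refine Finset.sum_congr rfl fun y _ => ?_
      unfold edgesIn
      rw [Finset.filter_filter]
      congr 1
      refine Finset.filter_congr fun e _ => ?_
      rw [map_eq_out]
      have he : e = s(e.out.1, e.out.2) := (Quot.out_eq e).symm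
      rw [Sym2.mk_isDiag_iff]
      have hm : ∀ T : Finset V, e ∈ T.sym2 ↔ e.out.1 ∈ T ∧ e.out.2 ∈ T := by
        intro T
        conv_lhs => rw [he]
        exact Finset.mk_mem_sym2_iff
      rw [hm, hm]
      simp only [Finset.mem_filter]
      constructor
      · rintro ⟨⟨a, b⟩, c, d⟩
        exact ⟨⟨⟨a, c⟩, b.trans d.symm⟩, b⟩
      · rintro ⟨⟨⟨a, c⟩, b⟩, d⟩
        exact ⟨⟨a, d⟩, c, b.symm.trans d⟩
    · intro e he
      simp only [Finset.coe_filter, Set.mem_ofPred_eq] at he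
      rw [Finset.mem_coe]
      refine Finset.mem_image_of_mem _ (Finset.mem_sym2_iff.1 he.2.1 _ ?_)
      exact Sym2.out_fst_mem e
  rw [h1, ← Finset.card_union_of_disjoint]
  · unfold edgesIn
    congr 1
    ext e
    simp only [Finset.mem_filter, Finset.mem_union]
    tauto
  · rw [Finset.disjoint_left]
    intro e
    simp only [Finset.mem_filter]
    tauto

/-- Every colour class `k` has at most `α k * (|Z| - 1)` edges inside every nonempty `Z ⊆ S`. For
`α k = 1` this says that the colour class `k` is a forest on `S`. -/
def SparseOn (E : Finset (Sym2 V)) (c : Sym2 V → ℕ) (α : ℕ → ℚ) (S : Finset V) : Prop :=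
  ∀ k, ∀ Z ⊆ S, Z.Nonempty → (edgesIn (colourClass E c k) Z : ℚ) ≤ α k * (Z.card - 1)

/-- A colouring which is sparse on the fibres of `π` extends to one sparse on `S`, provided that the
multigraph obtained by contracting the fibres is sparse enough to be list coloured by forests. -/
theorem exists_sparseOn_of_contraction {E : Finset (Sym2 V)} {L : Sym2 V → Finset ℕ}
    (hL : ∀ e, (L e).card = 2) {S : Finset V} (π : V → V) {c₀ : Sym2 V → ℕ}
    (hc₀ : ∀ e, c₀ e ∈ L e) {α : ℕ → ℚ} (hα : ∀ k, 1 ≤ α k)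
    (hfib : ∀ y ∈ S.image π, SparseOn E c₀ α (S.filter fun v => π v = y))
    (h : ∀ C ⊆ S.image π, C.Nonempty →
      (E.filter fun e => e ∈ (S.filter fun v => π v ∈ C).sym2 ∧ ¬ (e.map π).IsDiag).card
        ≤ 2 * (C.card - 1)) :
    ∃ c : Sym2 V → ℕ, (∀ e, c e ∈ L e) ∧ SparseOn E c α S := by
  classical
  obtain ⟨c₁, hc₁, hsp⟩ := exists_forest_colouring (E.filter fun e => e ∈ S.sym2) L hL π 1 (by
    intro C _
    rcases (C ∩ S.image π).eq_empty_or_nonempty with hemp | hne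
    · rw [Finset.card_eq_zero.2]
      · exact Nat.zero_le _
      · rw [Finset.filter_eq_empty_iff]
        intro e he hcon
        rw [Finset.mem_filter] at he
        have hx := Sym2.out_fst_mem e
        have : π e.out.1 ∈ C ∩ S.image π := by
          refine Finset.mem_inter.2 ⟨Finset.mem_sym2_iff.1 hcon.2 _ ?_,
            Finset.mem_image_of_mem _ (Finset.mem_sym2_iff.1 he.2 _ hx)⟩
          exact Sym2.mem_map.2 ⟨_, hx, rfl⟩
        rw [hemp] at this
        simp at this
    · refine le_trans (Finset.card_le_card ?_) ((h _ Finset.inter_subset_right hne).trans ?_)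
      · intro e he
        rw [Finset.mem_filter, Finset.mem_filter] at he
        rw [Finset.mem_filter]
        refine ⟨he.1.1, Finset.mem_sym2_iff.2 fun a ha => ?_, he.2.1⟩
        have haS := Finset.mem_sym2_iff.1 he.1.2 a ha
        rw [Finset.mem_filter, Finset.mem_inter]
        exact ⟨haS, Finset.mem_sym2_iff.1 he.2.2 _ (Sym2.mem_map.2 ⟨a, ha, rfl⟩),
          Finset.mem_image_of_mem _ haS⟩
      · have := Finset.card_le_card (Finset.inter_subset_left : C ∩ S.image π ⊆ C)
        omega)
  refine ⟨fun e => if (e.map π).IsDiag then c₀ e else c₁ e, fun e => ?_, fun k Z hZ hne => ?_⟩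
  · dsimp only
    split_ifs
    · exact hc₀ e
    · exact hc₁ e
  set c : Sym2 V → ℕ := fun e => if (e.map π).IsDiag then c₀ e else c₁ e with hc
  rw [edgesIn_eq_sum_fibres _ π]
  have hcross : ((colourClass E c k).filter fun e => e ∈ Z.sym2 ∧ ¬ (e.map π).IsDiag).card ≤
      (Z.image π).card - 1 := by
    refine (Finset.card_le_card ?_).trans ((hsp k (Z.image π) (hne.image π)).trans (by simp))
    intro e he
    rw [colourClass, Finset.mem_filter, Finset.mem_filter] at he
    rw [Finset.mem_filter, Finset.mem_filter]
    refine ⟨⟨he.1.1, Finset.sym2_mono hZ he.2.1⟩, ?_, he.2.2, ?_⟩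
    · have := he.1.2
      rw [hc] at this
      dsimp only at this
      rwa [if_neg he.2.2] at this
    · rw [Finset.mem_sym2_iff]
      intro a ha
      obtain ⟨b, hb, rfl⟩ := Sym2.mem_map.1 ha
      exact Finset.mem_image_of_mem _ (Finset.mem_sym2_iff.1 he.2.1 b hb)
  have hpart : ∀ y ∈ Z.image π, (edgesIn (colourClass E c k) (Z.filter fun v => π v = y) : ℚ) ≤
      α k * ((Z.filter fun v => π v = y).card - 1) := by
    intro y hy
    obtain ⟨v, hv, rfl⟩ := Finset.mem_image.1 hy
    have h1 := hfib (π v) (Finset.mem_image_of_mem _ (hZ hv)) k (Z.filter fun u => π u = π v)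
      (Finset.filter_subset_filter _ hZ) ⟨v, by simp [hv]⟩
    refine le_trans ?_ h1
    rw [Nat.cast_le]
    refine Finset.card_le_card fun e he => ?_
    rw [colourClass, Finset.mem_filter, Finset.mem_filter] at he
    rw [colourClass, Finset.mem_filter, Finset.mem_filter]
    have hd : (e.map π).IsDiag := by
      rw [map_eq_out, Sym2.mk_isDiag_iff]
      have ha := Finset.mem_sym2_iff.1 he.2 _ (Sym2.out_fst_mem e)
      have hb := Finset.mem_sym2_iff.1 he.2 _ (Sym2.out_snd_mem e)
      rw [Finset.mem_filter] at ha hb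
      exact ha.2.trans hb.2.symm
    have h2 := he.1.2
    rw [hc] at h2
    dsimp only at h2
    rw [if_pos hd] at h2
    exact ⟨⟨he.1.1, h2⟩, he.2⟩
  have hcardZ : ∑ y ∈ Z.image π, ((Z.filter fun v => π v = y).card : ℚ) = Z.card := by
    rw [← Nat.cast_sum, ← Finset.card_eq_sum_card_fiberwise]
    exact fun v hv => Finset.mem_coe.2 (Finset.mem_image_of_mem _ hv)
  have h3 := Finset.sum_le_sum hpart
  rw [← Finset.mul_sum, Finset.sum_sub_distrib, hcardZ, Finset.sum_const, nsmul_eq_mul,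
    mul_one] at h3
  have h4 : 1 ≤ (Z.image π).card := (hne.image π).card_pos
  have h5 : (((colourClass E c k).filter fun e => e ∈ Z.sym2 ∧ ¬ (e.map π).IsDiag).card : ℚ) ≤
      (Z.image π).card - 1 := by
    have : (((colourClass E c k).filter fun e => e ∈ Z.sym2 ∧ ¬ (e.map π).IsDiag).card : ℚ) ≤
      (((Z.image π).card - 1 : ℕ) : ℚ) := by exact_mod_cast hcross
    rwa [Nat.cast_sub h4, Nat.cast_one] at this
  have h6 : (1 : ℚ) ≤ (Z.image π).card := by exact_mod_cast h4
  push_cast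
  nlinarith [hα k]

end Contraction

/-! ### Sparse colourings when the density bound is not in `(3/2, 2]` -/

section Degenerate

theorem exists_mem_ne_of_card_eq_two {A : Finset ℕ} (hA : A.card = 2) (x : ℕ) :
    ∃ y ∈ A, y ≠ x := Finset.exists_mem_ne (by omega) x

/-- Split the items into pairs and use two different colours on each pair. -/
theorem exists_balanced_choice {τ : Type*} [DecidableEq τ] (A : τ → Finset ℕ)
    (hA : ∀ x, (A x).card = 2) (j : ℕ) (N : Finset τ) (hN : N.card ≤ 2 * j) :
    ∃ g : τ → ℕ, (∀ x, g x ∈ A x) ∧ ∀ k, (N.filter fun x => g x = k).card ≤ j := by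
  choose d hd using fun x => exists_mem_ne_of_card_eq_two (hA x) 0
  induction j generalizing N with
  | zero =>
    have : N = ∅ := by
      rw [← Finset.card_eq_zero]
      omega
    exact ⟨d, fun x => (hd x).1, fun k => by simp [this]⟩
  | succ j ih =>
    by_cases h1 : N.card ≤ 1
    · exact ⟨d, fun x => (hd x).1, fun k => (Finset.card_filter_le _ _).trans (by omega)⟩
    obtain ⟨x, hx, y, hy, hxy⟩ := Finset.one_lt_card.1 (not_le.1 h1)
    have hy' : y ∈ N.erase x := Finset.mem_erase.2 ⟨hxy.symm, hy⟩
    obtain ⟨g, hg, hgk⟩ := ih ((N.erase x).erase y) (by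
      rw [Finset.card_erase_of_mem hy', Finset.card_erase_of_mem hx]
      omega)
    obtain ⟨b, hb, hbd⟩ := exists_mem_ne_of_card_eq_two (hA y) (d x)
    refine ⟨Function.update (Function.update g x (d x)) y b, fun z => ?_, fun k => ?_⟩
    · by_cases hzy : z = y
      · subst hzy
        simpa using hb
      · by_cases hzx : z = x
        · subst hzx
          simpa [hzy] using (hd z).1
        · simpa [hzy, hzx] using hg z
    · have hsub : (N.filter fun z => Function.update (Function.update g x (d x)) y b z = k) ⊆
          insert (if b = k then y else x) (((N.erase x).erase y).filter fun z => g z = k) := by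
        intro z hz
        rw [Finset.mem_filter] at hz
        obtain ⟨hzN, hzk⟩ := hz
        rw [Finset.mem_insert, Finset.mem_filter, Finset.mem_erase, Finset.mem_erase]
        by_cases hzy : z = y
        · subst hzy
          rw [Function.update_self] at hzk
          simp [hzk]
        · rw [Function.update_of_ne hzy] at hzk
          by_cases hzx : z = x
          · subst hzx
            rw [Function.update_self] at hzk
            left
            rw [if_neg (by rintro rfl; exact hbd hzk.symm)]
          · rw [Function.update_of_ne hzx] at hzk
            exact Or.inr ⟨⟨hzy, hzx, hzN⟩, hzk⟩
      exact (Finset.card_le_card hsub).trans ((Finset.card_insert_le _ _).trans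
        (Nat.succ_le_succ (hgk k)))

variable {V : Type*} [DecidableEq V] {E : Finset (Sym2 V)} {L : Sym2 V → Finset ℕ}

/-- A vertex with at most four neighbours in `S` can be added to a colouring such that it gets at
most two neighbours in every colour. -/
theorem exists_extend_of_degIn_le_four (hE : ∀ e ∈ E, ¬ e.IsDiag) (hL : ∀ e, (L e).card = 2)
    {S : Finset V} {v : V} (hv : v ∈ S) (hdeg : degIn E v S ≤ 4) {c : Sym2 V → ℕ}
    (hc : ∀ e, c e ∈ L e) :
    ∃ c' : Sym2 V → ℕ, (∀ e, c' e ∈ L e) ∧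
      (∀ k Z, v ∉ Z → edgesIn (colourClass E c' k) Z = edgesIn (colourClass E c k) Z) ∧
      ∀ k, ∀ Z ⊆ S, v ∈ Z → edgesIn (colourClass E c' k) Z ≤
        edgesIn (colourClass E c k) (Z.erase v) + 2 := by
  rw [← degIn_erase_self hE hv] at hdeg
  obtain ⟨g, hg, hgk⟩ := exists_balanced_choice (fun u => L s(v, u)) (fun u => hL _) 2
    ((S.erase v).filter fun u => s(v, u) ∈ E) hdeg
  obtain ⟨c', hc', hout, hin⟩ := exists_recolour hE hc v hg
  refine ⟨c', hc', hout, fun k Z hZ hvZ => ?_⟩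
  rw [hin k Z hvZ]
  refine Nat.add_le_add_left ((Finset.card_le_card fun u hu => ?_).trans (hgk k)) _
  rw [Finset.mem_filter] at hu
  rw [Finset.mem_filter, Finset.mem_filter]
  exact ⟨⟨Finset.erase_subset_erase v hZ hu.1, hu.2.1⟩, hu.2.2⟩

/-- A 4-degenerate graph has a list colouring with 2-degenerate colour classes. -/
theorem exists_two_degenerate_colouring (hE : ∀ e ∈ E, ¬ e.IsDiag) (hL : ∀ e, (L e).card = 2)
    (S : Finset V) (h : ∀ Z ⊆ S, Z.Nonempty → ∃ v ∈ Z, degIn E v Z ≤ 4) :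
    ∃ c : Sym2 V → ℕ, (∀ e, c e ∈ L e) ∧ ∀ k, ∀ Z ⊆ S, 2 ≤ Z.card →
      edgesIn (colourClass E c k) Z + 3 ≤ 2 * Z.card := by
  induction hn : S.card generalizing S with
  | zero =>
    choose d hd using fun e => exists_mem_ne_of_card_eq_two (hL e) 0
    refine ⟨d, fun e => (hd e).1, fun k Z hZ h2 => ?_⟩
    have := Finset.card_le_card hZ
    omega
  | succ n ih =>
    obtain ⟨v, hv, hdeg⟩ := h S subset_rfl (Finset.card_pos.1 (by omega))
    obtain ⟨c, hc, hck⟩ := ih (S.erase v) (fun Z hZ => h Z (hZ.trans (Finset.erase_subset _ _)))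
      (by rw [Finset.card_erase_of_mem hv]; omega)
    obtain ⟨c', hc', hout, hin⟩ := exists_extend_of_degIn_le_four hE hL hv hdeg hc
    refine ⟨c', hc', fun k Z hZ h2 => ?_⟩
    by_cases hvZ : v ∈ Z
    · have h1 := hin k Z hZ hvZ
      have hcard := Finset.card_erase_of_mem hvZ
      by_cases h3 : 3 ≤ Z.card
      · have := hck k (Z.erase v) (Finset.erase_subset_erase v hZ) (by omega)
        omega
      · have h4 := two_mul_edgesIn_le (E := colourClass E c' k)
          (fun e he => hE e (colourClass_subset _ _ _ he)) Z
        have h5 : Z.card = 2 := by omega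
        rw [h5] at h4 ⊢
        omega
    · rw [hout k Z hvZ]
      exact hck k Z (fun u hu => Finset.mem_erase.2 ⟨fun h => hvZ (h ▸ hu), hZ hu⟩) h2

theorem edgesIn_le_two_of_card_eq_three {E : Finset (Sym2 V)} (hE : ∀ e ∈ E, ¬ e.IsDiag)
    {Z : Finset V} (hZ : Z.card = 3) {a b : V} (ha : a ∈ Z) (hb : b ∈ Z) (hab : a ≠ b)
    (h : s(a, b) ∉ E) : edgesIn E Z ≤ 2 := by
  rw [edgesIn_erase hE ha]
  have hcard : (Z.erase a).card = 2 := by rw [Finset.card_erase_of_mem ha, hZ]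
  have h1 := two_mul_edgesIn_le hE (Z.erase a)
  have hb' : b ∈ Z.erase a := Finset.mem_erase.2 ⟨hab.symm, hb⟩
  have h2 : degIn E a (Z.erase a) ≤ ((Z.erase a).erase b).card := by
    refine Finset.card_le_card fun u hu => ?_
    rw [Finset.mem_filter] at hu
    exact Finset.mem_erase.2 ⟨by rintro rfl; exact h hu.2, hu.1⟩
  rw [Finset.card_erase_of_mem hb', hcard] at h2
  rw [hcard] at h1
  omega

/-- A vertex `v` with five neighbours in `S` can be added to a colouring such that it gets at most
three neighbours in every colour, and such that three neighbours in the same colour never form a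
triangle of this colour. -/
theorem exists_extend_of_degIn_eq_five (hE : ∀ e ∈ E, ¬ e.IsDiag) (hL : ∀ e, (L e).card = 2)
    {S : Finset V} {v : V} (hv : v ∈ S) (hdeg : degIn E v S = 5) {c : Sym2 V → ℕ}
    (hc : ∀ e, c e ∈ L e) :
    ∃ c' : Sym2 V → ℕ, (∀ e, c' e ∈ L e) ∧
      (∀ k Z, v ∉ Z → edgesIn (colourClass E c' k) Z = edgesIn (colourClass E c k) Z) ∧
      ∀ k, ∀ Z ⊆ S, v ∈ Z →
        edgesIn (colourClass E c' k) Z ≤ edgesIn (colourClass E c k) (Z.erase v) + 2 ∨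
        edgesIn (colourClass E c' k) Z ≤ edgesIn (colourClass E c k) (Z.erase v) + 3 ∧
          4 ≤ Z.card ∧ (Z.card = 4 → edgesIn (colourClass E c k) (Z.erase v) ≤ 2) := by
  rw [← degIn_erase_self hE hv] at hdeg
  set N := (S.erase v).filter fun u => s(v, u) ∈ E with hN
  have hNcard : N.card = 5 := hdeg
  obtain ⟨p, hp⟩ := Finset.card_pos.1 (show 0 < N.card by omega)
  have hN1 : (N.erase p).card = 4 := by rw [Finset.card_erase_of_mem hp, hNcard]
  obtain ⟨q, hq⟩ := Finset.card_pos.1 (show 0 < (N.erase p).card by omega)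
  have hN2 : ((N.erase p).erase q).card = 3 := by rw [Finset.card_erase_of_mem hq, hN1]
  obtain ⟨r, s, t, hrs, hrt, hst, hrst⟩ := Finset.card_eq_three.1 hN2
  have hmemN : ∀ u, u ∈ N → u = p ∨ u = q ∨ u = r ∨ u = s ∨ u = t := by
    intro u hu
    by_cases h1 : u = p
    · exact Or.inl h1
    by_cases h2 : u = q
    · exact Or.inr (Or.inl h2)
    have : u ∈ (N.erase p).erase q := by simp [h1, h2, hu]
    rw [hrst] at this
    simpa [h1, h2] using this
  have hqp : q ≠ p := (Finset.mem_erase.1 hq).1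
  have hr : r ∈ (N.erase p).erase q := by rw [hrst]; simp
  have hs : s ∈ (N.erase p).erase q := by rw [hrst]; simp
  have ht : t ∈ (N.erase p).erase q := by rw [hrst]; simp
  simp only [Finset.mem_erase] at hr hs ht
  -- the colour `x` of `vp` is not the colour of `pq`, and `x` is avoided on `vr` to allow it on `vq`
  obtain ⟨x, hx, hxc⟩ := exists_mem_ne_of_card_eq_two (hL s(v, p)) (c s(p, q))
  obtain ⟨cr, hcr, hcrx⟩ := exists_mem_ne_of_card_eq_two (hL s(v, r)) x
  obtain ⟨cq, hcq, hcqr⟩ := exists_mem_ne_of_card_eq_two (hL s(v, q)) cr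
  obtain ⟨cs, hcs, -⟩ := exists_mem_ne_of_card_eq_two (hL s(v, s)) 0
  obtain ⟨ct, hct, hcts⟩ := exists_mem_ne_of_card_eq_two (hL s(v, t)) cs
  set g : V → ℕ := fun u => if u = p then x else if u = q then cq else if u = r then cr else
    if u = s then cs else if u = t then ct else c s(v, u) with hg
  obtain ⟨c', hc', hout, hin⟩ := exists_recolour hE hc v (g := g) (by
    intro u
    rw [hg]
    dsimp only
    split_ifs with h1 h2 h3 h4 h5
    · exact h1 ▸ hx
    · exact h2 ▸ hcq
    · exact h3 ▸ hcr
    · exact h4 ▸ hcs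
    · exact h5 ▸ hct
    · exact hc _)
  have gp : g p = x := by simp [hg]
  have gq : g q = cq := by simp [hg, hqp]
  have gr : g r = cr := by simp [hg, hr.1, hr.2.1]
  have gs : g s = cs := by simp [hg, hs.1, hs.2.1, hrs.symm]
  have gt : g t = ct := by simp [hg, ht.1, ht.2.1, hrt.symm, hst.symm]
  refine ⟨c', hc', hout, fun k Z hZ hvZ => ?_⟩
  rw [hin k Z hvZ]
  set M := (Z.erase v).filter fun u => s(v, u) ∈ E ∧ g u = k with hM
  have hMN : ∀ u ∈ M, u ∈ N ∧ g u = k := by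
    intro u hu
    rw [hM, Finset.mem_filter] at hu
    rw [hN, Finset.mem_filter]
    exact ⟨⟨Finset.erase_subset_erase v hZ hu.1, hu.2.1⟩, hu.2.2⟩
  have hcls : ∀ e ∈ colourClass E c k, ¬ e.IsDiag := fun e he => hE e (colourClass_subset _ _ _ he)
  by_cases hpq : p ∈ M ∧ q ∈ M
  · have hkx : k = x := by rw [← (hMN p hpq.1).2, gp]
    have hsub : M ⊆ {p, q, if k = cs then s else t} := by
      intro u hu
      obtain ⟨hu1, hu2⟩ := hMN u hu
      have hqk := (hMN q hpq.2).2
      rw [gq] at hqk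
      simp only [Finset.mem_insert, Finset.mem_singleton]
      rcases hmemN u hu1 with rfl | rfl | rfl | rfl | rfl
      · simp
      · simp
      · rw [gr] at hu2
        exact absurd (hqk.trans hu2.symm) hcqr
      · rw [gs] at hu2
        simp [hu2]
      · rw [gt] at hu2
        rw [if_neg (by rintro rfl; exact hcts hu2)]
        simp
    have hM3 : M.card ≤ 3 := (Finset.card_le_card hsub).trans Finset.card_le_three
    by_cases hM2 : M.card ≤ 2
    · left; omega
    right
    have hMZ : M.card ≤ (Z.erase v).card := Finset.card_filter_le _ _
    have hZc := Finset.card_erase_of_mem hvZ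
    refine ⟨by omega, by omega, fun hZ4 => ?_⟩
    refine edgesIn_le_two_of_card_eq_three hcls (by omega) (Finset.mem_filter.1 hpq.1).1
      (Finset.mem_filter.1 hpq.2).1 hqp.symm fun hcon => ?_
    rw [colourClass, Finset.mem_filter] at hcon
    exact hxc (hkx.symm.trans hcon.2.symm)
  · left
    refine Nat.add_le_add_left ?_ _
    have hsub : M ⊆ {if p ∈ M then p else if q ∈ M then q else r, if k = cs then s else t} := by
      intro u hu
      obtain ⟨hu1, hu2⟩ := hMN u hu
      simp only [Finset.mem_insert, Finset.mem_singleton]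
      rcases hmemN u hu1 with rfl | rfl | rfl | rfl | rfl
      · simp [hu]
      · left
        rw [if_neg fun h => hpq ⟨h, hu⟩, if_pos hu]
      · left
        rw [gr] at hu2
        rw [if_neg, if_neg]
        · intro h
          have := (hMN q h).2
          rw [gq] at this
          exact hcqr (this.trans hu2.symm)
        · intro h
          have := (hMN p h).2
          rw [gp] at this
          exact hcrx (hu2.trans this.symm)
      · rw [gs] at hu2
        simp [hu2]
      · rw [gt] at hu2
        rw [if_neg (show ¬ k = cs by rintro rfl; exact hcts hu2)]
        simp
    exact (Finset.card_le_card hsub).trans Finset.card_le_two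

/-- Colouring graphs of maximum density at most `5/2`. If no vertex of `S` has degree at most four,
then `S` induces a 5-regular graph, and either it is disconnected or it becomes 4-degenerate when
any one vertex is removed. -/
theorem exists_colouring_of_density_le_five_halves (hE : ∀ e ∈ E, ¬ e.IsDiag)
    (hL : ∀ e, (L e).card = 2) (h : ∀ Z : Finset V, 2 * edgesIn E Z ≤ 5 * Z.card) (S : Finset V) :
    ∃ c : Sym2 V → ℕ, (∀ e, c e ∈ L e) ∧ ∀ k, ∀ Z ⊆ S, 3 ≤ Z.card →
      2 * edgesIn (colourClass E c k) Z + 9 ≤ 5 * Z.card := by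
  induction hn : S.card using Nat.strong_induction_on generalizing S with
  | _ n ih =>
  have hcls : ∀ c k, ∀ e ∈ colourClass E c k, ¬ e.IsDiag :=
    fun c k e he => hE e (colourClass_subset _ _ _ he)
  by_cases hlow : ∃ v ∈ S, degIn E v S ≤ 4
  · obtain ⟨v, hv, hdeg⟩ := hlow
    obtain ⟨c, hc, hck⟩ := ih _ (by
      rw [← hn]; exact Finset.card_erase_lt_of_mem hv) (S.erase v) rfl
    obtain ⟨c', hc', hout, hin⟩ := exists_extend_of_degIn_le_four hE hL hv hdeg hc
    refine ⟨c', hc', fun k Z hZ h3 => ?_⟩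
    by_cases hvZ : v ∈ Z
    · have h1 := hin k Z hZ hvZ
      have hcard := Finset.card_erase_of_mem hvZ
      by_cases h4 : 4 ≤ Z.card
      · have := hck k (Z.erase v) (Finset.erase_subset_erase v hZ) (by omega)
        omega
      · have h4 := two_mul_edgesIn_le (hcls c' k) Z
        have h5 : Z.card = 3 := by omega
        rw [h5] at h4 ⊢
        omega
    · rw [hout k Z hvZ]
      exact hck k Z (fun u hu => Finset.mem_erase.2 ⟨fun h => hvZ (h ▸ hu), hZ hu⟩) h3
  push Not at hlow
  have hreg : ∀ v ∈ S, degIn E v S = 5 := by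
    have h1 : ∑ v ∈ S, degIn E v S ≤ ∑ v ∈ S, 5 := by
      rw [sum_degIn hE, Finset.sum_const, smul_eq_mul, mul_comm]
      linarith [h S]
    intro v hv
    exact ((Finset.sum_eq_sum_iff_of_le fun v hv => hlow v hv).1
      (le_antisymm (Finset.sum_le_sum fun v hv => hlow v hv) h1) v hv).symm
  rcases S.eq_empty_or_nonempty with rfl | ⟨v, hv⟩
  · choose d hd using fun e => exists_mem_ne_of_card_eq_two (hL e) 0
    refine ⟨d, fun e => (hd e).1, fun k Z hZ h2 => ?_⟩
    have := Finset.card_le_card hZ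
    simp at this
    simp [this] at h2
  by_cases hdeg : ∀ Z ⊆ S.erase v, Z.Nonempty → ∃ w ∈ Z, degIn E w Z ≤ 4
  · obtain ⟨c, hc, hck⟩ := exists_two_degenerate_colouring hE hL _ hdeg
    obtain ⟨c', hc', hout, hin⟩ := exists_extend_of_degIn_eq_five hE hL hv (hreg v hv) hc
    refine ⟨c', hc', fun k Z hZ h3 => ?_⟩
    by_cases hvZ : v ∈ Z
    · have hcard := Finset.card_erase_of_mem hvZ
      have h1 := hck k (Z.erase v) (Finset.erase_subset_erase v hZ) (by omega)
      rcases hin k Z hZ hvZ with h2 | ⟨h2, h4, h5⟩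
      · omega
      · by_cases h6 : Z.card = 4
        · have := h5 h6
          omega
        · omega
    · rw [hout k Z hvZ]
      have := hck k Z (fun u hu => Finset.mem_erase.2 ⟨fun h => hvZ (h ▸ hu), hZ hu⟩) (by omega)
      omega
  -- a 5-regular proper part is not joined to the rest
  push Not at hdeg
  obtain ⟨A, hA, hAne, hAdeg⟩ := hdeg
  have hAS : A ⊆ S := hA.trans (Finset.erase_subset _ _)
  have hsplit : ∀ a ∈ A, ∀ b ∈ S, s(a, b) ∈ E → b ∈ A := by
    intro a ha b hb hab
    have h1 : (A.filter fun u => s(a, u) ∈ E) = S.filter fun u => s(a, u) ∈ E := by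
      refine Finset.eq_of_subset_of_card_le (Finset.filter_subset_filter _ hAS) ?_
      have h2 := hAdeg a ha
      have h3 := hreg a (hAS ha)
      unfold degIn at h2 h3
      omega
    have : b ∈ S.filter fun u => s(a, u) ∈ E := Finset.mem_filter.2 ⟨hb, hab⟩
    rw [← h1] at this
    exact (Finset.mem_filter.1 this).1
  have hvA : v ∉ A := fun h => (Finset.mem_erase.1 (hA h)).1 rfl
  obtain ⟨c₁, hc₁, hck₁⟩ := ih A.card (by
    rw [← hn]; exact Finset.card_lt_card ⟨hAS, fun h => hvA (h hv)⟩) A rfl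
  obtain ⟨c₂, hc₂, hck₂⟩ := ih (S \ A).card (by
    rw [← hn, Finset.card_sdiff_of_subset hAS]
    have := hAne.card_pos
    have := Finset.card_le_card hAS
    omega) (S \ A) rfl
  refine ⟨fun e => if e ∈ A.sym2 then c₁ e else c₂ e, fun e => ?_, fun k Z hZ h3 => ?_⟩
  · dsimp only
    split_ifs
    · exact hc₁ e
    · exact hc₂ e
  set c : Sym2 V → ℕ := fun e => if e ∈ A.sym2 then c₁ e else c₂ e with hc
  have h1 : edgesIn (colourClass E c k) (Z ∩ A) = edgesIn (colourClass E c₁ k) (Z ∩ A) := by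
    unfold edgesIn colourClass
    rw [Finset.filter_filter, Finset.filter_filter]
    congr 1
    refine Finset.filter_congr fun e _ => and_congr_left fun he => ?_
    rw [hc]
    dsimp only
    rw [if_pos (Finset.sym2_mono Finset.inter_subset_right he)]
  have h2 : edgesIn (colourClass E c k) (Z \ A) = edgesIn (colourClass E c₂ k) (Z \ A) := by
    unfold edgesIn colourClass
    rw [Finset.filter_filter, Finset.filter_filter]
    congr 1
    refine Finset.filter_congr fun e _ => and_congr_left fun he => ?_
    rw [hc]
    dsimp only
    rw [if_neg]
    intro h'
    have hx := Sym2.out_fst_mem e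
    exact (Finset.mem_sdiff.1 (Finset.mem_sym2_iff.1 he _ hx)).2 (Finset.mem_sym2_iff.1 h' _ hx)
  rw [edgesIn_eq_add_of_split (A := A), h1, h2]
  · have hsum : (Z ∩ A).card + (Z \ A).card = Z.card := Finset.card_inter_add_card_sdiff Z A
    have hsmall : ∀ (c : Sym2 V → ℕ) (W : Finset V),
        (3 ≤ W.card → 2 * edgesIn (colourClass E c k) W + 9 ≤ 5 * W.card) →
        (W.card = 0 ∧ edgesIn (colourClass E c k) W = 0) ∨
          (2 * edgesIn (colourClass E c k) W + 5 ≤ 5 * W.card) := by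
      intro c W hW
      by_cases hW3 : 3 ≤ W.card
      · right
        have := hW hW3
        omega
      · have h4 := two_mul_edgesIn_le (hcls c k) W
        have h5 : W.card = 0 ∨ W.card = 1 ∨ W.card = 2 := by omega
        rcases h5 with h5 | h5 | h5 <;> rw [h5] at h4 <;> omega
    have h4 := hck₁ k (Z ∩ A) Finset.inter_subset_right
    have h5 := hck₂ k (Z \ A) (Finset.sdiff_subset_sdiff hZ subset_rfl)
    have h6 := hsmall c₁ _ h4
    have h7 := hsmall c₂ _ h5
    omega
  · intro a ha b hb hab
    have hab' := colourClass_subset _ _ _ hab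
    exact ⟨fun h => hsplit a h b (hZ hb) hab', fun h => hsplit b h a (hZ ha) (by rwa [Sym2.eq_swap])⟩

end Degenerate

section Forests

variable {V : Type*} [Fintype V] [DecidableEq V] {E : Finset (Sym2 V)} {L : Sym2 V → Finset ℕ}

/-- List colouring of a graph such that each colour class is sparse like a union of `t` forests. -/
theorem exists_colouring_by_forests (hE : ∀ e ∈ E, ¬ e.IsDiag) (hL : ∀ e, (L e).card = 2) (t : ℕ)
    (h : ∀ Z : Finset V, Z.Nonempty → edgesIn E Z ≤ 2 * t * (Z.card - 1)) :
    ∃ c : Sym2 V → ℕ, (∀ e, c e ∈ L e) ∧ ∀ k, ∀ Z : Finset V, Z.Nonempty →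
      edgesIn (colourClass E c k) Z ≤ t * (Z.card - 1) := by
  obtain ⟨c, hc, hck⟩ := exists_forest_colouring E L hL id t (by
    intro C hC
    refine (Finset.card_le_card fun e he => ?_).trans (h C hC)
    rw [Finset.mem_filter] at he ⊢
    exact ⟨he.1, by simpa using he.2.2⟩)
  refine ⟨c, hc, fun k Z hZ => (Finset.card_le_card fun e he => ?_).trans (hck k Z hZ)⟩
  rw [colourClass, Finset.mem_filter, Finset.mem_filter] at he
  rw [Finset.mem_filter]
  simpa using ⟨he.1.1, he.1.2, hE e he.1.1, Finset.mem_sym2_iff.1 he.2⟩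

/-- For `m ≤ 3/2` there is a colouring by forests, since `Z` contains at most `2 (|Z| - 1)` edges. -/
theorem exists_sparse_colouring_of_le_three_halves (hE : ∀ e ∈ E, ¬ e.IsDiag)
    (hL : ∀ e, (L e).card = 2) {m : ℝ} (hm : 1 < m) (hm' : m ≤ 3 / 2)
    (h : ∀ Z : Finset V, (edgesIn E Z : ℝ) ≤ m * Z.card) :
    ∃ c : Sym2 V → ℕ, (∀ e, c e ∈ L e) ∧ ∀ k, ∀ Z : Finset V, 3 ≤ Z.card →
      (edgesIn (colourClass E c k) Z : ℝ) < m * (Z.card - 2) + 1 := by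
  obtain ⟨c, hc, hck⟩ := exists_colouring_by_forests hE hL 1 (by
    intro Z hZ
    have h1 := two_mul_edgesIn_le hE Z
    have h2 : 2 * edgesIn E Z ≤ 3 * Z.card := by
      have := h Z
      have h3 : (2 * edgesIn E Z : ℝ) ≤ 3 * Z.card := by
        nlinarith [(Nat.cast_nonneg Z.card : (0 : ℝ) ≤ Z.card)]
      exact_mod_cast h3
    have h3 := hZ.card_pos
    by_cases h4 : 4 ≤ Z.card
    · omega
    · have : Z.card = 1 ∨ Z.card = 2 ∨ Z.card = 3 := by omega
      rcases this with h5 | h5 | h5 <;> rw [h5] at h1 ⊢ <;> omega)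
  refine ⟨c, hc, fun k Z hZ => ?_⟩
  have h1 := hck k Z (Finset.card_pos.1 (by omega))
  have h2 : edgesIn (colourClass E c k) Z + 1 ≤ Z.card := by omega
  have h3 : (edgesIn (colourClass E c k) Z + 1 : ℝ) ≤ Z.card := by exact_mod_cast h2
  have h4 : (3 : ℝ) ≤ Z.card := by exact_mod_cast hZ
  nlinarith

/-- For `m > 5/2` each colour can be given the density of a bounded number of forests. -/
theorem exists_sparse_colouring_of_five_halves_lt (hE : ∀ e ∈ E, ¬ e.IsDiag)
    (hL : ∀ e, (L e).card = 2) {m : ℝ} (hm : 5 / 2 < m)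
    (h : ∀ Z : Finset V, (edgesIn E Z : ℝ) ≤ m * Z.card) :
    ∃ c : Sym2 V → ℕ, (∀ e, c e ∈ L e) ∧ ∀ k, ∀ Z : Finset V, 3 ≤ Z.card →
      (edgesIn (colourClass E c k) Z : ℝ) < m * (Z.card - 2) + 1 := by
  -- the arboricity is at most `⌈m + 1/2⌉`, and each colour receives about half of the forests
  set t := ⌈(2 * m + 1) / 4⌉₊ with ht
  have ht1 : (2 * m + 1) / 4 ≤ t := Nat.le_ceil _
  have ht2 : (t : ℝ) < m - 1 / 2 := by
    by_cases h7 : m ≤ 7 / 2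
    · have : t ≤ 2 := Nat.ceil_le.2 (by push_cast; linarith)
      have : (t : ℝ) ≤ 2 := by exact_mod_cast this
      linarith
    · have := Nat.ceil_lt_add_one (show (0 : ℝ) ≤ (2 * m + 1) / 4 by linarith)
      rw [← ht] at this
      linarith
  have hreal : ∀ (F : Finset (Sym2 V)), (∀ e ∈ F, ¬ e.IsDiag) → ∀ Z : Finset V, Z.Nonempty →
      2 * (edgesIn F Z : ℝ) ≤ Z.card * (Z.card - 1) := by
    intro F hF Z hZ
    have h1 := two_mul_edgesIn_le hF Z
    have h2 : ((2 * edgesIn F Z : ℕ) : ℝ) ≤ ((Z.card * (Z.card - 1) : ℕ) : ℝ) := by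
      exact_mod_cast h1
    rw [Nat.cast_mul, Nat.cast_mul, Nat.cast_sub hZ.card_pos] at h2
    exact_mod_cast h2
  obtain ⟨c, hc, hck⟩ := exists_colouring_by_forests hE hL t (by
    intro Z hZ
    have h1 := hreal E hE Z hZ
    have h2 := h Z
    have h3 : 1 ≤ Z.card := hZ.card_pos
    have h4 : (1 : ℝ) ≤ Z.card := by exact_mod_cast h3
    have h5 : (edgesIn E Z : ℝ) ≤ 2 * t * (Z.card - 1) := by
      have h6 : (edgesIn E Z : ℝ) ≤ (m + 1 / 2) * (Z.card - 1) := by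
        by_cases h8 : (Z.card : ℝ) ≤ 2 * m + 1
        · nlinarith
        · nlinarith
      nlinarith
    have h6 : (edgesIn E Z : ℝ) ≤ ((2 * t * (Z.card - 1) : ℕ) : ℝ) := by
      rw [Nat.cast_mul, Nat.cast_sub h3]
      push_cast
      exact h5
    exact_mod_cast h6)
  refine ⟨c, hc, fun k Z hZ => ?_⟩
  have hne : Z.Nonempty := Finset.card_pos.1 (by omega)
  have h1 := hck k Z hne
  have h2 := hreal (colourClass E c k) (fun e he => hE e (colourClass_subset _ _ _ he)) Z hne
  have h3 : (edgesIn (colourClass E c k) Z : ℝ) ≤ t * (Z.card - 1) := by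
    have : (edgesIn (colourClass E c k) Z : ℝ) ≤ ((t * (Z.card - 1) : ℕ) : ℝ) := by
      exact_mod_cast h1
    rw [Nat.cast_mul, Nat.cast_sub hne.card_pos] at this
    exact_mod_cast this
  have h4 : (3 : ℝ) ≤ Z.card := by exact_mod_cast hZ
  by_cases h5 : (Z.card : ℝ) < 2 * m - 1
  · nlinarith
  · nlinarith

/-- For `2 < m < 5/2` the graph is 4-degenerate, so there is a colouring with 2-degenerate classes;
the case `m = 5/2` has to admit 5-regular graphs. -/
theorem exists_sparse_colouring_of_le_five_halves (hE : ∀ e ∈ E, ¬ e.IsDiag)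
    (hL : ∀ e, (L e).card = 2) {m : ℝ} (hm : 2 < m) (hm' : m ≤ 5 / 2)
    (h : ∀ Z : Finset V, (edgesIn E Z : ℝ) ≤ m * Z.card) :
    ∃ c : Sym2 V → ℕ, (∀ e, c e ∈ L e) ∧ ∀ k, ∀ Z : Finset V, 3 ≤ Z.card →
      (edgesIn (colourClass E c k) Z : ℝ) < m * (Z.card - 2) + 1 := by
  rcases hm'.lt_or_eq with hlt | rfl
  · obtain ⟨c, hc, hck⟩ := exists_two_degenerate_colouring hE hL Finset.univ (by
      intro Z _ hZ
      obtain ⟨v, hv, hdeg⟩ := exists_degIn_mul_card_le hE hZ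
      refine ⟨v, hv, ?_⟩
      by_contra hcon
      have h1 : 5 * Z.card ≤ 2 * edgesIn E Z := le_trans (Nat.mul_le_mul (by omega) le_rfl) hdeg
      have h2 : (5 * Z.card : ℝ) ≤ 2 * edgesIn E Z := by exact_mod_cast h1
      have h3 : (0 : ℝ) < Z.card := by exact_mod_cast hZ.card_pos
      nlinarith [h Z])
    refine ⟨c, hc, fun k Z hZ => ?_⟩
    have h1 := hck k Z (Finset.subset_univ _) (by omega)
    have h2 : (edgesIn (colourClass E c k) Z + 3 : ℝ) ≤ 2 * Z.card := by exact_mod_cast h1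
    have h3 : (3 : ℝ) ≤ Z.card := by exact_mod_cast hZ
    nlinarith
  · obtain ⟨c, hc, hck⟩ := exists_colouring_of_density_le_five_halves hE hL (by
      intro Z
      have h1 := h Z
      have h2 : (2 * edgesIn E Z : ℝ) ≤ 5 * Z.card := by linarith
      exact_mod_cast h2) Finset.univ
    refine ⟨c, hc, fun k Z hZ => ?_⟩
    have h1 := hck k Z (Finset.subset_univ _) hZ
    have h2 : (2 * edgesIn (colourClass E c k) Z + 9 : ℝ) ≤ 5 * Z.card := by exact_mod_cast h1
    linarith

end Forests

/-! ### Colouring the edges at a vertex of degree three or four -/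

section Star

variable {τ : Type*} [DecidableEq τ]

/-- The colouring `g` of `N` is safe with respect to relations `R k` if each colour `k` is used at
most twice, and only on pairs not related by `R k`. Here `N` stands for the neighbourhood of a
vertex `v`, the colour of `u` for the colour of `vu`, and `R k` for adjacency in colour `k`. -/
def StarSafe (R : ℕ → τ → τ → Prop) (N : Finset τ) (g : τ → ℕ) : Prop :=
  ∀ k, (N.filter fun u => g u = k).card ≤ 1 ∨
    ∃ u u', (N.filter fun u => g u = k) ⊆ {u, u'} ∧ ¬ R k u u'

/-- Four colours `c₁`, …, `c₄` for the edges of a star with four ends are safe if no three of them are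
equal and the ends of edges with the same colour are not related. -/
theorem exists_starSafe_of_colours {A : τ → Finset ℕ} (hA : ∀ x, (A x).card = 2)
    (R : ℕ → τ → τ → Prop) {N : Finset τ} {u₁ u₂ u₃ u₄ : τ} (h12 : u₁ ≠ u₂) (h13 : u₁ ≠ u₃)
    (h14 : u₁ ≠ u₄) (h23 : u₂ ≠ u₃) (h24 : u₂ ≠ u₄) (h34 : u₃ ≠ u₄)
    (hN : ∀ u ∈ N, u = u₁ ∨ u = u₂ ∨ u = u₃ ∨ u = u₄) (c₁ c₂ c₃ c₄ : ℕ)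
    (hc₁ : c₁ ∈ A u₁) (hc₂ : c₂ ∈ A u₂) (hc₃ : c₃ ∈ A u₃) (hc₄ : c₄ ∈ A u₄)
    (n123 : ¬ (c₁ = c₂ ∧ c₂ = c₃)) (n124 : ¬ (c₁ = c₂ ∧ c₂ = c₄))
    (n134 : ¬ (c₁ = c₃ ∧ c₃ = c₄)) (n234 : ¬ (c₂ = c₃ ∧ c₃ = c₄))
    (r12 : c₁ = c₂ → ¬ R c₁ u₁ u₂) (r13 : c₁ = c₃ → ¬ R c₁ u₁ u₃) (r14 : c₁ = c₄ → ¬ R c₁ u₁ u₄)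
    (r23 : c₂ = c₃ → ¬ R c₂ u₂ u₃) (r24 : c₂ = c₄ → ¬ R c₂ u₂ u₄)
    (r34 : c₃ = c₄ → ¬ R c₃ u₃ u₄) :
    ∃ g : τ → ℕ, (∀ x, g x ∈ A x) ∧ StarSafe R N g := by
  choose d hd using fun x => exists_mem_ne_of_card_eq_two (hA x) 0
  set g : τ → ℕ := fun u => if u = u₁ then c₁ else if u = u₂ then c₂ else if u = u₃ then c₃ else
    if u = u₄ then c₄ else d u with hg
  have g1 : g u₁ = c₁ := by simp [hg]
  have g2 : g u₂ = c₂ := by simp [hg, h12.symm]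
  have g3 : g u₃ = c₃ := by simp [hg, h13.symm, h23.symm]
  have g4 : g u₄ = c₄ := by simp [hg, h14.symm, h24.symm, h34.symm]
  refine ⟨g, fun x => ?_, fun k => ?_⟩
  · rw [hg]
    dsimp only
    split_ifs with e1 e2 e3 e4
    · exact e1 ▸ hc₁
    · exact e2 ▸ hc₂
    · exact e3 ▸ hc₃
    · exact e4 ▸ hc₄
    · exact (hd x).1
  clear_value g
  have hmem : ∀ u ∈ N.filter fun u => g u = k,
      (u = u₁ ∧ c₁ = k) ∨ (u = u₂ ∧ c₂ = k) ∨ (u = u₃ ∧ c₃ = k) ∨ (u = u₄ ∧ c₄ = k) := by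
    intro u hu
    rw [Finset.mem_filter] at hu
    rcases hN u hu.1 with rfl | rfl | rfl | rfl
    · exact Or.inl ⟨rfl, g1 ▸ hu.2⟩
    · exact Or.inr (Or.inl ⟨rfl, g2 ▸ hu.2⟩)
    · exact Or.inr (Or.inr (Or.inl ⟨rfl, g3 ▸ hu.2⟩))
    · exact Or.inr (Or.inr (Or.inr ⟨rfl, g4 ▸ hu.2⟩))
  by_cases hpair : (c₁ = k ∧ c₂ = k) ∨ (c₁ = k ∧ c₃ = k) ∨ (c₁ = k ∧ c₄ = k) ∨ (c₂ = k ∧ c₃ = k) ∨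
      (c₂ = k ∧ c₄ = k) ∨ (c₃ = k ∧ c₄ = k)
  · right
    have hpick : ∀ p q, (∀ u, (u = u₁ ∧ c₁ = k) ∨ (u = u₂ ∧ c₂ = k) ∨ (u = u₃ ∧ c₃ = k) ∨
        (u = u₄ ∧ c₄ = k) → u = p ∨ u = q) → ¬ R k p q →
        ∃ u u', (N.filter fun u => g u = k) ⊆ {u, u'} ∧ ¬ R k u u' := fun p q h hR =>
      ⟨p, q, fun u hu => by simpa using h u (hmem u hu), hR⟩
    rcases hpair with ⟨e, e'⟩ | ⟨e, e'⟩ | ⟨e, e'⟩ | ⟨e, e'⟩ | ⟨e, e'⟩ | ⟨e, e'⟩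
    · apply hpick u₁ u₂ <;> grind
    · apply hpick u₁ u₃ <;> grind
    · apply hpick u₁ u₄ <;> grind
    · apply hpick u₂ u₃ <;> grind
    · apply hpick u₂ u₄ <;> grind
    · apply hpick u₃ u₄ <;> grind
  · left
    rw [Finset.card_le_one]
    intro a ha b hb
    have := hmem a ha
    have := hmem b hb
    grind

/-- Two lists are different, so three different colours can be chosen. -/
theorem exists_distinct_of_ne {A B C : Finset ℕ} (hA : A.card = 2) (hB : B.card = 2)
    (hC : C.card = 2) (h : A ≠ B) :
    ∃ a ∈ A, ∃ b ∈ B, ∃ c ∈ C, a ≠ b ∧ a ≠ c ∧ b ≠ c := by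
  obtain ⟨a, ha, haB⟩ : ∃ a ∈ A, a ∉ B := by
    by_contra hcon
    push Not at hcon
    exact h (Finset.eq_of_subset_of_card_le hcon (by omega))
  obtain ⟨c, hc, hca⟩ := exists_mem_ne_of_card_eq_two hC a
  obtain ⟨b, hb, hbc⟩ := exists_mem_ne_of_card_eq_two hB c
  exact ⟨a, ha, b, hb, c, hc, fun h => haB (h ▸ hb), hca.symm, hbc⟩

/-- Colouring a star with three edges: only one colour `x` may be used twice, and it is not one of a
set `K` of at most one forbidden colour. -/
theorem exists_colouring_three {A : τ → Finset ℕ} (hA : ∀ x, (A x).card = 2)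
    (R : ℕ → τ → τ → Prop) {N : Finset τ} (hN : N.card = 3) {K : Finset ℕ} (hK : K.card ≤ 1)
    (hR : ∀ k ∉ K, ∀ u ∈ N, ∀ v ∈ N, ∀ w ∈ N, u ≠ v → u ≠ w → v ≠ w →
      ¬ (R k u v ∧ R k u w ∧ R k v w)) :
    ∃ g : τ → ℕ, (∀ x, g x ∈ A x) ∧ ∃ x, ∀ k, (N.filter fun u => g u = k).card ≤ 1 ∨
      (k = x ∧ k ∉ K ∧ ∃ u u', (N.filter fun u => g u = k) ⊆ {u, u'} ∧ ¬ R k u u') := by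
  choose d hd using fun x => exists_mem_ne_of_card_eq_two (hA x) 0
  have hassign : ∀ p q r : τ, p ≠ q → p ≠ r → q ≠ r → ∀ a ∈ A p, ∀ b ∈ A q, ∀ c ∈ A r,
      ∃ g : τ → ℕ, (∀ x, g x ∈ A x) ∧ g p = a ∧ g q = b ∧ g r = c := by
    intro p q r hpq hpr hqr a ha b hb c hc
    refine ⟨fun u => if u = p then a else if u = q then b else if u = r then c else d u,
      fun x => ?_, by simp, by simp [hpq.symm], by simp [hpr.symm, hqr.symm]⟩
    dsimp only
    split_ifs with e1 e2 e3
    · exact e1 ▸ ha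
    · exact e2 ▸ hb
    · exact e3 ▸ hc
    · exact (hd x).1
  -- three different colours
  have hdist : ∀ p q r : τ, p ≠ q → p ≠ r → q ≠ r → N = {p, q, r} → ∀ a ∈ A p, ∀ b ∈ A q,
      ∀ c ∈ A r, a ≠ b → a ≠ c → b ≠ c → ∃ g : τ → ℕ, (∀ x, g x ∈ A x) ∧ ∃ x, ∀ k,
        (N.filter fun u => g u = k).card ≤ 1 ∨ (k = x ∧ k ∉ K ∧ ∃ u u',
          (N.filter fun u => g u = k) ⊆ {u, u'} ∧ ¬ R k u u') := by
    intro p q r hpq hpr hqr hNe a ha b hb c hc hab hac hbc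
    obtain ⟨g, hg, gp, gq, gr⟩ := hassign p q r hpq hpr hqr a ha b hb c hc
    refine ⟨g, hg, 0, fun k => Or.inl ?_⟩
    rw [Finset.card_le_one]
    intro s hs t ht
    rw [hNe] at hs ht
    simp only [Finset.mem_filter, Finset.mem_insert, Finset.mem_singleton] at hs ht
    grind
  -- the colour `x` on `p` and `q`, another colour on `r`
  have hshare : ∀ p q r : τ, p ≠ q → p ≠ r → q ≠ r → N = {p, q, r} → ∀ x ∉ K, x ∈ A p → x ∈ A q →
      ¬ R x p q → ∃ g : τ → ℕ, (∀ x, g x ∈ A x) ∧ ∃ x, ∀ k,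
        (N.filter fun u => g u = k).card ≤ 1 ∨ (k = x ∧ k ∉ K ∧ ∃ u u',
          (N.filter fun u => g u = k) ⊆ {u, u'} ∧ ¬ R k u u') := by
    intro p q r hpq hpr hqr hNe x hxK hp hq hxR
    obtain ⟨y, hy, hyx⟩ := exists_mem_ne_of_card_eq_two (hA r) x
    obtain ⟨g, hg, gp, gq, gr⟩ := hassign p q r hpq hpr hqr x hp x hq y hy
    refine ⟨g, hg, x, fun k => ?_⟩
    by_cases hkx : k = x
    · right
      subst hkx
      refine ⟨rfl, hxK, p, q, fun s hs => ?_, hxR⟩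
      rw [hNe] at hs
      simp only [Finset.mem_filter, Finset.mem_insert, Finset.mem_singleton] at hs ⊢
      grind
    · left
      rw [Finset.card_le_one]
      intro s hs t ht
      rw [hNe] at hs ht
      simp only [Finset.mem_filter, Finset.mem_insert, Finset.mem_singleton] at hs ht
      grind
  obtain ⟨p, q, r, hpq, hpr, hqr, hNe⟩ := Finset.card_eq_three.1 hN
  by_cases h1 : A p = A q
  · by_cases h2 : A r = A p
    · obtain ⟨x, hx, hxK⟩ : ∃ x ∈ A p, x ∉ K := by
        by_contra hcon
        push Not at hcon
        have := Finset.card_le_card (show A p ⊆ K from hcon)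
        have := hA p
        omega
      have hxq : x ∈ A q := h1 ▸ hx
      have hxr : x ∈ A r := h2 ▸ hx
      have h3 := hR x hxK p (by simp [hNe]) q (by simp [hNe]) r (by simp [hNe]) hpq hpr hqr
      by_cases h4 : R x p q
      · by_cases h5 : R x p r
        · exact hshare q r p hqr hpq.symm hpr.symm (by rw [hNe]; ext; simp; tauto) x hxK hxq hxr
            fun h6 => h3 ⟨h4, h5, h6⟩
        · exact hshare p r q hpr hpq hqr.symm (by rw [hNe]; ext; simp; tauto) x hxK hx hxr h5
      · exact hshare p q r hpq hpr hqr hNe x hxK hx hxq h4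
    · obtain ⟨a, ha, b, hb, c, hc, hab, hac, hbc⟩ := exists_distinct_of_ne (hA r) (hA p) (hA q) h2
      exact hdist p q r hpq hpr hqr hNe b hb c hc a ha hbc hab.symm hac.symm
  · obtain ⟨a, ha, b, hb, c, hc, hab, hac, hbc⟩ := exists_distinct_of_ne (hA p) (hA q) (hA r) h1
    exact hdist p q r hpq hpr hqr hNe a ha b hb c hc hab hac hbc

/-- Colouring a star with four edges, two of whose lists share a colour `c` missing from the other
two lists. -/
theorem exists_starSafe_of_shared_colour {A : τ → Finset ℕ} (hA : ∀ x, (A x).card = 2)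
    {R : ℕ → τ → τ → Prop} (hsymm : ∀ k u v, R k u v → R k v u)
    (hexc : ∀ k k' u v, R k u v → R k' u v → k = k') {N : Finset τ}
    {u₁ u₂ u₃ u₄ : τ} (h12 : u₁ ≠ u₂) (h13 : u₁ ≠ u₃)
    (h14 : u₁ ≠ u₄) (h23 : u₂ ≠ u₃) (h24 : u₂ ≠ u₄) (h34 : u₃ ≠ u₄)
    (hN : ∀ u ∈ N, u = u₁ ∨ u = u₂ ∨ u = u₃ ∨ u = u₄)
    (hcyc : ∀ k, ¬ (R k u₁ u₃ ∧ R k u₃ u₂ ∧ R k u₂ u₄ ∧ R k u₄ u₁))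
    {c : ℕ} (hc₁ : c ∉ A u₁) (hc₂ : c ∉ A u₂) (hc₃ : c ∈ A u₃) (hc₄ : c ∈ A u₄) :
    ∃ g : τ → ℕ, (∀ x, g x ∈ A x) ∧ StarSafe R N g := by
  have key := exists_starSafe_of_colours hA R h12 h13 h14 h23 h24 h34 hN
  by_cases hR : R c u₃ u₄
  swap
  · obtain ⟨a, ha, -⟩ := exists_mem_ne_of_card_eq_two (hA u₁) 0
    obtain ⟨b, hb, hba⟩ := exists_mem_ne_of_card_eq_two (hA u₂) a
    have hac : a ≠ c := fun h => hc₁ (h ▸ ha)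
    have hbc : b ≠ c := fun h => hc₂ (h ▸ hb)
    apply key a b c c ha hb hc₃ hc₄ <;> grind
  obtain ⟨y, hy, hyc⟩ := exists_mem_ne_of_card_eq_two (hA u₃) c
  obtain ⟨z, hz, hzc⟩ := exists_mem_ne_of_card_eq_two (hA u₄) c
  -- all four colours can be chosen different if `y` or `z` is missing from `A u₁` or `A u₂`
  by_cases hy₁ : y ∈ A u₁
  swap
  · obtain ⟨b, hb, hby⟩ := exists_mem_ne_of_card_eq_two (hA u₂) y
    obtain ⟨a, ha, hab⟩ := exists_mem_ne_of_card_eq_two (hA u₁) b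
    apply key a b y c ha hb hy hc₄ <;> grind
  by_cases hy₂ : y ∈ A u₂
  swap
  · obtain ⟨a, ha, hay⟩ := exists_mem_ne_of_card_eq_two (hA u₁) y
    obtain ⟨b, hb, hab⟩ := exists_mem_ne_of_card_eq_two (hA u₂) a
    apply key a b y c ha hb hy hc₄ <;> grind
  by_cases hz₁ : z ∈ A u₁
  swap
  · obtain ⟨b, hb, hby⟩ := exists_mem_ne_of_card_eq_two (hA u₂) z
    obtain ⟨a, ha, hab⟩ := exists_mem_ne_of_card_eq_two (hA u₁) b
    apply key a b c z ha hb hc₃ hz <;> grind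
  by_cases hz₂ : z ∈ A u₂
  swap
  · obtain ⟨a, ha, hay⟩ := exists_mem_ne_of_card_eq_two (hA u₁) z
    obtain ⟨b, hb, hab⟩ := exists_mem_ne_of_card_eq_two (hA u₂) a
    apply key a b c z ha hb hc₃ hz <;> grind
  by_cases hyz : y = z
  swap
  · by_cases hRy : R y u₁ u₂
    · have hRz : ¬ R z u₁ u₂ := fun h => hyz (hexc _ _ _ _ hRy h)
      apply key z z y c hz₁ hz₂ hy hc₄ <;> grind
    · apply key y y c z hy₁ hy₂ hc₃ hz <;> grind
  subst hyz
  -- now `y` lies in all four lists, and the lists of `u₃` and `u₄` are `{y, c}`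
  obtain ⟨a, ha, hay⟩ := exists_mem_ne_of_card_eq_two (hA u₁) y
  obtain ⟨b, hb, hby⟩ := exists_mem_ne_of_card_eq_two (hA u₂) y
  have hac : a ≠ c := fun h => hc₁ (h ▸ ha)
  have hbc : b ≠ c := fun h => hc₂ (h ▸ hb)
  by_cases hab : a = b
  swap
  · apply key a b y c ha hb hy hc₄ <;> grind
  subst hab
  by_cases hRa : R a u₁ u₂
  swap
  · apply key a a y c ha hb hy hc₄ <;> grind
  by_cases r13 : R y u₁ u₃
  swap
  · apply key y a y c hy₁ hb hy hc₄ <;> grind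
  by_cases r23 : R y u₂ u₃
  swap
  · apply key a y y c ha hy₂ hy hc₄ <;> grind
  by_cases r24 : R y u₂ u₄
  swap
  · apply key a y c y ha hy₂ hc₃ hz <;> grind
  have r14 : ¬ R y u₁ u₄ := fun h =>
    hcyc y ⟨r13, hsymm _ _ _ r23, r24, hsymm _ _ _ h⟩
  apply key y a c y hy₁ hb hc₃ hz <;> grind

/-- Colouring a star with four edges and equal lists: the four ends have three perfect matchings, and
if none of the splittings into two pairs can be coloured, then each matching is present in one of the
two colours of the lists, so two of them form a monochromatic 4-cycle. -/
theorem exists_starSafe_of_equal_lists {A : τ → Finset ℕ} (hA : ∀ x, (A x).card = 2)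
    {R : ℕ → τ → τ → Prop} (hsymm : ∀ k u v, R k u v → R k v u)
    (hexc : ∀ k k' u v, R k u v → R k' u v → k = k') {N : Finset τ}
    {u₁ u₂ u₃ u₄ : τ} (h12 : u₁ ≠ u₂) (h13 : u₁ ≠ u₃)
    (h14 : u₁ ≠ u₄) (h23 : u₂ ≠ u₃) (h24 : u₂ ≠ u₄) (h34 : u₃ ≠ u₄)
    (hN : ∀ u ∈ N, u = u₁ ∨ u = u₂ ∨ u = u₃ ∨ u = u₄)
    (e2 : A u₁ = A u₂) (e3 : A u₁ = A u₃) (e4 : A u₁ = A u₄)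
    (y1 : ∀ k, ¬ (R k u₁ u₂ ∧ R k u₂ u₄ ∧ R k u₄ u₃ ∧ R k u₃ u₁))
    (y2 : ∀ k, ¬ (R k u₁ u₂ ∧ R k u₂ u₃ ∧ R k u₃ u₄ ∧ R k u₄ u₁))
    (y3 : ∀ k, ¬ (R k u₁ u₃ ∧ R k u₃ u₂ ∧ R k u₂ u₄ ∧ R k u₄ u₁)) :
    ∃ g : τ → ℕ, (∀ x, g x ∈ A x) ∧ StarSafe R N g := by
  obtain ⟨a, ha, -⟩ := exists_mem_ne_of_card_eq_two (hA u₁) 0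
  obtain ⟨b, hb, hba⟩ := exists_mem_ne_of_card_eq_two (hA u₁) a
  have ha2 := e2 ▸ ha
  have ha3 := e3 ▸ ha
  have ha4 := e4 ▸ ha
  have hb2 := e2 ▸ hb
  have hb3 := e3 ▸ hb
  have hb4 := e4 ▸ hb
  have key := exists_starSafe_of_colours hA R h12 h13 h14 h23 h24 h34 hN
  by_contra hcon
  have hmono : ∀ p q r s, (R a p q ∨ R b r s) → (R b p q ∨ R a r s) →
      ∃ k, (k = a ∨ k = b) ∧ R k p q ∧ R k r s := by
    intro p q r s h1 h2
    rcases h1 with h1 | h1 <;> rcases h2 with h2 | h2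
    · exact absurd (hexc _ _ _ _ h2 h1) hba
    · exact ⟨a, Or.inl rfl, h1, h2⟩
    · exact ⟨b, Or.inr rfl, h2, h1⟩
    · exact absurd (hexc _ _ _ _ h1 h2) hba
  obtain ⟨k, ek, hk, hk'⟩ := hmono u₁ u₂ u₃ u₄
    (by by_contra h; push Not at h; exact hcon (by apply key a a b b ha ha2 hb3 hb4 <;> grind))
    (by by_contra h; push Not at h; exact hcon (by apply key b b a a hb hb2 ha3 ha4 <;> grind))
  obtain ⟨l, el, hl, hl'⟩ := hmono u₁ u₃ u₂ u₄
    (by by_contra h; push Not at h; exact hcon (by apply key a b a b ha hb2 ha3 hb4 <;> grind))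
    (by by_contra h; push Not at h; exact hcon (by apply key b a b a hb ha2 hb3 ha4 <;> grind))
  obtain ⟨j, ej, hj, hj'⟩ := hmono u₁ u₄ u₂ u₃
    (by by_contra h; push Not at h; exact hcon (by apply key a b b a ha hb2 hb3 ha4 <;> grind))
    (by by_contra h; push Not at h; exact hcon (by apply key b a a b hb ha2 ha3 hb4 <;> grind))
  -- each of the three matchings is monochromatic in `a` or `b`, so two have the same colour
  have hpig : k = l ∨ k = j ∨ l = j := by
    rcases ek with rfl | rfl <;> rcases el with rfl | rfl <;> rcases ej with rfl | rfl <;> simp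
  rcases hpig with rfl | rfl | rfl
  · exact y1 _ ⟨hk, hl', hsymm _ _ _ hk', hsymm _ _ _ hl⟩
  · exact y2 _ ⟨hk, hj', hk', hsymm _ _ _ hj⟩
  · exact y3 _ ⟨hl, hsymm _ _ _ hj', hl', hsymm _ _ _ hj⟩

/-- Colouring a star with four edges, so that the result is safe with respect to adjacency in a
colouring all of whose colour classes are forests. -/
theorem exists_colouring_four {A : τ → Finset ℕ} (hA : ∀ x, (A x).card = 2)
    {R : ℕ → τ → τ → Prop} (hsymm : ∀ k u v, R k u v → R k v u)
    (hexc : ∀ k k' u v, R k u v → R k' u v → k = k') {N : Finset τ} (hN : N.card = 4)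
    (htri : ∀ k, ∀ u ∈ N, ∀ v ∈ N, ∀ w ∈ N, u ≠ v → u ≠ w → v ≠ w →
      ¬ (R k u v ∧ R k u w ∧ R k v w))
    (hcyc : ∀ k, ∀ u ∈ N, ∀ v ∈ N, ∀ w ∈ N, ∀ x ∈ N, u ≠ v → u ≠ w → u ≠ x → v ≠ w → v ≠ x →
      w ≠ x → ¬ (R k u v ∧ R k v w ∧ R k w x ∧ R k x u)) :
    ∃ g : τ → ℕ, (∀ x, g x ∈ A x) ∧ StarSafe R N g := by
  -- a colour occurring in only one list is used there
  by_cases hpriv : ∃ u ∈ N, ∃ c ∈ A u, ∀ w ∈ N, w ≠ u → c ∉ A w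
  · obtain ⟨u, hu, c, hc, hcw⟩ := hpriv
    obtain ⟨g, hg, x, hgx⟩ := exists_colouring_three hA R (N := N.erase u) (K := ∅)
      (by rw [Finset.card_erase_of_mem hu, hN]) (by simp)
      (fun k _ a ha b hb d hd => htri k a (Finset.mem_of_mem_erase ha) b (Finset.mem_of_mem_erase hb)
        d (Finset.mem_of_mem_erase hd))
    refine ⟨Function.update g u c, fun y => ?_, fun k => ?_⟩
    · by_cases hy : y = u
      · subst hy
        simpa using hc
      · simpa [hy] using hg y
    · by_cases hk : k = c
      · left
        subst hk
        rw [Finset.card_le_one]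
        have : ∀ y ∈ N.filter fun y => Function.update g u k y = k, y = u := by
          intro y hy
          rw [Finset.mem_filter] at hy
          by_contra hyu
          rw [Function.update_of_ne hyu] at hy
          exact hcw y hy.1 hyu (hy.2 ▸ hg y)
        exact fun a ha b hb => (this a ha).trans (this b hb).symm
      · have hsub : (N.filter fun y => Function.update g u c y = k) =
            (N.erase u).filter fun y => g y = k := by
          ext y
          rw [Finset.mem_filter, Finset.mem_filter, Finset.mem_erase]
          by_cases hyu : y = u
          · subst hyu
            simp [Ne.symm hk]
          · simp [hyu]
        rw [hsub]
        rcases hgx k with h | ⟨-, -, h⟩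
        · exact Or.inl h
        · exact Or.inr h
  push Not at hpriv
  obtain ⟨u₁, u₂, u₃, u₄, h12, h13, h14, h23, h24, h34, hNe⟩ := Finset.card_eq_four.1 hN
  have m1 : u₁ ∈ N := by simp [hNe]
  have m2 : u₂ ∈ N := by simp [hNe]
  have m3 : u₃ ∈ N := by simp [hNe]
  have m4 : u₄ ∈ N := by simp [hNe]
  have hN' : ∀ u ∈ N, u = u₁ ∨ u = u₂ ∨ u = u₃ ∨ u = u₄ := by
    intro u hu
    rw [hNe] at hu
    simpa using hu
  -- a colour in exactly two lists settles the matter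
  have hshared : ∀ p ∈ N, ∀ q ∈ N, ∀ r ∈ N, ∀ s ∈ N, p ≠ q → p ≠ r → p ≠ s → q ≠ r → q ≠ s →
      r ≠ s → ∀ c, c ∉ A p → c ∉ A q → c ∈ A r → c ∈ A s →
      ∃ g : τ → ℕ, (∀ x, g x ∈ A x) ∧ StarSafe R N g := by
    intro p hp q hq r hr s hs hpq hpr hps hqr hqs hrs c h1 h2 h3 h4
    refine exists_starSafe_of_shared_colour hA hsymm hexc hpq hpr hps hqr hqs hrs ?_ ?_ h1 h2 h3 h4
    · intro u hu
      by_contra hcon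
      push Not at hcon
      have : ({u, p, q, r, s} : Finset τ) ⊆ N := by
        intro t ht
        simp only [Finset.mem_insert, Finset.mem_singleton] at ht
        rcases ht with rfl | rfl | rfl | rfl | rfl <;> assumption
      have := Finset.card_le_card this
      rw [hN, Finset.card_insert_of_notMem (by simp [hcon]),
        Finset.card_insert_of_notMem (by simp [hpq, hpr, hps]),
        Finset.card_insert_of_notMem (by simp [hqr, hqs]), Finset.card_pair hrs] at this
      omega
    · exact fun k => hcyc k p hp r hr q hq s hs hpr hpq hps hqr.symm hrs hqs
  have hdiff : ∀ p ∈ N, ∀ q ∈ N, ∀ r ∈ N, ∀ s ∈ N, p ≠ q → p ≠ r → p ≠ s → q ≠ r → q ≠ s →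
      r ≠ s → (∀ u ∈ N, u = p ∨ u = q ∨ u = r ∨ u = s) → A p ≠ A q →
      ∃ g : τ → ℕ, (∀ x, g x ∈ A x) ∧ StarSafe R N g := by
    intro p hp q hq r hr s hs hpq hpr hps hqr hqs hrs hNpq hne
    obtain ⟨a, ha, haq⟩ : ∃ a ∈ A p, a ∉ A q := by
      by_contra hcon
      push Not at hcon
      exact hne (Finset.eq_of_subset_of_card_le hcon (by rw [hA, hA]))
    obtain ⟨b, hb, hbp⟩ : ∃ b ∈ A q, b ∉ A p := by
      by_contra hcon
      push Not at hcon
      exact hne (Finset.eq_of_subset_of_card_le hcon (by rw [hA, hA])).symm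
    by_cases har : a ∈ A r
    · by_cases has : a ∈ A s
      · by_cases hbr : b ∈ A r
        · by_cases hbs : b ∈ A s
          · have hab : a ≠ b := fun h => haq (h ▸ hb)
            have two : ∀ t, a ∈ A t → b ∈ A t → A t = {a, b} := by
              intro t h1 h2
              refine (Finset.eq_of_subset_of_card_le (fun y hy => ?_)
                (by rw [hA, Finset.card_pair hab])).symm
              simp only [Finset.mem_insert, Finset.mem_singleton] at hy
              rcases hy with rfl | rfl <;> assumption
            have hr2 := two r har hbr
            have hs2 := two s has hbs
            obtain ⟨x, hx, hxa⟩ := exists_mem_ne_of_card_eq_two (hA p) a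
            have hxb : x ≠ b := fun h => hbp (h ▸ hx)
            have hxr : x ∉ A r := by simp [hr2, hxa, hxb]
            have hxs : x ∉ A s := by simp [hs2, hxa, hxb]
            obtain ⟨w, hw, hwp, hxw⟩ := hpriv p hp x hx
            rcases hNpq w hw with rfl | rfl | rfl | rfl
            · exact absurd rfl hwp
            · exact hshared r hr s hs p hp w hq hrs hpr.symm hqr.symm hps.symm hqs.symm hpq x
                hxr hxs hx hxw
            · exact absurd hxw hxr
            · exact absurd hxw hxs
          · exact hshared p hp s hs q hq r hr hps hpq hpr hqs.symm hrs.symm hqr b hbp hbs hb hbr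
        · by_cases hbs : b ∈ A s
          · exact hshared p hp r hr q hq s hs hpr hpq hps hqr.symm hrs hqs b hbp hbr hb hbs
          · obtain ⟨w, hw, hwq, hbw⟩ := hpriv q hq b hb
            rcases hNpq w hw with rfl | rfl | rfl | rfl <;> contradiction
      · exact hshared q hq s hs p hp r hr hqs hpq.symm hqr hps.symm hrs.symm hpr a haq has ha har
    · by_cases has : a ∈ A s
      · exact hshared q hq r hr p hp s hs hqr hpq.symm hqs hpr.symm hrs hps a haq har ha has
      · obtain ⟨w, hw, hwp, haw⟩ := hpriv p hp a ha
        rcases hNpq w hw with rfl | rfl | rfl | rfl <;> contradiction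
  by_cases e2 : A u₁ = A u₂
  swap
  · exact hdiff u₁ m1 u₂ m2 u₃ m3 u₄ m4 h12 h13 h14 h23 h24 h34 hN' e2
  by_cases e3 : A u₁ = A u₃
  swap
  · exact hdiff u₁ m1 u₃ m3 u₂ m2 u₄ m4 h13 h12 h14 h23.symm h34 h24
      (fun u hu => by have := hN' u hu; tauto) e3
  by_cases e4 : A u₁ = A u₄
  swap
  · exact hdiff u₁ m1 u₄ m4 u₂ m2 u₃ m3 h14 h12 h13 h24.symm h34.symm h23
      (fun u hu => by have := hN' u hu; tauto) e4
  exact exists_starSafe_of_equal_lists hA hsymm hexc h12 h13 h14 h23 h24 h34 hN' e2 e3 e4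
    (fun k => hcyc k u₁ m1 u₂ m2 u₄ m4 u₃ m3 h12 h14 h13 h24 h23 h34.symm)
    (fun k => hcyc k u₁ m1 u₂ m2 u₃ m3 u₄ m4 h12 h13 h14 h23 h24 h34)
    (fun k => hcyc k u₁ m1 u₃ m3 u₂ m2 u₄ m4 h13 h12 h14 h23.symm h34 h24)

end Star

/-! ### Sparse colourings when the density bound is in `(3/2, 2]` -/

section DensityTwo

variable {V : Type*} [DecidableEq V] {E : Finset (Sym2 V)} {L : Sym2 V → Finset ℕ}

/-- The weights for which the colours outside `K` are forests, while those in `K` have at most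
`4/3 (|Z| - 1)` edges in every `Z`; this allows cycles, but no triangles. -/
def weightOf (K : Finset ℕ) (k : ℕ) : ℚ := if k ∈ K then 4 / 3 else 1

theorem one_le_weightOf (K : Finset ℕ) (k : ℕ) : 1 ≤ weightOf K k := by
  unfold weightOf
  split_ifs <;> norm_num

theorem weightOf_le (K : Finset ℕ) (k : ℕ) : weightOf K k ≤ 4 / 3 := by
  unfold weightOf
  split_ifs <;> norm_num

theorem SparseOn.mono {c : Sym2 V → ℕ} {α β : ℕ → ℚ} {S : Finset V} (h : SparseOn E c α S)
    (hαβ : ∀ k, α k ≤ β k) : SparseOn E c β S := by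
  intro k Z hZ hne
  refine (h k Z hZ hne).trans (mul_le_mul_of_nonneg_right (hαβ k) ?_)
  have : (1 : ℚ) ≤ Z.card := by exact_mod_cast hne.card_pos
  linarith

theorem edgesIn_of_card_le_one (hE : ∀ e ∈ E, ¬ e.IsDiag) {Z : Finset V} (hZ : Z.card ≤ 1) :
    edgesIn E Z = 0 := by
  have h1 := two_mul_edgesIn_le hE Z
  have : Z.card = 0 ∨ Z.card = 1 := by omega
  rcases this with h | h <;> rw [h] at h1 <;> omega

theorem edgesIn_pair_eq_zero (hE : ∀ e ∈ E, ¬ e.IsDiag) {a b : V} (h : s(a, b) ∉ E) :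
    edgesIn E {a, b} = 0 := by
  unfold edgesIn
  rw [Finset.card_eq_zero, Finset.filter_eq_empty_iff]
  intro e he hcon
  induction e with
  | _ x y =>
  rw [Finset.mk_mem_sym2_iff] at hcon
  simp only [Finset.mem_insert, Finset.mem_singleton] at hcon
  rcases hcon with ⟨rfl | rfl, rfl | rfl⟩
  · exact hE _ he (by simp)
  · exact h he
  · exact h (by rwa [Sym2.eq_swap])
  · exact hE _ he (by simp)

/-- Adding a vertex `v` to a sparse colouring: a colour used at most once at `v` gets a leaf and
stays as sparse as it was, and a forest in which `v` is joined to two vertices which are not adjacent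
in this forest has at most one cycle, which is not a triangle. -/
theorem exists_sparseOn_extend (hE : ∀ e ∈ E, ¬ e.IsDiag) {S : Finset V} {v : V}
    {c : Sym2 V → ℕ} (hc : ∀ e, c e ∈ L e) {α β : ℕ → ℚ} (hα : ∀ k, 1 ≤ α k) (hαβ : ∀ k, α k ≤ β k)
    (hsp : SparseOn E c α (S.erase v)) {g : V → ℕ} (hg : ∀ u, g u ∈ L s(v, u))
    (h : ∀ k, (((S.erase v).filter fun u => s(v, u) ∈ E).filter fun u => g u = k).card ≤ 1 ∨
      (α k = 1 ∧ β k = 4 / 3 ∧ ∃ u u',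
        (((S.erase v).filter fun u => s(v, u) ∈ E).filter fun u => g u = k) ⊆ {u, u'} ∧
          s(u, u') ∉ colourClass E c k)) :
    ∃ c' : Sym2 V → ℕ, (∀ e, c' e ∈ L e) ∧ SparseOn E c' β S := by
  obtain ⟨c', hc', hout, hin⟩ := exists_recolour hE hc v hg
  refine ⟨c', hc', fun k Z hZ hne => ?_⟩
  have hcls : ∀ c k, ∀ e ∈ colourClass E c k, ¬ e.IsDiag :=
    fun c k e he => hE e (colourClass_subset _ _ _ he)
  have h1Z : (1 : ℚ) ≤ Z.card := by exact_mod_cast hne.card_pos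
  by_cases hvZ : v ∈ Z
  swap
  · rw [hout k Z hvZ]
    exact hsp.mono hαβ k Z (fun u hu => Finset.mem_erase.2 ⟨fun h => hvZ (h ▸ hu), hZ hu⟩) hne
  have hβ := (hα k).trans (hαβ k)
  rcases (Z.erase v).eq_empty_or_nonempty with hemp | hne'
  · have : Z.card = 1 := by
      have := Finset.card_erase_of_mem hvZ
      rw [hemp, Finset.card_empty] at this
      have := hne.card_pos
      omega
    rw [edgesIn_of_card_le_one (hcls c' k) this.le, this]
    simp
  have hZ' := Finset.erase_subset_erase v hZ
  have hold := hsp k (Z.erase v) hZ' hne'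
  have hcard : ((Z.erase v).card : ℚ) = Z.card - 1 := by
    rw [Finset.card_erase_of_mem hvZ, Nat.cast_sub hne.card_pos, Nat.cast_one]
  have hcard2 : (1 : ℚ) ≤ (Z.erase v).card := by exact_mod_cast hne'.card_pos
  rw [hin k Z hvZ]
  set M := (Z.erase v).filter fun u => s(v, u) ∈ E ∧ g u = k with hM
  have hMsub : M ⊆ ((S.erase v).filter fun u => s(v, u) ∈ E).filter fun u => g u = k := by
    intro u hu
    rw [hM, Finset.mem_filter] at hu
    rw [Finset.mem_filter, Finset.mem_filter]
    exact ⟨⟨hZ' hu.1, hu.2.1⟩, hu.2.2⟩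
  have hleaf : M.card ≤ 1 → ((edgesIn (colourClass E c k) (Z.erase v) + M.card : ℕ) : ℚ) ≤
      β k * (Z.card - 1) := by
    intro h1
    have h2 : (M.card : ℚ) ≤ 1 := by exact_mod_cast h1
    push_cast
    nlinarith [hα k, hαβ k]
  rcases h k with h1 | ⟨h1, h2, u, u', huu, hnot⟩
  · exact hleaf ((Finset.card_le_card hMsub).trans h1)
  by_cases hM1 : M.card ≤ 1
  · exact hleaf hM1
  have hMuu : M = {u, u'} := by
    refine Finset.eq_of_subset_of_card_le (hMsub.trans huu) ?_
    have := Finset.card_le_two (a := u) (b := u')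
    omega
  have hM2 : M.card ≤ 2 := by
    rw [hMuu]
    exact Finset.card_le_two
  have hMZ : M ⊆ Z.erase v := Finset.filter_subset _ _
  rw [h1, one_mul, hcard] at hold
  rw [h2]
  have hM2' : (M.card : ℚ) ≤ 2 := by exact_mod_cast hM2
  by_cases h4 : 4 ≤ Z.card
  · have h4' : (4 : ℚ) ≤ Z.card := by exact_mod_cast h4
    push_cast
    linarith
  · have hZe : M = Z.erase v := by
      refine Finset.eq_of_subset_of_card_le hMZ ?_
      rw [Finset.card_erase_of_mem hvZ]
      omega
    rw [← hZe, hMuu, edgesIn_pair_eq_zero (hcls c k) hnot, ← hMuu]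
    have : M.card + 1 = Z.card := by
      rw [hZe, Finset.card_erase_of_mem hvZ]
      have := hne.card_pos
      omega
    rw [← this]
    have h3 : (2 : ℚ) ≤ M.card := by exact_mod_cast (show 2 ≤ M.card by omega)
    push_cast
    linarith

/-- A triangle in a colour which is a forest is impossible. -/
theorem SparseOn.not_triangle {c : Sym2 V → ℕ} {α : ℕ → ℚ}
    {S : Finset V} (h : SparseOn E c α S) {k : ℕ} (hk : α k = 1) {u v w : V} (hu : u ∈ S)
    (hv : v ∈ S) (hw : w ∈ S) (huv : u ≠ v) (huw : u ≠ w) (hvw : v ≠ w) :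
    ¬ (s(u, v) ∈ colourClass E c k ∧ s(u, w) ∈ colourClass E c k ∧
      s(v, w) ∈ colourClass E c k) := by
  rintro ⟨h1, h2, h3⟩
  have hcard : ({u, v, w} : Finset V).card = 3 := Finset.card_eq_three.2 ⟨u, v, w, huv, huw, hvw, rfl⟩
  have h4 := h k {u, v, w} (by
    intro x hx
    simp only [Finset.mem_insert, Finset.mem_singleton] at hx
    rcases hx with rfl | rfl | rfl <;> assumption) ⟨u, by simp⟩
  have h5 : ({s(u, v), s(u, w), s(v, w)} : Finset (Sym2 V)).card ≤
      edgesIn (colourClass E c k) {u, v, w} := by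
    refine Finset.card_le_card fun e he => ?_
    simp only [Finset.mem_insert, Finset.mem_singleton] at he
    rw [Finset.mem_filter]
    rcases he with rfl | rfl | rfl
    · exact ⟨h1, by simp⟩
    · exact ⟨h2, by simp⟩
    · exact ⟨h3, by simp⟩
  rw [Finset.card_eq_three.2 ⟨s(u, v), s(u, w), s(v, w), by simp [hvw, huw], by
    simp [huv, huw], by simp [huv, huw], rfl⟩] at h5
  have h6 : (3 : ℚ) ≤ edgesIn (colourClass E c k) {u, v, w} := by exact_mod_cast h5
  rw [hk, hcard] at h4
  norm_num at h4
  linarith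

/-- A 4-cycle in a colour which is a forest is impossible. -/
theorem SparseOn.not_four_cycle {c : Sym2 V → ℕ} {α : ℕ → ℚ}
    {S : Finset V} (h : SparseOn E c α S) {k : ℕ} (hk : α k = 1) {u v w x : V} (hu : u ∈ S)
    (hv : v ∈ S) (hw : w ∈ S) (hx : x ∈ S) (huv : u ≠ v) (huw : u ≠ w) (hux : u ≠ x) (hvw : v ≠ w)
    (hvx : v ≠ x) (hwx : w ≠ x) :
    ¬ (s(u, v) ∈ colourClass E c k ∧ s(v, w) ∈ colourClass E c k ∧
      s(w, x) ∈ colourClass E c k ∧ s(x, u) ∈ colourClass E c k) := by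
  rintro ⟨h1, h2, h3, h3'⟩
  have hcard : ({u, v, w, x} : Finset V).card = 4 :=
    Finset.card_eq_four.2 ⟨u, v, w, x, huv, huw, hux, hvw, hvx, hwx, rfl⟩
  have h4 := h k {u, v, w, x} (by
    intro x hx
    simp only [Finset.mem_insert, Finset.mem_singleton] at hx
    rcases hx with rfl | rfl | rfl | rfl <;> assumption) ⟨u, by simp⟩
  have h5 : ({s(u, v), s(v, w), s(w, x), s(x, u)} : Finset (Sym2 V)).card ≤
      edgesIn (colourClass E c k) {u, v, w, x} := by
    refine Finset.card_le_card fun e he => ?_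
    simp only [Finset.mem_insert, Finset.mem_singleton] at he
    rw [Finset.mem_filter]
    rcases he with rfl | rfl | rfl | rfl
    · exact ⟨h1, by simp⟩
    · exact ⟨h2, by simp⟩
    · exact ⟨h3, by simp⟩
    · exact ⟨h3', by simp⟩
  rw [Finset.card_eq_four.2 ⟨s(u, v), s(v, w), s(w, x), s(x, u), by simp; grind, by simp; grind,
    by simp; grind, by simp; grind, by simp; grind, by simp; grind, rfl⟩] at h5
  have h6 : (4 : ℚ) ≤ edgesIn (colourClass E c k) {u, v, w, x} := by exact_mod_cast h5
  rw [hk, hcard] at h4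
  norm_num at h4
  linarith

/-- A vertex of degree three can be added to a colouring in which at most one colour is not a
forest. -/
theorem exists_sparseOn_extend_three (hE : ∀ e ∈ E, ¬ e.IsDiag) (hL : ∀ e, (L e).card = 2)
    {S : Finset V} {v : V} (hv : v ∈ S) (hdeg : degIn E v S = 3) {c : Sym2 V → ℕ}
    (hc : ∀ e, c e ∈ L e) {K : Finset ℕ} (hK : K.card ≤ 1)
    (hsp : SparseOn E c (weightOf K) (S.erase v)) :
    ∃ c' : Sym2 V → ℕ, (∀ e, c' e ∈ L e) ∧ ∃ x, SparseOn E c' (weightOf (insert x K)) S := by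
  rw [← degIn_erase_self hE hv] at hdeg
  set N := (S.erase v).filter fun u => s(v, u) ∈ E with hN
  have hNS : ∀ u ∈ N, u ∈ S.erase v := fun u hu => (Finset.mem_filter.1 hu).1
  obtain ⟨g, hg, x, hgx⟩ := exists_colouring_three (A := fun u => L s(v, u)) (fun u => hL _)
    (fun k u w => s(u, w) ∈ colourClass E c k) (N := N) hdeg hK
    (fun k hk u hu w hw y hy huw huy hwy =>
      hsp.not_triangle (by simp [weightOf, hk]) (hNS u hu) (hNS w hw) (hNS y hy) huw huy hwy)
  obtain ⟨c', hc', hsp'⟩ := exists_sparseOn_extend hE hc (one_le_weightOf K)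
    (β := weightOf (insert x K)) (fun k => by
      unfold weightOf
      by_cases h1 : k ∈ K
      · simp [h1]
      · simp only [h1, if_false]
        split_ifs <;> norm_num) hsp hg (fun k => by
      rcases hgx k with h | ⟨rfl, hk, h⟩
      · exact Or.inl h
      · exact Or.inr ⟨by simp [weightOf, hk], by simp [weightOf], h⟩)
  exact ⟨c', hc', x, hsp'⟩

/-- A vertex of degree four can be added to a colouring by forests. -/
theorem exists_sparseOn_extend_four (hE : ∀ e ∈ E, ¬ e.IsDiag) (hL : ∀ e, (L e).card = 2)
    {S : Finset V} {v : V} (hv : v ∈ S) (hdeg : degIn E v S = 4) {c : Sym2 V → ℕ}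
    (hc : ∀ e, c e ∈ L e) (hsp : SparseOn E c (weightOf ∅) (S.erase v)) :
    ∃ c' : Sym2 V → ℕ, (∀ e, c' e ∈ L e) ∧ SparseOn E c' (fun _ => 4 / 3) S := by
  rw [← degIn_erase_self hE hv] at hdeg
  set N := (S.erase v).filter fun u => s(v, u) ∈ E with hN
  have hNS : ∀ u ∈ N, u ∈ S.erase v := fun u hu => (Finset.mem_filter.1 hu).1
  have hw1 : ∀ k, weightOf ∅ k = 1 := fun k => by simp [weightOf]
  obtain ⟨g, hg, hgx⟩ := exists_colouring_four (A := fun u => L s(v, u)) (fun u => hL _)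
    (R := fun k u w => s(u, w) ∈ colourClass E c k) (fun k u w h => by rwa [Sym2.eq_swap])
    (fun k k' u w h h' => (Finset.mem_filter.1 h).2.symm.trans (Finset.mem_filter.1 h').2)
    (N := N) hdeg
    (fun k u hu w hw y hy huw huy hwy =>
      hsp.not_triangle (hw1 k) (hNS u hu) (hNS w hw) (hNS y hy) huw huy hwy)
    (fun k u hu w hw y hy z hz h1 h2 h3 h4 h5 h6 =>
      hsp.not_four_cycle (hw1 k) (hNS u hu) (hNS w hw) (hNS y hy) (hNS z hz) h1 h2 h3 h4 h5 h6)
  exact exists_sparseOn_extend hE hc (one_le_weightOf ∅) (weightOf_le ∅) hsp hg fun k => by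
    rcases hgx k with h | h
    · exact Or.inl h
    · exact Or.inr ⟨hw1 k, rfl, h⟩

/-- The excess `e(P) - 2 (|P| - 1)` of a vertex set `P` over the number of edges of two forests. -/
def excess (E : Finset (Sym2 V)) (P : Finset V) : ℤ := edgesIn E P - 2 * P.card + 2

theorem excess_of_card_eq_one (hE : ∀ e ∈ E, ¬ e.IsDiag) {P : Finset V} (hP : P.card = 1) :
    excess E P = 0 := by
  unfold excess
  rw [edgesIn_of_card_le_one hE hP.le, hP]
  norm_num

variable [Fintype V]

/-- Extending a sparse colouring of the fibres of `π`, when no union of fibres has an excess larger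
than the sum of the excesses of the fibres. -/
theorem exists_sparseOn_of_excess (hL : ∀ e, (L e).card = 2) {S : Finset V} (π : V → V)
    {c₀ : Sym2 V → ℕ} (hc₀ : ∀ e, c₀ e ∈ L e) {α : ℕ → ℚ} (hα : ∀ k, 1 ≤ α k)
    (hfib : ∀ y ∈ S.image π, SparseOn E c₀ α (S.filter fun v => π v = y))
    (h : ∀ C ⊆ S.image π, C.Nonempty → excess E (S.filter fun v => π v ∈ C) ≤
      ∑ y ∈ C, excess E (S.filter fun v => π v = y)) :
    ∃ c : Sym2 V → ℕ, (∀ e, c e ∈ L e) ∧ SparseOn E c α S := by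
  refine exists_sparseOn_of_contraction hL π hc₀ hα hfib fun C hC hne => ?_
  set U := S.filter fun v => π v ∈ C with hU
  have himg : U.image π = C := by
    ext y
    rw [Finset.mem_image]
    constructor
    · rintro ⟨v, hv, rfl⟩
      exact (Finset.mem_filter.1 hv).2
    · intro hy
      obtain ⟨v, hv, rfl⟩ := Finset.mem_image.1 (hC hy)
      exact ⟨v, Finset.mem_filter.2 ⟨hv, hy⟩, rfl⟩
  have hfibU : ∀ y ∈ C, (U.filter fun v => π v = y) = S.filter fun v => π v = y := by
    intro y hy
    ext v
    simp only [hU, Finset.mem_filter]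
    constructor
    · rintro ⟨⟨h1, -⟩, h2⟩
      exact ⟨h1, h2⟩
    · rintro ⟨h1, h2⟩
      exact ⟨⟨h1, h2 ▸ hy⟩, h2⟩
  have h1 := edgesIn_eq_sum_fibres E π U
  rw [himg, Finset.sum_congr rfl fun y hy => by rw [hfibU y hy]] at h1
  have h2 : excess E U ≤ ∑ y ∈ C, excess E (S.filter fun v => π v = y) := h C hC hne
  have h3 : U.card = ∑ y ∈ C, (S.filter fun v => π v = y).card := by
    rw [Finset.card_eq_sum_card_fiberwise (f := π) (t := C)
      (fun v hv => Finset.mem_coe.2 (Finset.mem_filter.1 hv).2)]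
    exact Finset.sum_congr rfl fun y hy => by rw [hfibU y hy]
  unfold excess at h2
  rw [Finset.sum_add_distrib, Finset.sum_sub_distrib, ← Finset.mul_sum, ← Nat.cast_sum,
    ← Nat.cast_sum, ← h3, Finset.sum_const, nsmul_eq_mul] at h2
  have h4 := hne.card_pos
  omega

/-- Nonpositive excess everywhere: forests suffice. -/
theorem exists_sparseOn_of_excess_nonpos (hE : ∀ e ∈ E, ¬ e.IsDiag) (hL : ∀ e, (L e).card = 2)
    {S : Finset V} (h : ∀ Z ⊆ S, Z.Nonempty → excess E Z ≤ 0) :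
    ∃ c : Sym2 V → ℕ, (∀ e, c e ∈ L e) ∧ SparseOn E c (weightOf ∅) S := by
  choose d hd using fun e => exists_mem_ne_of_card_eq_two (hL e) 0
  have hcard : ∀ y ∈ S, (S.filter fun v => id v = y).card = 1 := by
    intro y hy
    rw [Finset.card_eq_one]
    refine ⟨y, ?_⟩
    ext v
    simp only [Finset.mem_filter, Finset.mem_singleton, id]
    exact ⟨fun h => h.2, fun h => ⟨h ▸ hy, h⟩⟩
  refine exists_sparseOn_of_excess hL id (fun e => (hd e).1) (one_le_weightOf ∅) ?_ ?_
  · intro y hy k Z hZ hne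
    rw [Finset.image_id] at hy
    have h1 := Finset.card_le_card hZ
    rw [hcard y hy] at h1
    have h2 : Z.card = 1 := le_antisymm h1 hne.card_pos
    rw [edgesIn_of_card_le_one (fun e he => hE e (colourClass_subset _ _ _ he)) h1, h2]
    simp
  · intro C hC hne
    rw [Finset.image_id] at hC
    rw [Finset.sum_eq_zero fun y hy => excess_of_card_eq_one hE (hcard y (hC hy))]
    refine h _ (Finset.filter_subset _ _) ?_
    obtain ⟨y, hy⟩ := hne
    exact ⟨y, Finset.mem_filter.2 ⟨hC hy, hy⟩⟩

/-- Excess one on `S`, but nonpositive excess on all smaller sets: at most one colour is not a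
forest. -/
theorem exists_sparseOn_of_excess_eq_one (hE : ∀ e ∈ E, ¬ e.IsDiag) (hL : ∀ e, (L e).card = 2)
    {S : Finset V} (hS : excess E S = 1) (h : ∀ Z ⊂ S, Z.Nonempty → excess E Z ≤ 0) :
    ∃ c : Sym2 V → ℕ, (∀ e, c e ∈ L e) ∧ ∃ x, SparseOn E c (weightOf {x}) S := by
  have hne : S.Nonempty := by
    rw [Finset.nonempty_iff_ne_empty]
    rintro rfl
    simp [excess, edgesIn_empty] at hS
  have hcard : 2 ≤ S.card := by
    by_contra hcon
    have := hne.card_pos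
    rw [excess_of_card_eq_one hE (by omega)] at hS
    omega
  obtain ⟨v, hv, hdeg⟩ := exists_degIn_mul_card_le hE hne
  have hS' := hS
  unfold excess at hS'
  have hdeg3 : degIn E v S ≤ 3 := by
    by_contra hcon
    have h1 : 4 * S.card ≤ 2 * edgesIn E S := le_trans (Nat.mul_le_mul (by omega) le_rfl) hdeg
    omega
  have hss : S.erase v ⊂ S := Finset.erase_ssubset hv
  have hc := Finset.card_erase_of_mem hv
  have h1 := h _ hss (Finset.card_pos.1 (by omega))
  have h2 := edgesIn_erase hE hv
  rw [degIn_erase_self hE hv] at h2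
  unfold excess at h1
  obtain ⟨c, hc, hsp⟩ := exists_sparseOn_of_excess_nonpos hE hL (S := S.erase v)
    (fun Z hZ => h Z (lt_of_le_of_lt hZ hss))
  obtain ⟨c', hc', x, hsp'⟩ := exists_sparseOn_extend_three hE hL hv (by omega) hc (by simp) hsp
  exact ⟨c', hc', x, by simpa using hsp'⟩

/-- Excess two on `S`, at most one on all smaller sets, and no two disjoint sets of excess one. If
`v` has degree three, then all sets of excess one in `S \ {v}` contain the smallest such set, so `S
\ {v}` has a colouring with only one cycle. If `S` is 4-regular, then smaller sets have nonpositive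
excess, because the complement of a set of excess one has excess one. -/
theorem exists_sparseOn_of_excess_eq_two (hE : ∀ e ∈ E, ¬ e.IsDiag) (hL : ∀ e, (L e).card = 2)
    {S : Finset V} (hS : excess E S = 2) (h : ∀ Z ⊂ S, Z.Nonempty → excess E Z ≤ 1)
    (hdisj : ∀ Y ⊆ S, ∀ Z ⊆ S, Y.Nonempty → Z.Nonempty → Disjoint Y Z →
      excess E Y + excess E Z < 2) :
    ∃ c : Sym2 V → ℕ, (∀ e, c e ∈ L e) ∧ SparseOn E c (fun _ => 4 / 3) S := by
  rcases S.eq_empty_or_nonempty with rfl | hne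
  · choose d hd using fun e => exists_mem_ne_of_card_eq_two (hL e) 0
    refine ⟨d, fun e => (hd e).1, fun k Z hZ hne => ?_⟩
    rw [Finset.subset_empty.1 hZ] at hne
    simp at hne
  have hcard : 2 ≤ S.card := by
    by_contra hcon
    have := hne.card_pos
    rw [excess_of_card_eq_one hE (by omega)] at hS
    omega
  have hS' := hS
  unfold excess at hS'
  have hdeg_ge : ∀ v ∈ S, 3 ≤ degIn E v S := by
    intro v hv
    have h1 := h _ (Finset.erase_ssubset hv) (Finset.card_pos.1 (by
      rw [Finset.card_erase_of_mem hv]; omega))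
    have h2 := edgesIn_erase hE hv
    rw [degIn_erase_self hE hv] at h2
    have hc := Finset.card_erase_of_mem hv
    unfold excess at h1
    omega
  by_cases hlow : ∃ v ∈ S, degIn E v S ≤ 3
  · obtain ⟨v, hv, hdeg⟩ := hlow
    have hdeg3 : degIn E v S = 3 := le_antisymm hdeg (hdeg_ge v hv)
    have hss : S.erase v ⊂ S := Finset.erase_ssubset hv
    have hT : excess E (S.erase v) = 1 := by
      have h2 := edgesIn_erase hE hv
      rw [degIn_erase_self hE hv] at h2
      have hc := Finset.card_erase_of_mem hv
      unfold excess
      omega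
    set T := S.erase v with hTdef
    -- the smallest set of excess one
    obtain ⟨Y, hY, hYmin⟩ := Finset.exists_min_image
      (T.powerset.filter fun Y => Y.Nonempty ∧ excess E Y = 1) Finset.card
      ⟨T, Finset.mem_filter.2 ⟨Finset.mem_powerset.2 subset_rfl, Finset.card_pos.1 (by
        rw [hTdef, Finset.card_erase_of_mem hv]; omega), hT⟩⟩
    rw [Finset.mem_filter, Finset.mem_powerset] at hY
    obtain ⟨hYT, hYne, hY1⟩ := hY
    obtain ⟨c₀, hc₀, x, hsp₀⟩ := exists_sparseOn_of_excess_eq_one hE hL hY1 (by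
      intro Z hZ hZne
      have hZT : Z ⊆ T := hZ.subset.trans hYT
      have h1 := h Z (lt_of_le_of_lt hZT hss) hZne
      by_contra hcon
      have h2 := hYmin Z (Finset.mem_filter.2 ⟨Finset.mem_powerset.2 hZT, hZne, by omega⟩)
      have h3 := Finset.card_lt_card hZ
      omega)
    obtain ⟨y₀, hy₀⟩ := hYne
    let π : V → V := fun u => if u ∈ Y then y₀ else u
    have hπ : ∀ u, π u = y₀ ↔ u ∈ Y := by
      intro u
      simp only [π]
      split_ifs with hu
      · simp [hu]
      · simp only [hu, iff_false]
        rintro rfl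
        exact hu hy₀
    have hfib0 : (T.filter fun u => π u = y₀) = Y := by
      ext u
      rw [Finset.mem_filter, hπ]
      exact ⟨fun h => h.2, fun h => ⟨hYT h, h⟩⟩
    have hfib1 : ∀ y ∈ T.image π, y ≠ y₀ → (T.filter fun u => π u = y).card = 1 := by
      intro y hy hyy
      obtain ⟨u, hu, rfl⟩ := Finset.mem_image.1 hy
      have huY : u ∉ Y := fun h => hyy ((hπ u).2 h)
      rw [Finset.card_eq_one]
      refine ⟨u, ?_⟩
      ext w
      rw [Finset.mem_filter, Finset.mem_singleton]
      constructor
      · rintro ⟨-, hw⟩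
        have hwY : w ∉ Y := fun h => hyy (hw ▸ (hπ w).2 h)
        simpa [π, huY, hwY] using hw
      · rintro rfl
        exact ⟨hu, rfl⟩
    obtain ⟨c, hc, hsp⟩ := exists_sparseOn_of_excess (S := T) hL π hc₀ (one_le_weightOf {x}) (by
      intro y hy
      by_cases hyy : y = y₀
      · rw [hyy, hfib0]
        exact hsp₀
      · intro k Z hZ hZne
        have h1 := Finset.card_le_card hZ
        rw [hfib1 y hy hyy] at h1
        have h2 : Z.card = 1 := le_antisymm h1 hZne.card_pos
        rw [edgesIn_of_card_le_one (fun e he => hE e (colourClass_subset _ _ _ he)) h1, h2]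
        simp) (by
      intro C hC hCne
      have hUT : (T.filter fun u => π u ∈ C) ⊆ T := Finset.filter_subset _ _
      have hUne : (T.filter fun u => π u ∈ C).Nonempty := by
        obtain ⟨y, hy⟩ := hCne
        obtain ⟨u, hu, rfl⟩ := Finset.mem_image.1 (hC hy)
        exact ⟨u, Finset.mem_filter.2 ⟨hu, hy⟩⟩
      have hU1 := h _ (lt_of_le_of_lt hUT hss) hUne
      by_cases hyC : y₀ ∈ C
      · rw [Finset.sum_eq_single_of_mem y₀ hyC fun y hy hyy =>
          excess_of_card_eq_one hE (hfib1 y (hC hy) hyy), hfib0, hY1]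
        exact hU1
      · rw [Finset.sum_eq_zero fun y hy => excess_of_card_eq_one hE
          (hfib1 y (hC hy) fun hyy => hyC (hyy ▸ hy))]
        have := hdisj Y (hYT.trans hss.subset) _ (hUT.trans hss.subset) ⟨y₀, hy₀⟩ hUne (by
          rw [Finset.disjoint_left]
          intro u hu hu'
          exact hyC (((hπ u).2 hu) ▸ (Finset.mem_filter.1 hu').2))
        omega)
    obtain ⟨c', hc', z, hsp'⟩ := exists_sparseOn_extend_three hE hL hv hdeg3 hc (by simp) hsp
    exact ⟨c', hc', hsp'.mono (weightOf_le _)⟩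
  push Not at hlow
  have hreg : ∀ v ∈ S, degIn E v S = 4 := by
    have h1 : ∑ v ∈ S, degIn E v S ≤ ∑ v ∈ S, 4 := by
      rw [sum_degIn hE, Finset.sum_const, smul_eq_mul]
      omega
    intro v hv
    exact ((Finset.sum_eq_sum_iff_of_le fun v hv => hlow v hv).1
      (le_antisymm (Finset.sum_le_sum fun v hv => hlow v hv) h1) v hv).symm
  have hproper : ∀ Z ⊂ S, Z.Nonempty → excess E Z ≤ 0 := by
    intro Z hZ hZne
    by_contra hcon
    have hZ1 := h Z hZ hZne
    have hWne : (S \ Z).Nonempty := by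
      obtain ⟨w, hw, hwZ⟩ := Finset.exists_of_ssubset hZ
      exact ⟨w, Finset.mem_sdiff.2 ⟨hw, hwZ⟩⟩
    have hd := hdisj Z hZ.subset (S \ Z) Finset.sdiff_subset hZne hWne Finset.disjoint_sdiff
    -- count the edges between `Z` and its complement from both sides
    have hcount : ∀ A ⊆ S, 4 * A.card = 2 * edgesIn E A + ∑ v ∈ A, degIn E v (S \ A) := by
      intro A hA
      rw [← sum_degIn hE, ← Finset.sum_add_distrib, mul_comm, ← smul_eq_mul, ← Finset.sum_const]
      refine Finset.sum_congr rfl fun v hv => ?_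
      rw [← hreg v (hA hv)]
      unfold degIn
      rw [← Finset.card_union_of_disjoint, ← Finset.filter_union,
        Finset.union_sdiff_of_subset hA]
      exact Finset.disjoint_filter_filter Finset.disjoint_sdiff
    have hcross : ∑ v ∈ Z, degIn E v (S \ Z) = ∑ w ∈ S \ Z, degIn E w Z := by
      unfold degIn
      simp_rw [Finset.card_filter]
      rw [Finset.sum_comm]
      simp_rw [Sym2.eq_swap]
    have h1 := hcount Z hZ.subset
    have h2 := hcount (S \ Z) Finset.sdiff_subset
    rw [Finset.sdiff_sdiff_eq_self hZ.subset, ← hcross] at h2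
    have h3 := Finset.card_sdiff_add_card_eq_card hZ.subset
    unfold excess at hcon hZ1 hd
    omega
  obtain ⟨v, hv⟩ := hne
  obtain ⟨c, hc, hsp⟩ := exists_sparseOn_of_excess_nonpos hE hL (S := S.erase v)
    (fun Z hZ => hproper Z (lt_of_le_of_lt hZ (Finset.erase_ssubset hv)))
  exact exists_sparseOn_extend_four hE hL hv (hreg v hv) hc hsp

end DensityTwo

/-! ### Partitions of maximum excess -/

section FibreExcess

variable {V : Type*} [DecidableEq V] {E : Finset (Sym2 V)} {L : Sym2 V → Finset ℕ}

/-- The sum of the excesses of the fibres of `π` in `S`. -/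
def fibreExcess (E : Finset (Sym2 V)) (S : Finset V) (π : V → V) : ℤ :=
  ∑ y ∈ S.image π, excess E (S.filter fun v => π v = y)

/-- Merging a proper nonempty set `C` of fibres of a map `π` that maximizes the sum of the excesses
of the fibres, among all maps not constant on `S`, does not increase this sum. -/
theorem excess_le_sum_of_maximal {S : Finset V} {π : V → V}
    (hmax : ∀ π' : V → V, 2 ≤ (S.image π').card → fibreExcess E S π' ≤ fibreExcess E S π)
    {C : Finset V} (hC : C ⊂ S.image π) (hne : C.Nonempty) :
    excess E (S.filter fun v => π v ∈ C) ≤ ∑ y ∈ C, excess E (S.filter fun v => π v = y) := by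
  obtain ⟨y₀, hy₀⟩ := hne
  let π' : V → V := fun v => if π v ∈ C then y₀ else π v
  have himg : S.image π' = insert y₀ (S.image π \ C) := by
    ext y
    simp only [Finset.mem_image, Finset.mem_insert, Finset.mem_sdiff, π']
    constructor
    · rintro ⟨v, hv, rfl⟩
      split_ifs with h
      · exact Or.inl rfl
      · exact Or.inr ⟨⟨v, hv, rfl⟩, h⟩
    · rintro (rfl | ⟨⟨v, hv, rfl⟩, h⟩)
      · obtain ⟨v, hv, hvy⟩ := Finset.mem_image.1 (hC.subset hy₀)
        exact ⟨v, hv, by rw [hvy, if_pos hy₀]⟩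
      · exact ⟨v, hv, by rw [if_neg h]⟩
  have hnot : y₀ ∉ S.image π \ C := fun h => (Finset.mem_sdiff.1 h).2 hy₀
  have hfib0 : (S.filter fun v => π' v = y₀) = S.filter fun v => π v ∈ C := by
    refine Finset.filter_congr fun v _ => ?_
    simp only [π']
    split_ifs with h
    · simp [h]
    · simp only [h, iff_false]
      rintro h'
      exact h (h' ▸ hy₀)
  have hfib1 : ∀ y ∈ S.image π \ C, (S.filter fun v => π' v = y) = S.filter fun v => π v = y := by
    intro y hy
    refine Finset.filter_congr fun v _ => ?_
    simp only [π']
    split_ifs with h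
    · refine ⟨?_, ?_⟩
      · rintro rfl
        exact absurd hy hnot
      · rintro rfl
        exact absurd h (Finset.mem_sdiff.1 hy).2
    · rfl
  have h1 := hmax π' (by
    rw [himg, Finset.card_insert_of_notMem hnot]
    obtain ⟨y, hy, hyC⟩ := Finset.exists_of_ssubset hC
    have : 0 < (S.image π \ C).card := Finset.card_pos.2 ⟨y, Finset.mem_sdiff.2 ⟨hy, hyC⟩⟩
    omega)
  unfold fibreExcess at h1
  rw [himg, Finset.sum_insert hnot, hfib0,
    Finset.sum_congr rfl fun y hy => by rw [hfib1 y hy],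
    ← Finset.sum_sdiff hC.subset] at h1
  linarith

/-- Collapsing two disjoint sets. -/
theorem exists_fibreExcess_eq_add (hE : ∀ e ∈ E, ¬ e.IsDiag) {S Y Z : Finset V} (hY : Y ⊆ S)
    (hZ : Z ⊆ S) (hYne : Y.Nonempty) (hZne : Z.Nonempty) (hd : Disjoint Y Z) :
    ∃ π : V → V, 2 ≤ (S.image π).card ∧ fibreExcess E S π = excess E Y + excess E Z := by
  obtain ⟨y₀, hy₀⟩ := hYne
  obtain ⟨z₀, hz₀⟩ := hZne
  rw [Finset.disjoint_left] at hd
  have hyz : y₀ ≠ z₀ := fun h => hd hy₀ (h ▸ hz₀)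
  let π : V → V := fun v => if v ∈ Y then y₀ else if v ∈ Z then z₀ else v
  have hπy : ∀ v, π v = y₀ ↔ v ∈ Y := by
    intro v
    simp only [π]
    split_ifs with h1 h2
    · simp [h1]
    · simp [h1, hyz.symm]
    · simp only [h1, iff_false]
      rintro rfl
      exact h1 hy₀
  have hπz : ∀ v, π v = z₀ ↔ v ∈ Z := by
    intro v
    simp only [π]
    split_ifs with h1 h2
    · simp [hd h1, hyz]
    · simp [h2]
    · simp only [h2, iff_false]
      rintro rfl
      exact h2 hz₀
  have hyI : y₀ ∈ S.image π := Finset.mem_image.2 ⟨y₀, hY hy₀, (hπy _).2 hy₀⟩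
  have hzI : z₀ ∈ S.image π := Finset.mem_image.2 ⟨z₀, hZ hz₀, (hπz _).2 hz₀⟩
  refine ⟨π, Finset.one_lt_card.2 ⟨y₀, hyI, z₀, hzI, hyz⟩, ?_⟩
  unfold fibreExcess
  rw [Finset.sum_eq_add_of_mem y₀ z₀ hyI hzI hyz]
  · congr 2
    · ext v
      rw [Finset.mem_filter, hπy]
      exact ⟨fun h => h.2, fun h => ⟨hY h, h⟩⟩
    · ext v
      rw [Finset.mem_filter, hπz]
      exact ⟨fun h => h.2, fun h => ⟨hZ h, h⟩⟩
  · rintro y hy ⟨hy1, hy2⟩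
    obtain ⟨u, hu, rfl⟩ := Finset.mem_image.1 hy
    have huY : u ∉ Y := fun h => hy1 ((hπy u).2 h)
    have huZ : u ∉ Z := fun h => hy2 ((hπz u).2 h)
    refine excess_of_card_eq_one hE (Finset.card_eq_one.2 ⟨u, ?_⟩)
    ext w
    rw [Finset.mem_filter, Finset.mem_singleton]
    constructor
    · rintro ⟨-, hw⟩
      have hwY : w ∉ Y := fun h => hy1 (hw ▸ (hπy w).2 h)
      have hwZ : w ∉ Z := fun h => hy2 (hw ▸ (hπz w).2 h)
      simpa [π, huY, huZ, hwY, hwZ] using hw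
    · rintro rfl
      exact ⟨hu, rfl⟩

variable [Fintype V]

/-- Colouring graphs of maximum density at most two. Take a partition of `S` into at least two parts
maximizing the sum of the excesses of the parts. If this sum is at least the excess of `S`, then
colourings of the parts extend to `S` by forests. Otherwise no partition reaches the excess of `S`,
which determines the structure of `S`. -/
theorem exists_colouring_of_density_le_two (hE : ∀ e ∈ E, ¬ e.IsDiag)
    (hL : ∀ e, (L e).card = 2) (h : ∀ Z : Finset V, edgesIn E Z ≤ 2 * Z.card) (S : Finset V) :
    ∃ c : Sym2 V → ℕ, (∀ e, c e ∈ L e) ∧ SparseOn E c (fun _ => 4 / 3) S := by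
  induction hn : S.card using Nat.strong_induction_on generalizing S with
  | _ n ih =>
  by_cases hcard : S.card ≤ 1
  · choose d hd using fun e => exists_mem_ne_of_card_eq_two (hL e) 0
    refine ⟨d, fun e => (hd e).1, fun k Z hZ hne => ?_⟩
    have h1 := Finset.card_le_card hZ
    have h2 : Z.card = 1 := le_antisymm (h1.trans hcard) hne.card_pos
    rw [edgesIn_of_card_le_one (fun e he => hE e (colourClass_subset _ _ _ he)) h2.le, h2]
    simp
  push Not at hcard
  obtain ⟨π, hπ, hmax⟩ := Finset.exists_max_image
    (Finset.univ.filter fun π : V → V => 2 ≤ (S.image π).card) (fibreExcess E S)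
    ⟨id, by simpa using Nat.succ_le_of_lt hcard⟩
  simp only [Finset.mem_filter, Finset.mem_univ, true_and] at hπ hmax
  by_cases hcase : excess E S ≤ fibreExcess E S π
  · have hfib : ∀ y, ∃ c : Sym2 V → ℕ, (∀ e, c e ∈ L e) ∧
        SparseOn E c (fun _ => 4 / 3) (S.filter fun v => π v = y) := by
      intro y
      refine ih _ ?_ _ rfl
      rw [← hn]
      refine Finset.card_lt_card (Finset.filter_ssubset.2 ?_)
      by_contra hcon
      push Not at hcon
      have : (S.image π).card ≤ 1 := by
        rw [Finset.card_le_one]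
        intro a ha b hb
        obtain ⟨u, hu, rfl⟩ := Finset.mem_image.1 ha
        obtain ⟨w, hw, rfl⟩ := Finset.mem_image.1 hb
        rw [hcon u hu, hcon w hw]
      omega
    choose c hc hsp using hfib
    refine exists_sparseOn_of_excess hL π (c₀ := fun e => c (π e.out.1) e) (fun e => hc _ e)
      (fun _ => by norm_num) ?_ ?_
    · intro y _ k Z hZ hne
      refine le_trans ?_ (hsp y k Z hZ hne)
      rw [Nat.cast_le]
      refine Finset.card_le_card fun e he => ?_
      rw [colourClass, Finset.mem_filter, Finset.mem_filter] at he
      rw [colourClass, Finset.mem_filter, Finset.mem_filter]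
      have hy : π e.out.1 = y :=
        (Finset.mem_filter.1 (hZ (Finset.mem_sym2_iff.1 he.2 _ (Sym2.out_fst_mem e)))).2
      rw [hy] at he
      exact he
    · intro C hC hne
      rcases hC.eq_or_ssubset with rfl | hss
      · rw [Finset.filter_true_of_mem fun v hv => Finset.mem_image_of_mem _ hv]
        exact hcase
      · exact excess_le_sum_of_maximal hmax hss hne
  push Not at hcase
  have htwo : ∀ Y ⊆ S, ∀ Z ⊆ S, Y.Nonempty → Z.Nonempty → Disjoint Y Z →
      excess E Y + excess E Z < excess E S := by
    intro Y hY Z hZ hYne hZne hd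
    obtain ⟨π', hπ', hsum⟩ := exists_fibreExcess_eq_add hE hY hZ hYne hZne hd
    rw [← hsum]
    exact (hmax π' hπ').trans_lt hcase
  have hproper : ∀ Z ⊂ S, Z.Nonempty → excess E Z < excess E S := by
    intro Z hZ hZne
    obtain ⟨w, hw, hwZ⟩ := Finset.exists_of_ssubset hZ
    have := htwo Z hZ.subset {w} (by simpa using hw) hZne ⟨w, by simp⟩ (by simpa using hwZ)
    rwa [excess_of_card_eq_one hE (Finset.card_singleton w), add_zero] at this
  have hle : excess E S ≤ 2 := by
    unfold excess
    have := h S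
    omega
  have hpos : 0 < excess E S := by
    obtain ⟨a, ha, b, hb, hab⟩ := Finset.one_lt_card.1 hcard
    have := hproper {a} ⟨by simpa using ha, fun h => hab (Finset.mem_singleton.1 (h hb)).symm⟩
      ⟨a, by simp⟩
    rwa [excess_of_card_eq_one hE (Finset.card_singleton a)] at this
  rcases (show excess E S = 1 ∨ excess E S = 2 by omega) with h1 | h2
  · obtain ⟨c, hc, x, hsp⟩ := exists_sparseOn_of_excess_eq_one hE hL h1 (fun Z hZ hne => by
      have := hproper Z hZ hne
      omega)
    exact ⟨c, hc, hsp.mono (weightOf_le _)⟩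
  · exact exists_sparseOn_of_excess_eq_two hE hL h2 (fun Z hZ hne => by
      have := hproper Z hZ hne
      omega) (fun Y hY Z hZ hYne hZne hd => by
      have := htwo Y hY Z hZ hYne hZne hd
      omega)

end FibreExcess

/-- A graph of maximum density at most `m` can be coloured from lists of two colours such that
every colour class has fewer than `m (|Z| - 2) + 1` edges in every `Z` with at least three
vertices. -/
theorem exists_sparse_colouring {V : Type*} [Fintype V] [DecidableEq V] {E : Finset (Sym2 V)}
    {L : Sym2 V → Finset ℕ} (hE : ∀ e ∈ E, ¬ e.IsDiag) (hL : ∀ e, (L e).card = 2) {m : ℝ}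
    (hm : 1 < m) (h : ∀ Z : Finset V, (edgesIn E Z : ℝ) ≤ m * Z.card) :
    ∃ c : Sym2 V → ℕ, (∀ e, c e ∈ L e) ∧ ∀ k, ∀ Z : Finset V, 3 ≤ Z.card →
      (edgesIn (colourClass E c k) Z : ℝ) < m * (Z.card - 2) + 1 := by
  by_cases h1 : m ≤ 3 / 2
  · exact exists_sparse_colouring_of_le_three_halves hE hL hm h1 h
  by_cases h2 : m ≤ 2
  swap
  · by_cases h3 : m ≤ 5 / 2
    · exact exists_sparse_colouring_of_le_five_halves hE hL (not_le.1 h2) h3 h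
    · exact exists_sparse_colouring_of_five_halves_lt hE hL (not_le.1 h3) h
  push Not at h1
  obtain ⟨c, hc, hsp⟩ := exists_colouring_of_density_le_two hE hL (by
    intro Z
    have h3 : (edgesIn E Z : ℝ) ≤ 2 * Z.card :=
      (h Z).trans (mul_le_mul_of_nonneg_right h2 (Nat.cast_nonneg _))
    exact_mod_cast h3) Finset.univ
  refine ⟨c, hc, fun k Z hZ => ?_⟩
  have h4 := hsp k Z (Finset.subset_univ _) (Finset.card_pos.1 (by omega))
  have h5 : 3 * edgesIn (colourClass E c k) Z + 4 ≤ 4 * Z.card := by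
    have : (3 * edgesIn (colourClass E c k) Z + 4 : ℚ) ≤ 4 * Z.card := by linarith
    exact_mod_cast this
  have h6 : 2 * edgesIn (colourClass E c k) Z + 4 ≤ 3 * Z.card := by omega
  have h7 : (2 * edgesIn (colourClass E c k) Z + 4 : ℝ) ≤ 3 * Z.card := by exact_mod_cast h6
  have h8 : (3 : ℝ) ≤ Z.card := by exact_mod_cast hZ
  nlinarith

/-! ### Exploring a connected system of copies -/

section Exploration

variable {α κ : Type*} [DecidableEq α] {K : κ → Finset α} {φ : Finset α → ℝ}

/-- The elements of `H` can be coloured from the lists `L` in such a way that none of the sets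
`K x` contained in `H` is monochromatic. -/
def ListColourable (K : κ → Finset α) (L : α → Finset ℕ) (H : Finset α) : Prop :=
  ∃ c : α → ℕ, (∀ e, c e ∈ L e) ∧ ∀ x, K x ⊆ H → ∀ k, ∃ e ∈ K x, c e ≠ k

/-- `H` cannot be split into two nonempty parts so that each of the sets `K x` contained in `H` lies
in one of the parts. -/
def CopyConnected (K : κ → Finset α) (H : Finset α) : Prop :=
  ∀ S ⊆ H, S.Nonempty → S ≠ H → ∃ x, K x ⊆ H ∧ (K x ∩ S).Nonempty ∧ ¬ K x ⊆ S

/-- `Explored K φ G t S Q` says that the following exploration of the set `G` can reach a set `S'`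
with `φ S' < 0`, or attach `t` further copies: one starts with the set `S` and the queue `Q`, and at
each step one either removes the first element `e` of the queue, or attaches to `S` a copy
`K x ⊆ G` that contains `e` and is not contained in `S`, appending the new elements to the queue. -/
inductive Explored (K : κ → Finset α) (φ : Finset α → ℝ) (G : Set α) :
    ℕ → Finset α → List α → Prop
  | neg {t S Q} : φ S < 0 → Explored K φ G t S Q
  | zero {S Q} : Explored K φ G 0 S Q
  | skip {t S e Q} : Explored K φ G t S Q → Explored K φ G t S (e :: Q)
  | attach {t S e Q} (x : κ) : e ∈ K x → ¬ K x ⊆ S → (K x : Set α) ⊆ G →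
      Explored K φ G t (S ∪ K x) (e :: Q ++ (K x \ S).toList) → Explored K φ G (t + 1) S (e :: Q)

/-- A minimal set that cannot be coloured is connected, as colourings of two parts could be
combined. -/
theorem exists_copyConnected {L : α → Finset ℕ} {G : Finset α} (hG : ¬ ListColourable K L G) :
    ∃ H ⊆ G, ¬ ListColourable K L H ∧ CopyConnected K H := by
  obtain ⟨H, hHG, hH⟩ := exists_minimal_le_of_wellFoundedLT (fun H => ¬ ListColourable K L H) G hG
  refine ⟨H, hHG, hH.prop, fun S hS hne hSH => ?_⟩
  by_contra hcon
  push Not at hcon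
  have hlt : ∀ S' ⊂ H, ListColourable K L S' := fun S' h => by
    by_contra h'
    exact h.not_subset (hH.le_of_le h' h.subset)
  obtain ⟨c₁, hc₁, h₁⟩ := hlt S (hS.ssubset_of_ne hSH)
  obtain ⟨c₂, hc₂, h₂⟩ := hlt (H \ S) (Finset.sdiff_ssubset hS hne)
  refine hH.prop ⟨fun e => if e ∈ S then c₁ e else c₂ e, fun e => ?_, fun x hx k => ?_⟩
  · dsimp only
    split_ifs
    exacts [hc₁ e, hc₂ e]
  · by_cases hxS : (K x ∩ S).Nonempty
    · have hsub := hcon x hx hxS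
      obtain ⟨e, he, hek⟩ := h₁ x hsub k
      exact ⟨e, he, by simpa [hsub he] using hek⟩
    · have hdis : ∀ e ∈ K x, e ∉ S := fun e he heS => hxS ⟨e, Finset.mem_inter.2 ⟨he, heS⟩⟩
      obtain ⟨e, he, hek⟩ := h₂ x (fun e he => Finset.mem_sdiff.2 ⟨hx he, hdis e he⟩) k
      exact ⟨e, he, by simpa [hdis e he] using hek⟩

/-- If attaching copies does not increase `φ`, then `φ` is smallest on the whole of a connected
set. -/
theorem CopyConnected.le_of_subset {H : Finset α} (hH : CopyConnected K H)
    (hφ : ∀ S x, (K x ∩ S).Nonempty → φ (S ∪ K x) ≤ φ S) {S : Finset α} (hS : S ⊆ H)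
    (hne : S.Nonempty) : φ H ≤ φ S := by
  induction hn : (H \ S).card using Nat.strong_induction_on generalizing S with
  | _ n ih =>
  by_cases hSH : S = H
  · rw [hSH]
  obtain ⟨x, hx, hxS, hnot⟩ := hH S hS hne hSH
  refine (ih _ ?_ (Finset.union_subset hS hx) (hne.mono Finset.subset_union_left) rfl).trans
    (hφ S x hxS)
  rw [← hn]
  obtain ⟨e, he, heS⟩ := Finset.not_subset.1 hnot
  refine Finset.card_lt_card ⟨Finset.sdiff_subset_sdiff le_rfl Finset.subset_union_left, fun h => ?_⟩
  have := h (Finset.mem_sdiff.2 ⟨hx he, heS⟩)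
  simp [he] at this

/-- The exploration of a set that contains a connected set `H` with `φ H < 0` does not die out,
provided that the copies in `H` through the processed elements have all been attached. -/
theorem CopyConnected.explored {H : Finset α} (hH : CopyConnected K H) (hneg : φ H < 0) {G : Set α}
    (hG : (H : Set α) ⊆ G) (t : ℕ) (S : Finset α) (Q : List α) (hS : S ⊆ H) (hne : S.Nonempty)
    (hQ : ∀ e ∈ S, e ∉ Q → ∀ x, K x ⊆ H → e ∈ K x → K x ⊆ S) : Explored K φ G t S Q := by
  induction t generalizing S Q with
  | zero => exact .zero
  | succ t iht =>
  induction Q with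
  | nil =>
    by_cases hSH : S = H
    · exact .neg (hSH ▸ hneg)
    obtain ⟨x, hx, ⟨e, he⟩, hnot⟩ := hH S hS hne hSH
    rw [Finset.mem_inter] at he
    exact absurd (hQ e he.2 (by simp) x hx he.1) hnot
  | cons e Q ih =>
    by_cases hx : ∃ x, K x ⊆ H ∧ e ∈ K x ∧ ¬ K x ⊆ S
    · obtain ⟨x, hxH, hex, hnot⟩ := hx
      refine .attach x hex hnot (subset_trans (by exact_mod_cast hxH) hG)
        (iht _ _ (Finset.union_subset hS hxH) (hne.mono Finset.subset_union_left) ?_)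
      intro e' he' hq y hy hey
      simp only [List.cons_append, List.mem_cons, List.mem_append, Finset.mem_toList,
        Finset.mem_sdiff, not_or, not_and, not_not] at hq
      have heS : e' ∈ S := (Finset.mem_union.1 he').elim id hq.2.2
      exact (hQ e' heS (by simp [hq.1, hq.2.1]) y hy hey).trans Finset.subset_union_left
    · push Not at hx
      refine .skip (ih fun e' he' hq y hy hey => ?_)
      by_cases hee : e' = e
      · exact hx y hy (hee ▸ hey)
      · exact hQ e' he' (by simp [hee, hq]) y hy hey

/-- A set that cannot be coloured has an arbitrarily long exploration, if each such set contains a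
nonempty subset on which `φ` is negative. -/
theorem exists_explored {L : α → Finset ℕ} {G : Finset α} (hG : ¬ ListColourable K L G)
    (hφ : ∀ S x, (K x ∩ S).Nonempty → φ (S ∪ K x) ≤ φ S)
    (hdense : ∀ H ⊆ G, ¬ ListColourable K L H → ∃ S ⊆ H, S.Nonempty ∧ φ S < 0) (t : ℕ) :
    ∃ e ∈ G, Explored K φ G t {e} [e] := by
  obtain ⟨H, hHG, hH, hconn⟩ := exists_copyConnected hG
  obtain ⟨S, hS, hne, hneg⟩ := hdense H hHG hH
  obtain ⟨e, he⟩ := hne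
  refine ⟨e, hHG (hS he), hconn.explored ((hconn.le_of_subset hφ hS ⟨e, he⟩).trans_lt hneg)
    (by exact_mod_cast hHG) t _ _ (by simpa using hS he) (by simp) ?_⟩
  simp

variable {Ω : Type*} [MeasurableSpace Ω] {μ : MeasureTheory.Measure Ω}
  [MeasureTheory.IsFiniteMeasure μ] {G : Ω → Set α} {p : ℝ} [Fintype κ]

/-- The union bound for explorations of a random set `G`. The function `w` is a weight with
`1 ≤ θ * w S` whenever `φ S < 0`, and the main hypothesis `hstep` says that the copies that can be
attached to `S` at an element `e` have a small expected total weight. Every element of the queue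
costs a factor two, to pay for the choice between removing it and attaching a copy to it; this is why
the weights involve `2 * p` instead of `p`. -/
theorem measure_explored_le (hp : 0 ≤ p)
    (hμ : ∀ S : Finset α, μ.real {ω | (S : Set α) ⊆ G ω} ≤ p ^ S.card)
    {w : Finset α → ℝ} {θ : ℝ} (hθ : 0 ≤ θ) (hw : ∀ S, 0 ≤ w S)
    (hneg : ∀ S, φ S < 0 → 1 ≤ θ * w S)
    {b M : ℕ} (hb : ∀ x, (K x).card ≤ b)
    (hstep₁ : ∀ S : Finset α, S.card ≤ M → ∀ e ∈ S,
      ∑ x, (if e ∈ K x ∧ ¬ K x ⊆ S then (2 * p) ^ (K x \ S).card else 0) ≤ 1 / 4)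
    (hstep₂ : ∀ S : Finset α, S.card ≤ M → ∀ e ∈ S,
      ∑ x, (if e ∈ K x ∧ ¬ K x ⊆ S then (2 * p) ^ (K x \ S).card * w (S ∪ K x) else 0)
        ≤ 1 / 4 * w S)
    (t : ℕ) (S : Finset α) (Q : List α) (hQ : ∀ e ∈ Q, e ∈ S) (hS : S.card + t * b ≤ M) :
    μ.real {ω | (S : Set α) ⊆ G ω ∧ Explored K φ (G ω) t S Q} ≤
      p ^ S.card * 2 ^ Q.length * ((1 / 2) ^ t + θ * w S) := by
  have htriv : ∀ (t : ℕ) (S : Finset α) (Q : List α), 1 ≤ (1 / 2 : ℝ) ^ t + θ * w S →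
      μ.real {ω | (S : Set α) ⊆ G ω ∧ Explored K φ (G ω) t S Q} ≤
        p ^ S.card * 2 ^ Q.length * ((1 / 2) ^ t + θ * w S) := by
    intro t S Q h
    refine (MeasureTheory.measureReal_mono fun ω hω => hω.1).trans ((hμ S).trans ?_)
    have h2 : (1 : ℝ) ≤ 2 ^ Q.length := one_le_pow₀ (by norm_num)
    have h3 : 0 ≤ p ^ S.card := pow_nonneg hp _
    calc p ^ S.card = p ^ S.card * 1 * 1 := by ring
      _ ≤ p ^ S.card * 2 ^ Q.length * ((1 / 2) ^ t + θ * w S) := by gcongr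
  induction t generalizing S Q with
  | zero => exact htriv _ _ _ (by simpa using mul_nonneg hθ (hw S))
  | succ t iht =>
  by_cases hφS : φ S < 0
  · exact htriv _ _ _ ((hneg S hφS).trans (le_add_of_nonneg_left (by positivity)))
  induction Q with
  | nil =>
    have : {ω | (S : Set α) ⊆ G ω ∧ Explored K φ (G ω) (t + 1) S []} = ∅ := by
      rw [Set.eq_empty_iff_forall_notMem]
      rintro ω ⟨-, h⟩
      cases h
      exact hφS ‹_›
    rw [this, MeasureTheory.measureReal_empty]
    have := hw S
    positivity
  | cons e Q ih =>
    have hsub : {ω | (S : Set α) ⊆ G ω ∧ Explored K φ (G ω) (t + 1) S (e :: Q)} ⊆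
        {ω | (S : Set α) ⊆ G ω ∧ Explored K φ (G ω) (t + 1) S Q} ∪
        ⋃ x ∈ Finset.univ.filter (fun x => e ∈ K x ∧ ¬ K x ⊆ S),
          {ω | ((S ∪ K x : Finset α) : Set α) ⊆ G ω ∧
            Explored K φ (G ω) t (S ∪ K x) (e :: Q ++ (K x \ S).toList)} := by
      rintro ω ⟨hω, h⟩
      cases h with
      | neg h => exact absurd h hφS
      | skip h => exact Or.inl ⟨hω, h⟩
      | attach x hx hnot hxG h =>
        refine Or.inr (Set.mem_iUnion₂.2 ⟨x, by simp [hx, hnot], ?_, h⟩)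
        rw [Finset.coe_union]
        exact Set.union_subset hω hxG
    have hSM : S.card ≤ M := (Nat.le_add_right _ _).trans hS
    have heS : e ∈ S := hQ e (by simp)
    have hterm : ∀ x ∈ Finset.univ.filter (fun x => e ∈ K x ∧ ¬ K x ⊆ S),
        μ.real {ω | ((S ∪ K x : Finset α) : Set α) ⊆ G ω ∧
            Explored K φ (G ω) t (S ∪ K x) (e :: Q ++ (K x \ S).toList)} ≤
          p ^ S.card * 2 ^ (Q.length + 1) * ((1 / 2) ^ t * (2 * p) ^ (K x \ S).card +
            θ * ((2 * p) ^ (K x \ S).card * w (S ∪ K x))) := by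
      intro x _
      have hcard : (S ∪ K x).card = S.card + (K x \ S).card := by
        rw [← Finset.union_sdiff_self_eq_union, Finset.card_union_of_disjoint Finset.disjoint_sdiff]
      refine (iht (S ∪ K x) _ ?_ ?_).trans (le_of_eq ?_)
      · intro e' he'
        simp only [List.cons_append, List.mem_cons, List.mem_append, Finset.mem_toList,
          Finset.mem_sdiff] at he'
        rcases he' with rfl | he' | he'
        · exact Finset.mem_union_left _ heS
        · exact Finset.mem_union_left _ (hQ e' (by simp [he']))
        · exact Finset.mem_union_right _ he'.1
      · have h1 : (K x \ S).card ≤ b := (Finset.card_le_card Finset.sdiff_subset).trans (hb x)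
        rw [hcard]
        linarith [Nat.succ_mul t b]
      · rw [hcard]
        simp only [List.cons_append, List.length_cons, List.length_append, Finset.length_toList]
        rw [pow_add p, mul_pow, pow_succ, pow_succ, pow_add]
        ring
    refine (MeasureTheory.measureReal_mono hsub).trans
      ((MeasureTheory.measureReal_union_le _ _).trans ?_)
    have h1 := ih (fun e' he' => hQ e' (by simp [he']))
    have h2 := (MeasureTheory.measureReal_biUnion_finset_le
      (μ := μ) (Finset.univ.filter (fun x => e ∈ K x ∧ ¬ K x ⊆ S)) _).trans (Finset.sum_le_sum hterm)
    rw [← Finset.mul_sum, Finset.sum_add_distrib, ← Finset.mul_sum, ← Finset.mul_sum,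
      Finset.sum_filter, Finset.sum_filter] at h2
    refine (add_le_add h1 h2).trans ?_
    have h3 := mul_le_mul_of_nonneg_left (hstep₁ S hSM e heS) (by positivity : (0 : ℝ) ≤ (1 / 2) ^ t)
    have h4 := mul_le_mul_of_nonneg_left (hstep₂ S hSM e heS) hθ
    have h5 := mul_le_mul_of_nonneg_left (add_le_add h3 h4)
      (by positivity : 0 ≤ p ^ S.card * 2 ^ (Q.length + 1))
    refine (add_le_add le_rfl h5).trans ?_
    have h6 : 0 ≤ p ^ S.card * 2 ^ Q.length * (θ * w S) :=
      mul_nonneg (by positivity) (mul_nonneg hθ (hw S))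
    rw [List.length_cons, pow_succ, pow_succ]
    linarith

end Exploration

/-- The random graph contains a given set of edges with probability at most `p ^ |S|`. -/
theorem binomialRandom_subset_le {V : Type*} [Countable V] (p : I) (S : Finset (Sym2 V)) :
    (SimpleGraph.binomialRandom V p).real {G | (S : Set (Sym2 V)) ⊆ G.edgeSet} ≤
      (p : ℝ) ^ S.card := by
  classical
  have h : SimpleGraph.binomialRandom V p {G | (S : Set (Sym2 V)) ⊆ G.edgeSet} ≤
      (toNNReal p : ENNReal) ^ S.card := by
    rw [SimpleGraph.binomialRandom_apply']
    refine (MeasureTheory.measure_mono (t := {A | (S : Set (Sym2 V)) ⊆ A}) ?_).trans ?_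
    · rintro _ ⟨G, hG, rfl⟩
      exact hG
    rw [ProbabilityTheory.setBernoulli_apply']
    have : (fun q : Sym2 V → Prop => {e | q e}) ⁻¹' {A | (S : Set (Sym2 V)) ⊆ A} =
        MeasureTheory.cylinder S (Set.univ.pi fun _ => ({True} : Set Prop)) := by
      ext q
      simp [Set.subset_def]
    rw [this, MeasureTheory.Measure.infinitePi_cylinder _ (.univ_pi fun _ => MeasurableSet.of_discrete),
      MeasureTheory.Measure.pi_pi]
    calc _ ≤ ∏ _e : S, (toNNReal p : ENNReal) := by
          refine Finset.prod_le_prod' fun e _ => ?_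
          by_cases he : (e : Sym2 V).IsDiag <;> simp [he]
      _ = _ := by simp
  rw [MeasureTheory.measureReal_def]
  refine (ENNReal.toReal_mono (by simp) h).trans (le_of_eq ?_)
  simp

/-! ### Balanced edge sets of maximum 2-density -/

section Support

variable {V : Type*} [DecidableEq V]

/-- The set of vertices covered by the edges in `S`. -/
def support (S : Finset (Sym2 V)) : Finset V := S.biUnion Sym2.toFinset

theorem mem_support {S : Finset (Sym2 V)} {v : V} : v ∈ support S ↔ ∃ e ∈ S, v ∈ e := by
  simp [support]

theorem support_union (S T : Finset (Sym2 V)) : support (S ∪ T) = support S ∪ support T :=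
  Finset.union_biUnion

theorem support_image {X : Type*} [DecidableEq X] (f : X → V) (B : Finset (Sym2 X)) :
    support (B.image (Sym2.map f)) = (support B).image f := by
  ext v
  simp only [mem_support, Finset.mem_image]
  constructor
  · rintro ⟨_, ⟨e, he, rfl⟩, hv⟩
    obtain ⟨x, hx, rfl⟩ := Sym2.mem_map.1 hv
    exact ⟨x, ⟨e, he, hx⟩, rfl⟩
  · rintro ⟨x, ⟨e, he, hx⟩, rfl⟩
    exact ⟨_, ⟨e, he, rfl⟩, Sym2.mem_map.2 ⟨x, hx, rfl⟩⟩

theorem card_support_le (S : Finset (Sym2 V)) : (support S).card ≤ 2 * S.card := by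
  refine Finset.card_biUnion_le.trans ?_
  rw [mul_comm, ← smul_eq_mul]
  refine Finset.sum_le_card_nsmul _ _ _ fun e _ => ?_
  rw [Sym2.card_toFinset]
  split_ifs <;> norm_num

theorem edgesIn_support (S : Finset (Sym2 V)) : edgesIn S (support S) = S.card := by
  unfold edgesIn
  rw [Finset.filter_true_of_mem]
  intro e he
  exact Finset.mem_sym2_iff.2 fun v hv => mem_support.2 ⟨e, he, hv⟩

theorem two_le_card_support {S : Finset (Sym2 V)} (hS : ∀ e ∈ S, ¬ e.IsDiag) (hne : S.Nonempty) :
    2 ≤ (support S).card := by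
  obtain ⟨e, he⟩ := hne
  rw [← Sym2.card_toFinset_of_not_isDiag e (hS e he)]
  exact Finset.card_le_card (Finset.subset_biUnion_of_mem Sym2.toFinset he)

theorem three_le_card_support {S : Finset (Sym2 V)} (hS : ∀ e ∈ S, ¬ e.IsDiag) (h : 2 ≤ S.card) :
    3 ≤ (support S).card := by
  have h1 := two_mul_edgesIn_le hS (support S)
  rw [edgesIn_support] at h1
  by_contra hcon
  have h2 := two_le_card_support hS (Finset.card_pos.1 (by omega))
  have h3 : (support S).card = 2 := by omega
  rw [h3] at h1
  omega

end Support

section Pattern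

variable {W : Type*}

/-- Every set of edges of `F` that covers at least three vertices satisfies the bound given by the
maximum 2-density. -/
theorem card_sub_one_le_maxTwoDensity_mul [Finite W] [DecidableEq W] (F : SimpleGraph W)
    {J : Finset (Sym2 W)} (hJ : (J : Set (Sym2 W)) ⊆ F.edgeSet) (h3 : 3 ≤ (support J).card) :
    (J.card : ℝ) - 1 ≤ maxTwoDensity F * ((support J).card - 2) := by
  have hpos : (0 : ℝ) < (support J).card - 2 := by
    have : (3 : ℝ) ≤ (support J).card := by exact_mod_cast h3
    linarith
  rw [← div_le_iff₀ hpos]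
  let F' : F.Subgraph :=
    { verts := support J
      Adj := fun a b => s(a, b) ∈ J
      adj_sub := fun h => hJ h
      edge_vert := fun {a b} h => mem_support.2 ⟨s(a, b), h, by simp⟩
      symm := ⟨fun a b h => by rwa [Sym2.eq_swap]⟩ }
  have hE : F'.edgeSet = J := by
    ext e
    induction e with
    | _ a b => rfl
  refine (isGreatest_maxTwoDensity F).2 (Or.inl ⟨F', ?_, ?_, ?_⟩)
  · exact Finset.card_pos.1 (by omega)
  · simpa [F', Set.ncard_coe_finset] using h3
  · rw [hE]
    simp [F', Set.ncard_coe_finset]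

/-- A maximum 2-density larger than one is attained by a set of edges. -/
theorem exists_card_sub_one_eq_maxTwoDensity_mul [Finite W] [DecidableEq W] (F : SimpleGraph W)
    (hF : 1 < maxTwoDensity F) :
    ∃ J : Finset (Sym2 W), (J : Set (Sym2 W)) ⊆ F.edgeSet ∧ 3 ≤ (support J).card ∧
      (J.card : ℝ) - 1 = maxTwoDensity F * ((support J).card - 2) := by
  cases nonempty_fintype W
  rcases (isGreatest_maxTwoDensity F).1 with ⟨F', -, h3, heq⟩ | h
  swap
  · rw [h] at hF
    norm_num at hF
  have hpos : (0 : ℝ) < F'.verts.ncard - 2 := by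
    have : (3 : ℝ) ≤ F'.verts.ncard := by exact_mod_cast h3
    linarith
  have heq' : (F'.edgeSet.ncard : ℝ) - 1 = maxTwoDensity F * (F'.verts.ncard - 2) := by
    rw [heq, div_mul_cancel₀ _ hpos.ne']
  have hfin : F'.edgeSet.Finite := Set.toFinite _
  have hJ : (hfin.toFinset : Set (Sym2 W)) ⊆ F.edgeSet := by
    rw [hfin.coe_toFinset]
    exact F'.edgeSet_subset
  have hcard : hfin.toFinset.card = F'.edgeSet.ncard := (Set.ncard_eq_toFinset_card _ hfin).symm
  have h2 : 2 ≤ hfin.toFinset.card := by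
    have : (1 : ℝ) < F'.edgeSet.ncard := by nlinarith
    rw [hcard]
    exact_mod_cast this
  have h3' := three_le_card_support (fun e he => F.not_isDiag_of_mem_edgeSet (hJ he)) h2
  have hle := card_sub_one_le_maxTwoDensity_mul F hJ h3'
  refine ⟨_, hJ, h3', le_antisymm hle ?_⟩
  rw [hcard, heq']
  have hsub : (support hfin.toFinset).card ≤ F'.verts.ncard := by
    rw [← Set.ncard_coe_finset]
    refine Set.ncard_le_ncard (fun v hv => ?_) (Set.toFinite _)
    obtain ⟨e, he, hve⟩ := mem_support.1 hv
    exact F'.mem_verts_of_mem_edge (hfin.mem_toFinset.1 he) hve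
  have : ((support hfin.toFinset).card : ℝ) ≤ F'.verts.ncard := by exact_mod_cast hsub
  exact mul_le_mul_of_nonneg_left (by linarith) (by linarith)

/-- `IsPattern d B` says that the edge set `B` covers all vertices, has 2-density `d`, and is
strictly balanced: its proper subsets covering at least three vertices have a smaller 2-density. -/
structure IsPattern {X : Type*} [Fintype X] [DecidableEq X] (d : ℝ) (B : Finset (Sym2 X)) :
    Prop where
  not_isDiag : ∀ e ∈ B, ¬ e.IsDiag
  support_eq : support B = Finset.univ
  three_le : 3 ≤ Fintype.card X
  card_eq : (B.card : ℝ) - 1 = d * (Fintype.card X - 2)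
  card_le : ∀ J ⊆ B, J.Nonempty → (J.card : ℝ) - 1 ≤ d * ((support J).card - 2)
  card_lt : ∀ J ⊂ B, 3 ≤ (support J).card → (J.card : ℝ) - 1 < d * ((support J).card - 2)

/-- Every graph with maximum 2-density larger than one contains a strictly balanced edge set of this
2-density, namely a smallest one that attains the maximum. -/
theorem exists_isPattern [Finite W] [DecidableEq W] (F : SimpleGraph W)
    (hF : 1 < maxTwoDensity F) :
    ∃ (X : Finset W) (B : Finset (Sym2 X)), IsPattern (maxTwoDensity F) B ∧
      ∀ e ∈ B, e.map Subtype.val ∈ F.edgeSet := by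
  obtain ⟨B₀, -, hB₀⟩ := exists_minimal_le_of_wellFoundedLT
    (fun J : Finset (Sym2 W) => (J : Set (Sym2 W)) ⊆ F.edgeSet ∧ 3 ≤ (support J).card ∧
      (J.card : ℝ) - 1 = maxTwoDensity F * ((support J).card - 2)) _
    (exists_card_sub_one_eq_maxTwoDensity_mul F hF).choose_spec
  obtain ⟨hBF, hB3, hBeq⟩ := hB₀.prop
  have hmapinj : Function.Injective (Sym2.map (Subtype.val : support B₀ → W)) :=
    Sym2.map.injective Subtype.val_injective
  let B : Finset (Sym2 (support B₀)) := Finset.univ.filter fun e => e.map Subtype.val ∈ B₀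
  have hBimg : B.image (Sym2.map Subtype.val) = B₀ := by
    ext e
    simp only [B, Finset.mem_image, Finset.mem_filter, Finset.mem_univ, true_and]
    constructor
    · rintro ⟨e, he, rfl⟩
      exact he
    · intro he
      induction e with
      | _ a b =>
      exact ⟨s(⟨a, mem_support.2 ⟨_, he, by simp⟩⟩, ⟨b, mem_support.2 ⟨_, he, by simp⟩⟩), he, rfl⟩
  have hsub : ∀ J ⊆ B, J.image (Sym2.map Subtype.val) ⊆ B₀ := fun J hJ =>
    (Finset.image_subset_image hJ).trans hBimg.subset
  have hcard : ∀ J : Finset (Sym2 (support B₀)), (J.image (Sym2.map Subtype.val)).card = J.card :=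
    fun J => Finset.card_image_of_injective _ hmapinj
  have hsupp : ∀ J : Finset (Sym2 (support B₀)),
      (support (J.image (Sym2.map Subtype.val))).card = (support J).card := fun J => by
    rw [support_image, Finset.card_image_of_injective _ Subtype.val_injective]
  have hle : ∀ J ⊆ B, 3 ≤ (support J).card →
      (J.card : ℝ) - 1 ≤ maxTwoDensity F * ((support J).card - 2) := by
    intro J hJ h3
    rw [← hcard, ← hsupp]
    exact card_sub_one_le_maxTwoDensity_mul F
      (subset_trans (by exact_mod_cast hsub J hJ) hBF) ((hsupp J).symm ▸ h3)
  have hdiag : ∀ e ∈ B, ¬ e.IsDiag := by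
    intro e he hd
    refine F.not_isDiag_of_mem_edgeSet (hBF (Finset.mem_filter.1 he).2) ?_
    induction e with
    | _ a b => simpa using hd
  refine ⟨support B₀, B, ⟨hdiag, ?_, ?_, ?_, ?_, ?_⟩, fun e he => hBF (Finset.mem_filter.1 he).2⟩
  · have h := support_image (Subtype.val : support B₀ → W) B
    rw [hBimg] at h
    ext x
    simp only [Finset.mem_univ, iff_true]
    obtain ⟨y, hy, hyx⟩ := Finset.mem_image.1 (h.subset x.2)
    rwa [← Subtype.val_injective hyx]
  · simpa using hB3
  · rw [← hcard, hBimg, hBeq]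
    simp
  · intro J hJ hne
    rcases Nat.lt_or_ge J.card 2 with h | h
    · have h1 : J.card = 1 := le_antisymm (by omega) hne.card_pos
      have h2 : (2 : ℝ) ≤ (support J).card := by
        exact_mod_cast two_le_card_support (fun e he => hdiag e (hJ he)) hne
      rw [h1]
      have := mul_nonneg (by linarith : 0 ≤ maxTwoDensity F) (sub_nonneg.2 h2)
      simpa using this
    · exact hle J hJ (three_le_card_support (fun e he => hdiag e (hJ he)) h)
  · intro J hJ h3
    refine lt_of_le_of_ne (hle J hJ.subset h3) fun heq => ?_
    have hlt : J.image (Sym2.map Subtype.val) ⊂ B₀ := by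
      refine Finset.ssubset_iff_subset_ne.2 ⟨hsub J hJ.subset, fun h => ?_⟩
      have h1 := Finset.card_lt_card hJ
      rw [← hcard J, ← hcard B, h, hBimg] at h1
      exact lt_irrefl _ h1
    refine hlt.not_subset (hB₀.le_of_le (y := J.image (Sym2.map Subtype.val)) ⟨?_, ?_, ?_⟩
      hlt.subset)
    · exact subset_trans (by exact_mod_cast hlt.subset) hBF
    · rwa [hsupp]
    · rw [hcard, hsupp, heq]

end Pattern

/-! ### Attaching copies of a pattern -/

section Attach

variable {V X : Type*} [DecidableEq V] [DecidableEq X]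

/-- The potential of an edge set. If `p = n ^ (-1 / m)`, then about `n ^ (potential m S / m)` copies
of `S` are expected in the random graph. -/
def potential (m : ℝ) (S : Finset (Sym2 V)) : ℝ := m * (support S).card - S.card

/-- The copy of the edge set `B` given by the map `f`. -/
def copyOf (B : Finset (Sym2 X)) (f : X → V) : Finset (Sym2 V) := B.image (Sym2.map f)

omit [DecidableEq X] in
theorem card_copyOf (B : Finset (Sym2 X)) (f : X ↪ V) : (copyOf B f).card = B.card :=
  Finset.card_image_of_injective _ (Sym2.map.injective f.injective)

variable [Fintype X]

/-- The vertices of the pattern that a copy shares with `S`. -/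
def sharedVertices (f : X → V) (S : Finset (Sym2 V)) : Finset X :=
  Finset.univ.filter fun x => f x ∈ support S

omit [Fintype X] [DecidableEq X] in
theorem card_copyOf_sdiff (B : Finset (Sym2 X)) (f : X ↪ V) (S : Finset (Sym2 V)) :
    (copyOf B f \ S).card + (B.filter fun e => e.map f ∈ S).card = B.card := by
  have : copyOf B f \ S = (B.filter fun e => e.map f ∉ S).image (Sym2.map f) := by
    ext e
    simp only [copyOf, Finset.mem_sdiff, Finset.mem_image, Finset.mem_filter]
    constructor
    · rintro ⟨⟨e', he', rfl⟩, h⟩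
      exact ⟨e', ⟨he', h⟩, rfl⟩
    · rintro ⟨e', ⟨he', h⟩, rfl⟩
      exact ⟨⟨e', he', rfl⟩, h⟩
  rw [this, Finset.card_image_of_injective _ (Sym2.map.injective f.injective), add_comm]
  exact Finset.card_filter_add_card_filter_not _

theorem card_support_union_copyOf {d : ℝ} {B : Finset (Sym2 X)} (hB : IsPattern d B) (f : X ↪ V)
    (S : Finset (Sym2 V)) :
    (support (S ∪ copyOf B f)).card + (sharedVertices f S).card =
      (support S).card + Fintype.card X := by
  have h1 : support (copyOf B f) = Finset.univ.image f := by
    rw [copyOf, support_image, hB.support_eq]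
  have h2 : (support S ∩ Finset.univ.image f) = (sharedVertices f S).image f := by
    ext v
    simp only [sharedVertices, Finset.mem_inter, Finset.mem_image, Finset.mem_univ, true_and,
      Finset.mem_filter]
    constructor
    · rintro ⟨hv, x, rfl⟩
      exact ⟨x, hv, rfl⟩
    · rintro ⟨x, hv, rfl⟩
      exact ⟨hv, x, rfl⟩
  rw [support_union, h1, ← Finset.card_image_of_injective (sharedVertices f S) f.injective, ← h2,
    Finset.card_union_add_card_inter, Finset.card_image_of_injective _ f.injective,
    Finset.card_univ]

/-- The decrease of the potential when a copy is attached. -/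
theorem potential_sub_potential_union {d : ℝ} {B : Finset (Sym2 X)} (hB : IsPattern d B)
    (f : X ↪ V) (m : ℝ) (S : Finset (Sym2 V)) :
    potential m S - potential m (S ∪ copyOf B f) =
      (copyOf B f \ S).card - m * (Fintype.card X - (sharedVertices f S).card) := by
  have h1 : ((support (S ∪ copyOf B f)).card : ℝ) + (sharedVertices f S).card =
      (support S).card + Fintype.card X := by exact_mod_cast card_support_union_copyOf hB f S
  have h2 : ((S ∪ copyOf B f).card : ℝ) = S.card + (copyOf B f \ S).card := by
    rw [← Finset.union_sdiff_self_eq_union, Finset.card_union_of_disjoint Finset.disjoint_sdiff]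
    push_cast
    rfl
  unfold potential
  rw [h2]
  linear_combination -m * h1

theorem support_filter_subset (B : Finset (Sym2 X)) (f : X → V) (S : Finset (Sym2 V)) :
    support (B.filter fun e => e.map f ∈ S) ⊆ sharedVertices f S := by
  intro x hx
  obtain ⟨e, he, hxe⟩ := mem_support.1 hx
  rw [Finset.mem_filter] at he
  exact Finset.mem_filter.2 ⟨Finset.mem_univ _,
    mem_support.2 ⟨_, he.2, Sym2.mem_map.2 ⟨x, hxe, rfl⟩⟩⟩

omit [Fintype X] [DecidableEq X] in
theorem filter_nonempty_of_inter_nonempty {B : Finset (Sym2 X)} {f : X → V} {S : Finset (Sym2 V)}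
    (h : (copyOf B f ∩ S).Nonempty) : (B.filter fun e => e.map f ∈ S).Nonempty := by
  obtain ⟨e, he⟩ := h
  rw [Finset.mem_inter, copyOf, Finset.mem_image] at he
  obtain ⟨⟨e', he', rfl⟩, heS⟩ := he
  exact ⟨e', Finset.mem_filter.2 ⟨he', heS⟩⟩

/-- Attaching a copy that shares an edge with `S` does not increase the potential. -/
theorem potential_union_le {m d : ℝ} (hm : 0 ≤ m) (hmd : m ≤ d) {B : Finset (Sym2 X)}
    (hB : IsPattern d B) (f : X ↪ V) {S : Finset (Sym2 V)} (h : (copyOf B f ∩ S).Nonempty) :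
    potential m (S ∪ copyOf B f) ≤ potential m S := by
  have h1 := potential_sub_potential_union hB f m S
  have h2 := hB.card_le _ (Finset.filter_subset _ _) (filter_nonempty_of_inter_nonempty h)
  have h3 : ((support (B.filter fun e => e.map f ∈ S)).card : ℝ) ≤ (sharedVertices f S).card := by
    exact_mod_cast Finset.card_le_card (support_filter_subset B f S)
  have h4 : ((copyOf B f \ S).card : ℝ) + (B.filter fun e => e.map f ∈ S).card = B.card := by
    exact_mod_cast card_copyOf_sdiff B f S
  have h5 := hB.card_eq
  have h6 : ((sharedVertices f S).card : ℝ) ≤ Fintype.card X := by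
    exact_mod_cast Finset.card_le_univ _
  nlinarith

/-- Attaching a copy that shares an edge and at least three vertices with `S` decreases the
potential, because the pattern is strictly balanced. -/
theorem potential_union_lt {m d : ℝ} (hm : 0 < m) (hmd : m ≤ d) {B : Finset (Sym2 X)}
    (hB : IsPattern d B) (f : X ↪ V) {S : Finset (Sym2 V)} (h : (copyOf B f ∩ S).Nonempty)
    (hnot : ¬ copyOf B f ⊆ S) (h3 : 3 ≤ (sharedVertices f S).card) :
    potential m (S ∪ copyOf B f) < potential m S := by
  have h1 := potential_sub_potential_union hB f m S
  set J := B.filter fun e => e.map f ∈ S with hJ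
  have hne : J.Nonempty := filter_nonempty_of_inter_nonempty h
  have hsub : ((support J).card : ℝ) ≤ (sharedVertices f S).card := by
    exact_mod_cast Finset.card_le_card (support_filter_subset B f S)
  have hss : J ⊂ B := by
    refine Finset.ssubset_iff_subset_ne.2 ⟨Finset.filter_subset _ _, fun heq => hnot ?_⟩
    intro e he
    obtain ⟨e', he', rfl⟩ := Finset.mem_image.1 he
    rw [← heq] at he'
    exact (Finset.mem_filter.1 he').2
  have h2 : (J.card : ℝ) - 1 < d * ((sharedVertices f S).card - 2) := by
    have h3' : (3 : ℝ) ≤ (sharedVertices f S).card := by exact_mod_cast h3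
    rcases Nat.lt_or_ge J.card 2 with h | h
    · have hc : J.card = 1 := le_antisymm (by omega) hne.card_pos
      rw [hc]
      have : 0 < d * ((sharedVertices f S).card - 2) := mul_pos (by linarith) (by linarith)
      simpa using this
    · refine (hB.card_lt J hss (three_le_card_support
        (fun e he => hB.not_isDiag e (hss.subset he)) h)).trans_le ?_
      exact mul_le_mul_of_nonneg_left (by linarith) (by linarith)
  have h4 : ((copyOf B f \ S).card : ℝ) + J.card = B.card := by
    exact_mod_cast card_copyOf_sdiff B f S
  have h5 := hB.card_eq
  have h6 : ((sharedVertices f S).card : ℝ) ≤ Fintype.card X := by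
    exact_mod_cast Finset.card_le_univ _
  nlinarith

/-- The copies through an edge `e` of `S` that share only two vertices with `S` share the ends of
`e`. -/
theorem map_mem_toFinset_of_card_eq_two {d : ℝ} {B : Finset (Sym2 X)} (hB : IsPattern d B)
    (f : X ↪ V) {S : Finset (Sym2 V)} {e : Sym2 V} (heS : e ∈ S) (he : e ∈ copyOf B f)
    (h2 : (sharedVertices f S).card ≤ 2) {x : X} (hx : x ∈ sharedVertices f S) :
    f x ∈ e.toFinset := by
  obtain ⟨e', he', rfl⟩ := Finset.mem_image.1 he
  have hsub : e'.toFinset ⊆ sharedVertices f S := by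
    intro y hy
    exact Finset.mem_filter.2 ⟨Finset.mem_univ _,
      mem_support.2 ⟨_, heS, Sym2.mem_map.2 ⟨y, Sym2.mem_toFinset.1 hy, rfl⟩⟩⟩
  have heq := Finset.eq_of_subset_of_card_le hsub
    (by rwa [Sym2.card_toFinset_of_not_isDiag e' (hB.not_isDiag e' he')])
  rw [← heq, Sym2.mem_toFinset] at hx
  exact Sym2.mem_toFinset.2 (Sym2.mem_map.2 ⟨x, hx, rfl⟩)

theorem two_le_card_sharedVertices {d : ℝ} {B : Finset (Sym2 X)} (hB : IsPattern d B)
    (f : X → V) {S : Finset (Sym2 V)} (h : (copyOf B f ∩ S).Nonempty) :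
    2 ≤ (sharedVertices f S).card :=
  (two_le_card_support (fun e he => hB.not_isDiag e (Finset.filter_subset _ _ he))
    (filter_nonempty_of_inter_nonempty h)).trans (Finset.card_le_card (support_filter_subset B f S))

end Attach

/-! ### The expected weight of the copies attached in one step -/

section Step

variable {V X : Type*} [DecidableEq V] [DecidableEq X] [Fintype X]

/-- The contribution of a single copy. The exponent of `n` is `-1` for every new vertex, and there
is a further gain if the copy shares more than two vertices with `S`: then the potential decreases,
and by at least `1 / q`, since its values are multiples of `1 / q`. -/
theorem copy_weight_le {m d : ℝ} (hm : 0 < m) (hmd : m ≤ d) {B : Finset (Sym2 X)}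
    (hB : IsPattern d B) {q : ℕ} (hq : 0 < q) {z : ℤ} (hz : q * m = z) {x p c a : ℝ} (hx : 1 ≤ x)
    (hp : 0 ≤ p) (hc : 0 ≤ c) (hc2 : 2 * c ≤ 1) (hpc : p ≤ c * x ^ (-1 / m)) (ha : a ≤ 1 / m)
    (f : X ↪ V) {S : Finset (Sym2 V)} (h : (copyOf B f ∩ S).Nonempty) (hnot : ¬ copyOf B f ⊆ S) :
    (2 * p) ^ (copyOf B f \ S).card * x ^ (-(a * potential m (S ∪ copyOf B f))) ≤
      x ^ (-(a * potential m S)) * x ^ (-((Fintype.card X : ℝ) - (sharedVertices f S).card)) *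
        (if (sharedVertices f S).card = 2 then 2 * c else x ^ (-((1 / m - a) / q))) := by
  have hx0 : 0 < x := by linarith
  set N := (copyOf B f \ S).card with hN
  set u : ℝ := (Fintype.card X : ℝ) - (sharedVertices f S).card with hu
  set Δ := potential m S - potential m (S ∪ copyOf B f) with hΔ
  have hΔeq : Δ = N - m * u := potential_sub_potential_union hB f m S
  have hN1 : N ≠ 0 := by
    rw [hN, Ne, Finset.card_eq_zero, Finset.sdiff_eq_empty_iff_subset]
    exact hnot
  have hΔ0 : 0 ≤ Δ := sub_nonneg.2 (potential_union_le hm.le hmd hB f h)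
  have ha' : 0 ≤ 1 / m - a := sub_nonneg.2 ha
  have h1 : (2 * p) ^ N ≤ 2 * c * x ^ (-(N / m)) := by
    calc (2 * p) ^ N ≤ (2 * c * x ^ (-1 / m)) ^ N := by
          refine pow_le_pow_left₀ (by linarith) ?_ _
          linarith
      _ = (2 * c) ^ N * x ^ (-(N / m)) := by
          rw [mul_pow, ← Real.rpow_mul_natCast hx0.le]
          congr 2
          ring
      _ ≤ 2 * c * x ^ (-(N / m)) := by
          gcongr
          exact pow_le_of_le_one (by linarith) hc2 hN1
  have h2 : (2 * p) ^ N * x ^ (-(a * potential m (S ∪ copyOf B f))) ≤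
      x ^ (-(a * potential m S)) * x ^ (-u) * (2 * c * x ^ (-((1 / m - a) * Δ))) := by
    refine (mul_le_mul_of_nonneg_right h1 (Real.rpow_nonneg hx0.le _)).trans (le_of_eq ?_)
    have : x ^ (-(N / m)) * x ^ (-(a * potential m (S ∪ copyOf B f))) =
        x ^ (-(a * potential m S)) * x ^ (-u) * x ^ (-((1 / m - a) * Δ)) := by
      rw [← Real.rpow_add hx0, ← Real.rpow_add hx0, ← Real.rpow_add hx0]
      congr 1
      have h3 : potential m (S ∪ copyOf B f) = potential m S - Δ := by rw [hΔ]; ring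
      have h4 : (N : ℝ) = Δ + m * u := by rw [hΔeq]; ring
      rw [h3, h4]
      field_simp
      ring
    linear_combination 2 * c * this
  refine h2.trans (mul_le_mul_of_nonneg_left ?_ (by positivity))
  split_ifs with hU
  · refine mul_le_of_le_one_right (by linarith) ?_
    exact Real.rpow_le_one_of_one_le_of_nonpos hx (by nlinarith)
  · have h3 : 3 ≤ (sharedVertices f S).card := by
      have := two_le_card_sharedVertices hB f h
      omega
    have hΔpos : 0 < Δ := sub_pos.2 (potential_union_lt hm hmd hB f h hnot h3)
    have hq0 : (0 : ℝ) < q := by exact_mod_cast hq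
    have hΔq : 1 / (q : ℝ) ≤ Δ := by
      have h5 : (q : ℝ) * Δ =
          ((q * N - z * ((Fintype.card X : ℤ) - (sharedVertices f S).card) : ℤ) : ℝ) := by
        rw [hΔeq, hu]
        push_cast
        rw [← hz]
        ring
      have h6 : 0 < (q : ℝ) * Δ := mul_pos hq0 hΔpos
      rw [h5, Int.cast_pos] at h6
      have h7 : (1 : ℝ) ≤ q * Δ := by
        rw [h5, ← Int.cast_one, Int.cast_le]
        exact h6
      rw [div_le_iff₀ hq0]
      linarith
    calc 2 * c * x ^ (-((1 / m - a) * Δ)) ≤ 1 * x ^ (-((1 / m - a) * Δ)) := by gcongr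
      _ ≤ x ^ (-((1 / m - a) / q)) := by
        rw [one_mul]
        refine Real.rpow_le_rpow_of_exponent_le hx (neg_le_neg ?_)
        rw [div_eq_mul_one_div]
        gcongr

variable [Fintype V]

/-- The expected weight of the copies of one pattern that can be attached to `S` at `e`, up to the
normalizing factor. The copies are grouped according to the set of shared vertices. -/
theorem sum_copy_weight_le {m d : ℝ} (hm : 0 < m) (hmd : m ≤ d) {B : Finset (Sym2 X)}
    (hB : IsPattern d B) {q : ℕ} (hq : 0 < q) {z : ℤ} (hz : q * m = z) {p c a : ℝ}
    (hV : 0 < Fintype.card V)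
    (hp : 0 ≤ p) (hc : 0 ≤ c) (hc2 : 2 * c ≤ 1) (hpc : p ≤ c * (Fintype.card V : ℝ) ^ (-1 / m))
    (ha : a ≤ 1 / m) {S : Finset (Sym2 V)} {M : ℕ} (hS : S.card ≤ M) {e : Sym2 V} (heS : e ∈ S) :
    ∑ f : X ↪ V, (if e ∈ copyOf B f ∧ ¬ copyOf B f ⊆ S then (2 * p) ^ (copyOf B f \ S).card *
        (Fintype.card V : ℝ) ^ (-(a * potential m (S ∪ copyOf B f))) else 0) ≤
      (Fintype.card V : ℝ) ^ (-(a * potential m S)) * (2 ^ Fintype.card X *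
        (8 * c + (2 * M) ^ Fintype.card X * (Fintype.card V : ℝ) ^ (-((1 / m - a) / q)))) := by
  set x : ℝ := (Fintype.card V : ℝ) with hxdef
  have hx : 1 ≤ x := by
    rw [hxdef]
    exact_mod_cast hV
  have hx0 : 0 < x := by linarith
  set w := x ^ (-(a * potential m S)) with hw
  have hw0 : 0 ≤ w := Real.rpow_nonneg hx0.le _
  set η := x ^ (-((1 / m - a) / q)) with hη
  have hη0 : 0 ≤ η := Real.rpow_nonneg hx0.le _
  let g : Finset X → ℝ := fun U =>
    w * x ^ (-((Fintype.card X : ℝ) - U.card)) * (if U.card = 2 then 2 * c else η)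
  have hg : ∀ U, 0 ≤ g U := fun U => by
    have : 0 ≤ (if U.card = 2 then 2 * c else η) := by split_ifs <;> linarith
    exact mul_nonneg (mul_nonneg hw0 (Real.rpow_nonneg hx0.le _)) this
  let P : Finset X → Finset (X → V) := fun U => Fintype.piFinset fun y =>
    if y ∈ U then (if U.card = 2 then e.toFinset else support S) else Finset.univ
  have hterm : ∀ f : X ↪ V,
      (if e ∈ copyOf B f ∧ ¬ copyOf B f ⊆ S then (2 * p) ^ (copyOf B f \ S).card *
        x ^ (-(a * potential m (S ∪ copyOf B f))) else 0) ≤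
      ∑ U : Finset X, if ⇑f ∈ P U then g U else 0 := by
    intro f
    split_ifs with hf
    swap
    · exact Finset.sum_nonneg fun U _ => by split_ifs <;> simp [hg]
    have hint : (copyOf B f ∩ S).Nonempty := ⟨e, Finset.mem_inter.2 ⟨hf.1, heS⟩⟩
    refine (copy_weight_le hm hmd hB hq hz hx hp hc hc2 hpc ha f hint hf.2).trans ?_
    have hmem : ⇑f ∈ P (sharedVertices f S) := by
      refine Fintype.mem_piFinset.2 fun y => ?_
      split_ifs with hy hU
      · exact map_mem_toFinset_of_card_eq_two hB f heS hf.1 hU.le hy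
      · exact (Finset.mem_filter.1 hy).2
      · exact Finset.mem_univ _
    refine le_trans (le_of_eq ?_) (Finset.single_le_sum
      (f := fun U => if ⇑f ∈ P U then g U else 0)
      (fun U _ => by split_ifs <;> simp [hg]) (Finset.mem_univ (sharedVertices f S)))
    rw [if_pos hmem]
  refine (Finset.sum_le_sum fun f _ => hterm f).trans ?_
  rw [Finset.sum_comm]
  have hM : (1 : ℝ) ≤ 2 * M := by
    have : 1 ≤ M := (Finset.card_pos.2 ⟨e, heS⟩).trans_le hS
    have : (1 : ℝ) ≤ M := by exact_mod_cast this
    linarith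
  have hU : ∀ U : Finset X, ∑ f : X ↪ V, (if ⇑f ∈ P U then g U else 0) ≤
      w * (8 * c + (2 * M) ^ Fintype.card X * η) := by
    intro U
    rw [← Finset.sum_filter, Finset.sum_const, nsmul_eq_mul]
    have hcard : ((Finset.univ.filter fun f : X ↪ V => ⇑f ∈ P U).card : ℝ) ≤ (P U).card := by
      exact_mod_cast Finset.card_le_card_of_injOn (fun f : X ↪ V => ⇑f)
        (fun f hf => (Finset.mem_filter.1 hf).2) DFunLike.coe_injective.injOn
    have hPcard : (P U).card = (if U.card = 2 then e.toFinset else support S).card ^ U.card *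
        Fintype.card V ^ (Fintype.card X - U.card) := by
      rw [Fintype.card_piFinset, ← Finset.prod_mul_prod_compl U,
        Finset.prod_congr rfl (fun y hy => by rw [if_pos hy]), Finset.prod_const,
        Finset.prod_congr rfl (fun y hy => by rw [if_neg (Finset.mem_compl.1 hy)]),
        Finset.prod_const, Finset.card_compl, Finset.card_univ]
    have hcancel : x ^ (Fintype.card X - U.card) * x ^ (-((Fintype.card X : ℝ) - U.card)) = 1 := by
      rw [← Nat.cast_sub (Finset.card_le_univ U), ← Real.rpow_natCast, ← Real.rpow_add hx0]
      simp
    refine (mul_le_mul_of_nonneg_right hcard (hg U)).trans ?_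
    rw [hPcard]
    push_cast
    rw [← hxdef]
    have hrw : ∀ k r : ℝ, k ^ U.card * x ^ (Fintype.card X - U.card) *
        (w * x ^ (-((Fintype.card X : ℝ) - U.card)) * r) = w * (k ^ U.card * r) := fun k r => by
      linear_combination k ^ U.card * w * r * hcancel
    dsimp only [g]
    rw [hrw]
    refine mul_le_mul_of_nonneg_left ?_ hw0
    split_ifs with h2
    · have h3 : (e.toFinset.card : ℝ) ≤ 2 := by
        rw [Sym2.card_toFinset]
        split_ifs <;> norm_num
      have h4 : (e.toFinset.card : ℝ) ^ U.card ≤ 4 := by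
        rw [h2]
        nlinarith [(Nat.cast_nonneg _ : (0 : ℝ) ≤ e.toFinset.card)]
      have h5 : 0 ≤ (2 * (M : ℝ)) ^ Fintype.card X * η := by positivity
      nlinarith
    · have h3 : ((support S).card : ℝ) ≤ 2 * M := by
        exact_mod_cast (card_support_le S).trans (Nat.mul_le_mul_left 2 hS)
      have h4 : ((support S).card : ℝ) ^ U.card ≤ (2 * M) ^ Fintype.card X :=
        (pow_le_pow_left₀ (Nat.cast_nonneg _) h3 _).trans
          (pow_le_pow_right₀ hM (Finset.card_le_univ U))
      have h5 := mul_le_mul_of_nonneg_right h4 hη0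
      linarith
  refine (Finset.sum_le_card_nsmul _ _ _ fun U _ => hU U).trans (le_of_eq ?_)
  rw [Finset.card_univ, Fintype.card_finset, nsmul_eq_mul]
  push_cast
  ring

end Step

/-! ### The probability that the random graph is list-Ramsey -/

section Family

variable {ι : Type*} {Y : ι → Type*} [∀ i, DecidableEq (Y i)] {V : Type*} [DecidableEq V]

/-- The copies in `V` of the members of a family of edge sets. -/
def copies (V : Type*) [DecidableEq V] (B : ∀ i, Finset (Sym2 (Y i))) (x : Σ i, Y i ↪ V) :
    Finset (Sym2 V) := copyOf (B x.1) x.2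

omit [∀ i, DecidableEq (Y i)] in
/-- If the members of `B` are contained in those of `F`, then the edge set of a graph that is
list-Ramsey with respect to `F` cannot be coloured. -/
theorem exists_not_listColourable [Finite V] {W : ι → Type*} {F : ∀ i, SimpleGraph (W i)}
    {B : ∀ i, Finset (Sym2 (Y i))} (g : ∀ i, Y i ↪ W i)
    (hg : ∀ i, ∀ e ∈ B i, e.map (g i) ∈ (F i).edgeSet) {G : SimpleGraph V}
    (hG : IsListRamsey F 2 G) :
    ∃ L : Sym2 V → Finset ℕ, (∀ e, (L e).card = 2) ∧
      ¬ ListColourable (copies V B) L (Set.toFinite G.edgeSet).toFinset := by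
  classical
  obtain ⟨L, hL, hG⟩ := hG
  refine ⟨fun e => if h : e ∈ G.edgeSet then L ⟨e, h⟩ else {0, 1}, fun e => ?_, ?_⟩
  · dsimp only
    split_ifs
    exacts [hL _, rfl]
  rintro ⟨c, hc, hmono⟩
  obtain ⟨i, k, ⟨h⟩⟩ := hG (fun e => c e) fun e => by simpa [e.2] using hc e
  have hadj : ∀ e ∈ copies V B ⟨i, (g i).trans ⟨h, h.injective⟩⟩, e ∈ G.edgeSet ∧ c e = k := by
    intro e he
    obtain ⟨e', he', rfl⟩ := Finset.mem_image.1 he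
    have h1 := hg i e' he'
    induction e' with
    | _ a b =>
    have h2 := h.toHom.map_adj (show (F i).Adj (g i a) (g i b) from h1)
    obtain ⟨h3, h4⟩ := (SimpleGraph.EdgeLabeling.labelGraph_adj _ _).1 h2
    exact ⟨h3, h4⟩
  obtain ⟨e, he, hek⟩ := hmono ⟨i, (g i).trans ⟨h, h.injective⟩⟩
    (fun e he => (Set.Finite.mem_toFinset _).2 (hadj e he).1) k
  exact hek (hadj e he).2

variable [∀ i, Fintype (Y i)]

/-- A set of edges that cannot be coloured contains a dense part. -/
theorem exists_potential_neg [Fintype V] {m : ℝ} (hm : 1 < m) {d : ι → ℝ} (hmd : ∀ i, m ≤ d i)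
    {B : ∀ i, Finset (Sym2 (Y i))} (hB : ∀ i, IsPattern (d i) (B i)) {L : Sym2 V → Finset ℕ}
    (hL : ∀ e, (L e).card = 2) {H : Finset (Sym2 V)} (hdiag : ∀ e ∈ H, ¬ e.IsDiag)
    (hH : ¬ ListColourable (copies V B) L H) : ∃ S ⊆ H, S.Nonempty ∧ potential m S < 0 := by
  by_contra hcon
  push Not at hcon
  obtain ⟨c, hc, hsp⟩ := exists_sparse_colouring hdiag hL hm fun Z => by
    set S := H.filter fun e => e ∈ Z.sym2 with hS
    change (S.card : ℝ) ≤ _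
    rcases S.eq_empty_or_nonempty with h | h
    · rw [h]
      have : (0 : ℝ) ≤ Z.card := Nat.cast_nonneg _
      simpa using mul_nonneg (by linarith) this
    · have h1 := hcon S (Finset.filter_subset _ _) h
      have h2 : support S ⊆ Z := fun v hv => by
        obtain ⟨e, he, hve⟩ := mem_support.1 hv
        exact Finset.mem_sym2_iff.1 (Finset.mem_filter.1 he).2 v hve
      have h3 : ((support S).card : ℝ) ≤ Z.card := by exact_mod_cast Finset.card_le_card h2
      unfold potential at h1
      nlinarith
  refine hH ⟨c, hc, ?_⟩
  rintro ⟨i, f⟩ hx k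
  by_contra hmono
  push Not at hmono
  have hsupp : (support (copyOf (B i) f)).card = Fintype.card (Y i) := by
    rw [copyOf, support_image, (hB i).support_eq, Finset.card_image_of_injective _ f.injective,
      Finset.card_univ]
  have h1 := hsp k (support (copyOf (B i) f)) (hsupp ▸ (hB i).three_le)
  have h2 : (copyOf (B i) f).card ≤ edgesIn (colourClass H c k) (support (copyOf (B i) f)) := by
    rw [← edgesIn_support (copyOf (B i) f)]
    exact edgesIn_mono (fun e he => Finset.mem_filter.2 ⟨hx he, hmono e he⟩) le_rfl
  have h3 : ((B i).card : ℝ) ≤ edgesIn (colourClass H c k) (support (copyOf (B i) f)) := by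
    rw [← card_copyOf (B i) f]
    exact_mod_cast h2
  have h4 := (hB i).card_eq
  have h5 : (3 : ℝ) ≤ Fintype.card (Y i) := by exact_mod_cast (hB i).three_le
  rw [hsupp] at h1
  nlinarith [hmd i]

/-- A quantitative bound on the probability that the random graph is list-Ramsey. -/
theorem binomialRandom_isListRamsey_le [Fintype ι] {m : ℝ} (hm : 1 < m) {d : ι → ℝ}
    (hmd : ∀ i, m ≤ d i) {B : ∀ i, Finset (Sym2 (Y i))} (hB : ∀ i, IsPattern (d i) (B i))
    {W : ι → Type*} {F : ∀ i, SimpleGraph (W i)} (g : ∀ i, Y i ↪ W i)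
    (hg : ∀ i, ∀ e ∈ B i, e.map (g i) ∈ (F i).edgeSet) {q : ℕ} (hq : 0 < q) {z : ℤ}
    (hz : q * m = z) {n : ℕ} (hn : 0 < n) {p : I} {c a : ℝ} (hc : 0 ≤ c) (hc2 : 2 * c ≤ 1)
    (hpc : (p : ℝ) ≤ c * (n : ℝ) ^ (-1 / m)) (ha0 : 0 ≤ a) (ha : a ≤ 1 / m) {b T : ℕ}
    (hb : ∀ i, (B i).card ≤ b)
    (hstep : ∑ i, (2 : ℝ) ^ Fintype.card (Y i) * (8 * c +
      (2 * ((1 + T * b : ℕ) : ℝ)) ^ Fintype.card (Y i) * (n : ℝ) ^ (-((1 / m - a) / q))) ≤ 1 / 4) :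
    (SimpleGraph.binomialRandom (Fin n) p).real {G | IsListRamsey F 2 G} ≤
      (n : ℝ) ^ 2 * (p * 2 * ((1 / 2) ^ T + (n : ℝ) ^ (-(a * (2 * m - 1 + 1 / q))))) := by
  classical
  have hm0 : 0 < m := by linarith
  have hp : 0 ≤ (p : ℝ) := p.2.1
  have hn1 : (1 : ℝ) ≤ n := by exact_mod_cast hn
  have hn0 : (0 : ℝ) < n := by linarith
  have hq0 : (0 : ℝ) < q := by exact_mod_cast hq
  have hcardn : Fintype.card (Fin n) = n := Fintype.card_fin n
  let w : Finset (Sym2 (Fin n)) → ℝ := fun S => (n : ℝ) ^ (-(a * potential m S))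
  have hw : ∀ S, 0 ≤ w S := fun S => Real.rpow_nonneg hn0.le _
  have hmono : ∀ (S : Finset (Sym2 (Fin n))) x, (copies (Fin n) B x ∩ S).Nonempty →
      potential m (S ∪ copies (Fin n) B x) ≤ potential m S := fun S x h =>
    potential_union_le hm0.le (hmd x.1) (hB x.1) x.2 h
  have hneg : ∀ S : Finset (Sym2 (Fin n)), potential m S < 0 →
      1 ≤ (n : ℝ) ^ (-(a * (1 / q))) * w S := by
    intro S hS
    have h1 : (q : ℝ) * potential m S = ((z * (support S).card - q * S.card : ℤ) : ℝ) := by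
      unfold potential
      push_cast
      rw [← hz]
      ring
    have h2 : (q : ℝ) * potential m S < 0 := mul_neg_of_pos_of_neg hq0 hS
    rw [h1, Int.cast_lt_zero] at h2
    have h3 : (q : ℝ) * potential m S ≤ -1 := by
      rw [h1]
      exact_mod_cast (by omega : (z * (support S).card - q * S.card : ℤ) ≤ -1)
    have h4 : potential m S ≤ -(1 / q) := by
      rw [← neg_div, le_div_iff₀ hq0]
      linarith
    rw [← Real.rpow_add hn0]
    exact Real.one_le_rpow hn1 (by nlinarith)
  have hstep₂ : ∀ S : Finset (Sym2 (Fin n)), S.card ≤ 1 + T * b → ∀ e ∈ S,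
      ∑ x, (if e ∈ copies (Fin n) B x ∧ ¬ copies (Fin n) B x ⊆ S then
        (2 * (p : ℝ)) ^ (copies (Fin n) B x \ S).card * w (S ∪ copies (Fin n) B x) else 0)
          ≤ 1 / 4 * w S := by
    intro S hS e he
    rw [Fintype.sum_sigma]
    refine le_trans ?_ ((mul_le_mul_of_nonneg_left hstep (hw S)).trans_eq (mul_comm _ _))
    rw [Finset.mul_sum]
    refine Finset.sum_le_sum fun i _ => ?_
    have := sum_copy_weight_le (V := Fin n) hm0 (hmd i) (hB i) hq hz (by rwa [hcardn]) hp hc hc2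
      (by rwa [hcardn]) ha hS he
    rwa [hcardn] at this
  have hstep₁ : ∀ S : Finset (Sym2 (Fin n)), S.card ≤ 1 + T * b → ∀ e ∈ S,
      ∑ x, (if e ∈ copies (Fin n) B x ∧ ¬ copies (Fin n) B x ⊆ S then
        (2 * (p : ℝ)) ^ (copies (Fin n) B x \ S).card else 0) ≤ 1 / 4 := by
    intro S hS e he
    have hwS : 0 < w S := Real.rpow_pos_of_pos hn0 _
    refine le_of_mul_le_mul_right ((?_ : _ ≤ _).trans (hstep₂ S hS e he)) hwS
    rw [Finset.sum_mul]
    refine Finset.sum_le_sum fun x _ => ?_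
    split_ifs with h
    · refine mul_le_mul_of_nonneg_left ?_ (by positivity)
      refine Real.rpow_le_rpow_of_exponent_le hn1 (neg_le_neg ?_)
      exact mul_le_mul_of_nonneg_left (hmono S x ⟨e, Finset.mem_inter.2 ⟨h.1, he⟩⟩) ha0
    · simp
  have hbound : ∀ e : Sym2 (Fin n), ¬ e.IsDiag →
      (SimpleGraph.binomialRandom (Fin n) p).real {G | (({e} : Finset (Sym2 (Fin n))) :
        Set (Sym2 (Fin n))) ⊆ G.edgeSet ∧
          Explored (copies (Fin n) B) (potential m) G.edgeSet T {e} [e]} ≤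
      p * 2 * ((1 / 2) ^ T + (n : ℝ) ^ (-(a * (2 * m - 1 + 1 / q)))) := by
    intro e he
    have h1 := measure_explored_le (K := copies (Fin n) B) (φ := potential m) (w := w)
      (G := fun G : SimpleGraph (Fin n) => G.edgeSet) (b := b) (M := 1 + T * b) hp
      (binomialRandom_subset_le p) (Real.rpow_nonneg hn0.le (-(a * (1 / q)))) hw hneg
      (fun x => (card_copyOf (B x.1) x.2).trans_le (hb x.1)) hstep₁ hstep₂ T {e} [e] (by simp)
      (by simp)
    refine h1.trans (le_of_eq ?_)
    have h2 : potential m {e} = 2 * m - 1 := by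
      have : support {e} = e.toFinset := by simp [support]
      rw [potential, this, Sym2.card_toFinset_of_not_isDiag e he]
      push_cast [Finset.card_singleton]
      ring
    dsimp only [w]
    rw [h2, ← Real.rpow_add hn0]
    simp only [Finset.card_singleton, List.length_singleton, pow_one]
    congr 3
    ring
  have hsub : {G : SimpleGraph (Fin n) | IsListRamsey F 2 G} ⊆
      ⋃ e ∈ Finset.univ.filter fun e : Sym2 (Fin n) => ¬ e.IsDiag,
        {G | (({e} : Finset (Sym2 (Fin n))) : Set (Sym2 (Fin n))) ⊆ G.edgeSet ∧
          Explored (copies (Fin n) B) (potential m) G.edgeSet T {e} [e]} := by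
    intro G hG
    obtain ⟨L, hL, hnot⟩ := exists_not_listColourable g hg hG
    obtain ⟨e, he, hexp⟩ := exists_explored hnot hmono (fun H hH => exists_potential_neg hm hmd hB hL
      fun e he => G.not_isDiag_of_mem_edgeSet ((Set.Finite.mem_toFinset _).1 (hH he))) T
    rw [Set.Finite.mem_toFinset] at he
    refine Set.mem_iUnion₂.2 ⟨e, by simpa using G.not_isDiag_of_mem_edgeSet he, by simpa using he,
      by simpa using hexp⟩
  refine (MeasureTheory.measureReal_mono hsub (MeasureTheory.measure_ne_top _ _)).trans
    ((MeasureTheory.measureReal_biUnion_finset_le _ _).trans ?_)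
  refine (Finset.sum_le_card_nsmul _ _ _ fun e he => hbound e (Finset.mem_filter.1 he).2).trans ?_
  rw [nsmul_eq_mul]
  refine mul_le_mul_of_nonneg_right ?_ ?_
  · have h1 : (Finset.univ.filter fun e : Sym2 (Fin n) => ¬ e.IsDiag).card ≤ n ^ 2 := by
      refine (Finset.card_le_univ _).trans ?_
      refine (Fintype.card_le_of_surjective _ (Sym2.mk_surjective (α := Fin n))).trans ?_
      simp [sq]
    exact_mod_cast h1
  · have := Real.rpow_nonneg hn0.le (-(a * (2 * m - 1 + 1 / q)))
    positivity

end Family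

/-! ### Asymptotics -/

/-- A power of a logarithm is negligible compared with a power. -/
theorem tendsto_explorationSize_pow_mul_rpow (b k : ℕ) {η : ℝ} (hη : 0 < η) :
    Tendsto (fun n : ℕ => (2 * ((1 + ⌈4 * Real.log n⌉₊ * b : ℕ) : ℝ)) ^ k * (n : ℝ) ^ (-η)) atTop
      (𝓝 0) := by
  have h0 : Tendsto (fun n : ℕ => Real.log n ^ (k : ℝ) / (n : ℝ) ^ η) atTop (𝓝 0) :=
    (isLittleO_log_rpow_rpow_atTop (k : ℝ) hη).tendsto_div_nhds_zero.comp
      tendsto_natCast_atTop_atTop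
  have h1 := h0.const_mul ((2 * (1 + 5 * b) : ℝ) ^ k)
  rw [mul_zero] at h1
  refine squeeze_zero' (Eventually.of_forall fun n => by positivity) ?_ h1
  filter_upwards [(Real.tendsto_log_atTop.comp tendsto_natCast_atTop_atTop).eventually_ge_atTop 1,
    eventually_gt_atTop 0] with n hn hn0
  simp only [Function.comp_apply] at hn
  have h2 : (⌈4 * Real.log n⌉₊ : ℝ) ≤ 5 * Real.log n := by
    linarith [Nat.ceil_lt_add_one (show 0 ≤ 4 * Real.log n by linarith)]
  rw [Real.rpow_natCast, Real.rpow_neg (Nat.cast_nonneg _), ← div_eq_mul_inv, ← mul_div_assoc,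
    ← mul_pow]
  refine div_le_div_of_nonneg_right (pow_le_pow_left₀ (by positivity) ?_ k) (by positivity)
  push_cast
  have h3 : (⌈4 * Real.log n⌉₊ : ℝ) * b ≤ 5 * Real.log n * b := by gcongr
  linarith

theorem sq_mul_half_pow_le {n : ℕ} (hn : 0 < n) :
    (n : ℝ) ^ 2 * (1 / 2) ^ ⌈4 * Real.log n⌉₊ ≤ (n : ℝ) ^ (-(1 / 2) : ℝ) := by
  have hn0 : (0 : ℝ) < n := by exact_mod_cast hn
  have hlog : 0 ≤ Real.log n := Real.log_natCast_nonneg n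
  have h1 : ((1 : ℝ) / 2) ^ ⌈4 * Real.log n⌉₊ ≤ (n : ℝ) ^ (-(5 / 2) : ℝ) := by
    rw [Real.rpow_def_of_pos hn0, ← Real.rpow_natCast,
      Real.rpow_def_of_pos (by norm_num : (0 : ℝ) < 1 / 2), Real.exp_le_exp, one_div, Real.log_inv]
    have h2 := Nat.le_ceil (4 * Real.log n)
    nlinarith [Real.log_two_gt_d9]
  calc (n : ℝ) ^ 2 * (1 / 2) ^ ⌈4 * Real.log n⌉₊ ≤ (n : ℝ) ^ (2 : ℝ) * (n : ℝ) ^ (-(5 / 2) : ℝ) := by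
        rw [Real.rpow_two]
        gcongr
    _ = _ := by
        rw [← Real.rpow_add hn0]
        norm_num

/-- The expected number of explorations that last for `⌈4 log n⌉` steps or end in a set of negative
potential tends to zero. -/
theorem tendsto_of_le_exploration_bound {m a c : ℝ} {q : ℕ} (hm : 1 < m)
    (hamq : (2 * m - 1) / m < a * (2 * m - 1 + 1 / q)) {p : ℕ → I}
    (hp : ∀ᶠ n : ℕ in atTop, (p n : ℝ) ≤ c * (n : ℝ) ^ (-1 / m)) {P : ℕ → ℝ} (hP0 : ∀ n, 0 ≤ P n)
    (hP : ∀ᶠ n : ℕ in atTop, P n ≤ (n : ℝ) ^ 2 * (p n * 2 * ((1 / 2) ^ ⌈4 * Real.log n⌉₊ +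
      (n : ℝ) ^ (-(a * (2 * m - 1 + 1 / q)))))) : Tendsto P atTop (𝓝 0) := by
  have h1 : Tendsto (fun n : ℕ => (n : ℝ) ^ (-(1 / 2) : ℝ)) atTop (𝓝 0) :=
    (tendsto_rpow_neg_atTop (by norm_num)).comp tendsto_natCast_atTop_atTop
  have h2 : Tendsto (fun n : ℕ => (n : ℝ) ^ (-(a * (2 * m - 1 + 1 / q) - (2 * m - 1) / m)))
      atTop (𝓝 0) :=
    (tendsto_rpow_neg_atTop (sub_pos.2 hamq)).comp tendsto_natCast_atTop_atTop
  have h3 := (h1.const_mul 2).add (h2.const_mul (2 * c))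
  simp only [mul_zero, add_zero] at h3
  refine squeeze_zero' (Eventually.of_forall hP0) ?_ h3
  filter_upwards [hp, hP, eventually_gt_atTop 0] with n hpn hPn hn
  have hn0 : (0 : ℝ) < n := by exact_mod_cast hn
  have h4 : (p n : ℝ) * ((n : ℝ) ^ 2 * (1 / 2) ^ ⌈4 * Real.log n⌉₊) ≤ 1 * (n : ℝ) ^ (-(1 / 2) : ℝ) :=
    mul_le_mul (p n).2.2 (sq_mul_half_pow_le hn) (by positivity) zero_le_one
  have h5 : (p n : ℝ) * ((n : ℝ) ^ 2 * (n : ℝ) ^ (-(a * (2 * m - 1 + 1 / q)))) ≤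
      c * (n : ℝ) ^ (-(a * (2 * m - 1 + 1 / q) - (2 * m - 1) / m)) := by
    refine (mul_le_mul_of_nonneg_right hpn (by positivity)).trans (le_of_eq ?_)
    rw [mul_assoc, ← Real.rpow_two, ← Real.rpow_add hn0, ← Real.rpow_add hn0]
    congr 2
    have : m ≠ 0 := by linarith
    field_simp
    ring
  refine hPn.trans ?_
  linarith

end ListRamsey

theorem mainTheorem2 {ι : Type*} [Finite ι] [Nonempty ι] {W : ι → Type*} [∀ i, Finite (W i)]
    (F : ∀ i, SimpleGraph (W i)) (hF : 1 < ListRamsey.familyMaxTwoDensity F) :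
    ∃ c₀ : ℝ, 0 < c₀ ∧ ∀ p : ℕ → I,
      (∀ᶠ n : ℕ in atTop,
        (p n : ℝ) ≤ c₀ * (n : ℝ) ^ (-1 / ListRamsey.familyMaxTwoDensity F)) →
      Tendsto (fun n : ℕ => SimpleGraph.binomialRandom (Fin n) (p n)
        {G | ListRamsey.IsListRamsey F 2 G}) atTop (𝓝 0) := by
  classical
  open ListRamsey in
  cases nonempty_fintype ι
  set m := familyMaxTwoDensity F with hm
  have hm0 : 0 < m := by linarith
  have hmd : ∀ i, m ≤ maxTwoDensity (F i) := fun i =>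
    (isLeast_familyMaxTwoDensity F).2 ⟨i, rfl⟩
  choose X B hB hBF using fun i => exists_isPattern (F i) (hF.trans_le (hmd i))
  -- `m` is the 2-density of one of the patterns, hence rational.
  obtain ⟨q, hq, z, hz⟩ : ∃ q : ℕ, 0 < q ∧ ∃ z : ℤ, q * m = z := by
    obtain ⟨i, hi⟩ := (isLeast_familyMaxTwoDensity F).1
    have h3 := (hB i).three_le
    refine ⟨Fintype.card (X i) - 2, by omega, (B i).card - 1, ?_⟩
    have h := (hB i).card_eq
    dsimp only at hi
    rw [hi] at h
    rw [Nat.cast_sub (by omega)]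
    push_cast
    linarith
  have hq0 : (0 : ℝ) < q := by exact_mod_cast hq
  -- An exponent slightly smaller than `1 / m` makes up for the gain `1 / q` of the potential.
  obtain ⟨a, ha1, ha2⟩ : ∃ a, (2 * m - 1) / m / (2 * m - 1 + 1 / q) < a ∧ a < 1 / m := by
    refine exists_between ?_
    have h1 : 0 < 1 / (q : ℝ) := by positivity
    rw [div_div, div_lt_div_iff₀ (mul_pos hm0 (by linarith)) hm0]
    nlinarith [mul_pos hm0 h1]
  have hden : 0 < 2 * m - 1 + 1 / (q : ℝ) := by
    have : 0 < 1 / (q : ℝ) := by positivity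
    linarith
  have ha0 : 0 ≤ a := (div_nonneg (div_nonneg (by linarith) hm0.le) hden.le).trans ha1.le
  rw [div_lt_iff₀ hden] at ha1
  have hη : 0 < (1 / m - a) / q := div_pos (sub_pos.2 ha2) hq0
  -- The constant `c` keeps the contribution of copies that share a single edge below `1 / 4`.
  set D : ℝ := ∑ i, (2 : ℝ) ^ Fintype.card (X i) with hD
  have hD1 : 0 ≤ D := Finset.sum_nonneg fun i _ => by positivity
  set c : ℝ := 1 / (64 * (D + 1)) with hc
  have hc0 : 0 < c := by positivity
  have hcD : c * (64 * (D + 1)) = 1 := by rw [hc]; field_simp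
  have hc2 : 2 * c ≤ 1 := by nlinarith [mul_nonneg hc0.le hD1]
  have hcD' : D * (8 * c) < 1 / 4 := by nlinarith
  obtain ⟨b, hb⟩ : ∃ b, ∀ i, (B i).card ≤ b :=
    ⟨∑ i, (B i).card, fun i => Finset.single_le_sum (f := fun i => (B i).card)
      (fun _ _ => Nat.zero_le _) (Finset.mem_univ i)⟩
  have hstep : Tendsto (fun n : ℕ => ∑ i, (2 : ℝ) ^ Fintype.card (X i) * (8 * c +
      (2 * ((1 + ⌈4 * Real.log n⌉₊ * b : ℕ) : ℝ)) ^ Fintype.card (X i) *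
        (n : ℝ) ^ (-((1 / m - a) / q)))) atTop (𝓝 (∑ i, (2 : ℝ) ^ Fintype.card (X i) *
          (8 * c + 0))) :=
    tendsto_finsetSum _ fun i _ =>
      ((tendsto_explorationSize_pow_mul_rpow b _ hη).const_add _).const_mul _
  simp only [add_zero] at hstep
  rw [← Finset.sum_mul, ← hD] at hstep
  refine ⟨c, hc0, fun p hp => ?_⟩
  have hlim : Tendsto (fun n : ℕ => (SimpleGraph.binomialRandom (Fin n) (p n)).real
      {G | IsListRamsey F 2 G}) atTop (𝓝 0) := by
    refine tendsto_of_le_exploration_bound hF ha1 hp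
      (fun n => MeasureTheory.measureReal_nonneg) ?_
    filter_upwards [hp, hstep.eventually_le_const hcD', eventually_gt_atTop 0] with n hpn hsn hn
    exact binomialRandom_isListRamsey_le hF hmd hB
      (fun i => Function.Embedding.subtype _) hBF hq hz hn hc0.le hc2 hpn ha0 ha2.le hb hsn
  have h := ENNReal.tendsto_ofReal hlim
  simpa using h
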